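/- We work in intensional Martin-Löf type theory with $\Pi$-types (with $\eta$), $\Sigma$-types, $+$, $\mathbf 0$, $\mathbf 1$, $\mathbb N$, identity types, a cumulative hierarchy of universes $\mathcal U_0:\mathcal U_1:\cdots$ closed under these type formers, and $n$-truncations $\|A\|_n$ (with their usual induction principle into families of $n$-types); $\|A\|$ denotes the propositional truncation $\|A\|_{-1}$. A map $e:A\to B$ is an equivalence if it has a left inverse and a right inverse, and $A\simeq B$ is the type of equivalences. Let $\mathcal U$ be one of the universes. For $A:\mathcal U$ let $\mathcal U_A=\sum_{Z:\mathcal U}\|Z=A\|$, and call $A$ rigid if $\mathcal U_A$ is contractible. A type $A$ is $n$-connected if $\|A\|_n$ is contractible. Theorem. The following is derivable in this type theory. Assume univalence for $\mathcal U$ and excluded middle for $\mathcal U$ (that is, $P+\neg P$ for every proposition $P:\mathcal U$). Let $n\ge -1$ be a truncation level, let $X:\mathcal U$ be an $n$-type, and let $A,B:\mathcal U$ be $n$-connected rigid types such that $\neg(X\times A\simeq X\times B)$. Then there is an equivalence $f:\mathcal U\to\mathcal U$ such that $\|f(X\times A)=X\times B\|$. Moreover $\mathcal U_{X\times A}\simeq\mathcal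 U_X\simeq\mathcal U_{X\times B}$. -/

import Mathlib

/-!
Intensional Martin-Löf type theory, as a formal system.

Raw terms are written with de Bruijn indices, and derivability is an inductively generated
predicate on judgments. The type formers are dependent products (with eta), dependent sums,
binary sums, the empty type, the unit type, natural numbers, identity types, an infinite
cumulative hierarchy of universes à la Russell, and the `n`-truncations of homotopy type theory.
Univalence and excluded middle are not part of the formal system: they are types in it,
and a theorem that assumes them has them as hypotheses.
-/

namespace HoTT

/-- Raw terms (types are terms as well). The numbers in the comments tell how many variables an
argument binds; arguments that are not mentioned bind none. -/
inductive Tm : Type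
  /-- the variable with de Bruijn index `k` -/
  | var (k : ℕ)
  /-- the `i`-th universe -/
  | univ (i : ℕ)
  /-- `Π (x : A), B`; `B` binds 1 -/
  | pi (A B : Tm)
  /-- `λ (x : A), b`; `b` binds 1 -/
  | lam (A b : Tm)
  | app (f a : Tm)
  /-- `Σ (x : A), B`; `B` binds 1 -/
  | sigma (A B : Tm)
  | pair (a b : Tm)
  /-- induction on `p : Σ (x : A), B`; `B` and the motive `C` bind 1, `g` binds 2 -/
  | sigmaInd (A B C g p : Tm)
  /-- the binary sum `A + B` -/
  | sum (A B : Tm)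
  | inl (a : Tm)
  | inr (b : Tm)
  /-- induction on `e : A + B`; the motive `C`, and `c` and `d`, bind 1 -/
  | sumInd (A B C c d e : Tm)
  /-- the empty type -/
  | empty
  /-- induction on `e : empty`; the motive `C` binds 1 -/
  | emptyInd (C e : Tm)
  /-- the unit type -/
  | unit
  | star
  /-- induction on `e : unit`; the motive `C` binds 1 -/
  | unitInd (C c e : Tm)
  /-- the natural numbers -/
  | nat
  | zero
  | succ (n : Tm)
  /-- induction on `n : nat`; the motive `C` binds 1, the successor case `s` binds 2 -/
  | natInd (C z s n : Tm)
  /-- the identity type of `a` and `b` in `A` -/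
  | id (A a b : Tm)
  | refl (a : Tm)
  /-- path induction on `p : a = b` in `A`; the motive `C` binds 3, `c` binds 1 -/
  | idInd (A C c a b p : Tm)
  /-- the truncation of `A` at truncation level `k - 2`, where `k` is a term of type `nat` -/
  | trunc (k A : Tm)
  /-- the image of `a` in the truncation of its type -/
  | tr (k a : Tm)
  /-- the witness that `trunc k A` is a `(k - 2)`-type, for `A` in the `i`-th universe -/
  | truncIsTrunc (i : ℕ) (k A : Tm)
  /-- induction on `t : trunc k A`; the motive `C`, the witness `h` that the motive is a family
  of `(k - 2)`-types, and `g`, bind 1 -/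
  | truncInd (k A C h g t : Tm)

/-! ### Substitution -/

/-- Extend a renaming under one binder. -/
def upRen (ρ : ℕ → ℕ) : ℕ → ℕ
  | 0 => 0
  | k + 1 => ρ k + 1

/-- Replace every free variable `k` by the variable `ρ k`. -/
def Tm.rename : Tm → (ℕ → ℕ) → Tm
  | .var k, ρ => .var (ρ k)
  | .univ i, _ => .univ i
  | .pi A B, ρ => .pi (A.rename ρ) (B.rename (upRen ρ))
  | .lam A b, ρ => .lam (A.rename ρ) (b.rename (upRen ρ))
  | .app f a, ρ => .app (f.rename ρ) (a.rename ρ)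
  | .sigma A B, ρ => .sigma (A.rename ρ) (B.rename (upRen ρ))
  | .pair a b, ρ => .pair (a.rename ρ) (b.rename ρ)
  | .sigmaInd A B C g p, ρ =>
      .sigmaInd (A.rename ρ) (B.rename (upRen ρ)) (C.rename (upRen ρ))
        (g.rename (upRen (upRen ρ))) (p.rename ρ)
  | .sum A B, ρ => .sum (A.rename ρ) (B.rename ρ)
  | .inl a, ρ => .inl (a.rename ρ)
  | .inr b, ρ => .inr (b.rename ρ)
  | .sumInd A B C c d e, ρ =>
      .sumInd (A.rename ρ) (B.rename ρ) (C.rename (upRen ρ)) (c.rename (upRen ρ))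
        (d.rename (upRen ρ)) (e.rename ρ)
  | .empty, _ => .empty
  | .emptyInd C e, ρ => .emptyInd (C.rename (upRen ρ)) (e.rename ρ)
  | .unit, _ => .unit
  | .star, _ => .star
  | .unitInd C c e, ρ => .unitInd (C.rename (upRen ρ)) (c.rename ρ) (e.rename ρ)
  | .nat, _ => .nat
  | .zero, _ => .zero
  | .succ n, ρ => .succ (n.rename ρ)
  | .natInd C z s n, ρ =>
      .natInd (C.rename (upRen ρ)) (z.rename ρ) (s.rename (upRen (upRen ρ))) (n.rename ρ)
  | .id A a b, ρ => .id (A.rename ρ) (a.rename ρ) (b.rename ρ)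
  | .refl a, ρ => .refl (a.rename ρ)
  | .idInd A C c a b p, ρ =>
      .idInd (A.rename ρ) (C.rename (upRen (upRen (upRen ρ)))) (c.rename (upRen ρ))
        (a.rename ρ) (b.rename ρ) (p.rename ρ)
  | .trunc k A, ρ => .trunc (k.rename ρ) (A.rename ρ)
  | .tr k a, ρ => .tr (k.rename ρ) (a.rename ρ)
  | .truncIsTrunc i k A, ρ => .truncIsTrunc i (k.rename ρ) (A.rename ρ)
  | .truncInd k A C h g t, ρ =>
      .truncInd (k.rename ρ) (A.rename ρ) (C.rename (upRen ρ)) (h.rename (upRen ρ))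
        (g.rename (upRen ρ)) (t.rename ρ)

/-- Weakening by one variable. -/
def Tm.wk (t : Tm) : Tm := t.rename (fun k => k + 1)

/-- Extend a substitution under one binder. -/
def up (σ : ℕ → Tm) : ℕ → Tm
  | 0 => .var 0
  | k + 1 => (σ k).wk

/-- Simultaneous capture-avoiding substitution of `σ k` for every free variable `k`. -/
def Tm.subst : Tm → (ℕ → Tm) → Tm
  | .var k, σ => σ k
  | .univ i, _ => .univ i
  | .pi A B, σ => .pi (A.subst σ) (B.subst (up σ))
  | .lam A b, σ => .lam (A.subst σ) (b.subst (up σ))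
  | .app f a, σ => .app (f.subst σ) (a.subst σ)
  | .sigma A B, σ => .sigma (A.subst σ) (B.subst (up σ))
  | .pair a b, σ => .pair (a.subst σ) (b.subst σ)
  | .sigmaInd A B C g p, σ =>
      .sigmaInd (A.subst σ) (B.subst (up σ)) (C.subst (up σ)) (g.subst (up (up σ))) (p.subst σ)
  | .sum A B, σ => .sum (A.subst σ) (B.subst σ)
  | .inl a, σ => .inl (a.subst σ)
  | .inr b, σ => .inr (b.subst σ)
  | .sumInd A B C c d e, σ =>
      .sumInd (A.subst σ) (B.subst σ) (C.subst (up σ)) (c.subst (up σ)) (d.subst (up σ))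
        (e.subst σ)
  | .empty, _ => .empty
  | .emptyInd C e, σ => .emptyInd (C.subst (up σ)) (e.subst σ)
  | .unit, _ => .unit
  | .star, _ => .star
  | .unitInd C c e, σ => .unitInd (C.subst (up σ)) (c.subst σ) (e.subst σ)
  | .nat, _ => .nat
  | .zero, _ => .zero
  | .succ n, σ => .succ (n.subst σ)
  | .natInd C z s n, σ =>
      .natInd (C.subst (up σ)) (z.subst σ) (s.subst (up (up σ))) (n.subst σ)
  | .id A a b, σ => .id (A.subst σ) (a.subst σ) (b.subst σ)
  | .refl a, σ => .refl (a.subst σ)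
  | .idInd A C c a b p, σ =>
      .idInd (A.subst σ) (C.subst (up (up (up σ)))) (c.subst (up σ))
        (a.subst σ) (b.subst σ) (p.subst σ)
  | .trunc k A, σ => .trunc (k.subst σ) (A.subst σ)
  | .tr k a, σ => .tr (k.subst σ) (a.subst σ)
  | .truncIsTrunc i k A, σ => .truncIsTrunc i (k.subst σ) (A.subst σ)
  | .truncInd k A C h g t, σ =>
      .truncInd (k.subst σ) (A.subst σ) (C.subst (up σ)) (h.subst (up σ)) (g.subst (up σ))
        (t.subst σ)

/-- The substitution that sends the variable `0` to `a` and the variable `k + 1` to `σ k`. -/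
def scons (a : Tm) (σ : ℕ → Tm) : ℕ → Tm
  | 0 => a
  | k + 1 => σ k

/-- The substitution that weakens by `n` variables. -/
def shift (n : ℕ) : ℕ → Tm := fun k => .var (k + n)

/-- `t[a]`: substitute `a` for the last variable. -/
def Tm.inst (t a : Tm) : Tm := t.subst (scons a (shift 0))

/-- `t[a, b]`: substitute `a` for the last but one variable and `b` for the last one. -/
def Tm.inst₂ (t a b : Tm) : Tm := t.subst (scons b (scons a (shift 0)))

/-- `t[a, b, c]`: substitute `a`, `b`, `c` for the last three variables, `c` for the last one. -/
def Tm.inst₃ (t a b c : Tm) : Tm := t.subst (scons c (scons b (scons a (shift 0))))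

/-- Substitute `a` for the last variable of `t`, where `a` lives in a context with `n` variables
more than the context of the other variables of `t`. -/
def Tm.instWk (n : ℕ) (t a : Tm) : Tm := t.subst (scons a (shift n))

/-! ### Types that are defined in the theory -/

/-- `A → B`. -/
def arrow (A B : Tm) : Tm := .pi A B.wk

/-- `A × B`. -/
def prod (A B : Tm) : Tm := .sigma A B.wk

/-- `¬ A`. -/
def neg (A : Tm) : Tm := arrow A .empty

/-- `A` is contractible: `Σ (x : A), Π (y : A), x = y`. -/
def isContr (A : Tm) : Tm := .sigma A (.pi A.wk (.id A.wk.wk (.var 1) (.var 0)))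

/-- `A` is a proposition: `Π (x y : A), x = y`. -/
def isProp (A : Tm) : Tm := .pi A (.pi A.wk (.id A.wk.wk (.var 1) (.var 0)))

/-- `A`, a type in the `i`-th universe, is a `(k - 2)`-type, where `k` is a term of type `nat`.
By recursion on `k`: a `(-2)`-type is a contractible type, and an `(n + 1)`-type is a type all of
whose identity types are `n`-types. -/
def isTrunc (i : ℕ) (k A : Tm) : Tm :=
  .app
    (.natInd (.pi (.univ i) (.univ i))
      (.lam (.univ i) (isContr (.var 0)))
      -- here the last variable is the predicate for `k`, and the last but one is `k`
      (.lam (.univ i)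
        (.pi (.var 0) (.pi (.var 1) (.app (.var 3) (.id (.var 2) (.var 1) (.var 0))))))
      k)
    A

/-! ### Derivations -/

/-- Contexts; the head of the list is the type of the variable with de Bruijn index `0`. -/
abbrev Ctx : Type := List Tm

/-- The three forms of judgment. -/
inductive Judgment : Type
  /-- `Γ` is a well-formed context -/
  | ctx (Γ : Ctx)
  /-- `Γ ⊢ a : A` -/
  | typed (Γ : Ctx) (a A : Tm)
  /-- `Γ ⊢ a ≡ b : A` (judgmental equality) -/
  | equal (Γ : Ctx) (a b A : Tm)

open Tm Judgment in
/-- The derivable judgments of the type theory. -/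
inductive Derivable : Judgment → Prop
  -- contexts and variables
  | ctx_nil : Derivable (ctx [])
  | ctx_cons {Γ A i} : Derivable (ctx Γ) → Derivable (typed Γ A (univ i)) →
      Derivable (ctx (A :: Γ))
  | variable {Γ k A} : Derivable (ctx Γ) → Γ[k]? = some A →
      Derivable (typed Γ (var k) (A.rename (fun j => j + (k + 1))))
  -- judgmental equality is a congruence
  | eq_refl {Γ a A} : Derivable (typed Γ a A) → Derivable (equal Γ a a A)
  | eq_symm {Γ a b A} : Derivable (equal Γ a b A) → Derivable (equal Γ b a A)
  | eq_trans {Γ a b c A} : Derivable (equal Γ a b A) → Derivable (equal Γ b c A) →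
      Derivable (equal Γ a c A)
  | conv {Γ a A B i} : Derivable (typed Γ a A) → Derivable (equal Γ A B (univ i)) →
      Derivable (typed Γ a B)
  | eq_conv {Γ a b A B i} : Derivable (equal Γ a b A) → Derivable (equal Γ A B (univ i)) →
      Derivable (equal Γ a b B)
  -- universes
  | univ_form {Γ i} : Derivable (ctx Γ) → Derivable (typed Γ (univ i) (univ (i + 1)))
  | univ_cumul {Γ A i} : Derivable (typed Γ A (univ i)) →
      Derivable (typed Γ A (univ (i + 1)))
  | univ_cumul_eq {Γ A B i} : Derivable (equal Γ A B (univ i)) →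
      Derivable (equal Γ A B (univ (i + 1)))
  -- dependent products
  | pi_form {Γ A B i} : Derivable (typed Γ A (univ i)) →
      Derivable (typed (A :: Γ) B (univ i)) → Derivable (typed Γ (pi A B) (univ i))
  | pi_form_eq {Γ A A' B B' i} : Derivable (typed Γ A (univ i)) →
      Derivable (equal Γ A A' (univ i)) → Derivable (equal (A :: Γ) B B' (univ i)) →
      Derivable (equal Γ (pi A B) (pi A' B') (univ i))
  | pi_intro {Γ A B b i} : Derivable (typed Γ A (univ i)) →
      Derivable (typed (A :: Γ) b B) → Derivable (typed Γ (lam A b) (pi A B))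
  | pi_intro_eq {Γ A A' B b b' i} : Derivable (typed Γ A (univ i)) →
      Derivable (equal Γ A A' (univ i)) → Derivable (equal (A :: Γ) b b' B) →
      Derivable (equal Γ (lam A b) (lam A' b') (pi A B))
  | pi_elim {Γ A B f a} : Derivable (typed Γ f (pi A B)) → Derivable (typed Γ a A) →
      Derivable (typed Γ (app f a) (B.inst a))
  | pi_elim_eq {Γ A B f f' a a'} : Derivable (equal Γ f f' (pi A B)) →
      Derivable (equal Γ a a' A) → Derivable (equal Γ (app f a) (app f' a') (B.inst a))
  | pi_comp {Γ A B b a i} : Derivable (typed Γ A (univ i)) →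
      Derivable (typed (A :: Γ) b B) → Derivable (typed Γ a A) →
      Derivable (equal Γ (app (lam A b) a) (b.inst a) (B.inst a))
  | pi_uniq {Γ A B f} : Derivable (typed Γ f (pi A B)) →
      Derivable (equal Γ f (lam A (app f.wk (var 0))) (pi A B))
  -- dependent sums
  | sigma_form {Γ A B i} : Derivable (typed Γ A (univ i)) →
      Derivable (typed (A :: Γ) B (univ i)) → Derivable (typed Γ (sigma A B) (univ i))
  | sigma_form_eq {Γ A A' B B' i} : Derivable (typed Γ A (univ i)) →
      Derivable (equal Γ A A' (univ i)) → Derivable (equal (A :: Γ) B B' (univ i)) →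
      Derivable (equal Γ (sigma A B) (sigma A' B') (univ i))
  | sigma_intro {Γ A B a b i} : Derivable (typed Γ A (univ i)) →
      Derivable (typed (A :: Γ) B (univ i)) →
      Derivable (typed Γ a A) → Derivable (typed Γ b (B.inst a)) →
      Derivable (typed Γ (pair a b) (sigma A B))
  | sigma_intro_eq {Γ A B a a' b b' i} : Derivable (typed Γ A (univ i)) →
      Derivable (typed (A :: Γ) B (univ i)) →
      Derivable (equal Γ a a' A) → Derivable (equal Γ b b' (B.inst a)) →
      Derivable (equal Γ (pair a b) (pair a' b') (sigma A B))
  | sigma_elim {Γ A B C g p i j} : Derivable (typed Γ A (univ i)) →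
      Derivable (typed (A :: Γ) B (univ i)) →
      Derivable (typed (sigma A B :: Γ) C (univ j)) →
      Derivable (typed (B :: A :: Γ) g (C.instWk 2 (pair (var 1) (var 0)))) →
      Derivable (typed Γ p (sigma A B)) →
      Derivable (typed Γ (sigmaInd A B C g p) (C.inst p))
  | sigma_elim_eq {Γ A A' B B' C C' g g' p p' i j} : Derivable (typed Γ A (univ i)) →
      Derivable (typed (A :: Γ) B (univ i)) →
      Derivable (equal Γ A A' (univ i)) → Derivable (equal (A :: Γ) B B' (univ i)) →
      Derivable (equal (sigma A B :: Γ) C C' (univ j)) →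
      Derivable (equal (B :: A :: Γ) g g' (C.instWk 2 (pair (var 1) (var 0)))) →
      Derivable (equal Γ p p' (sigma A B)) →
      Derivable (equal Γ (sigmaInd A B C g p) (sigmaInd A' B' C' g' p') (C.inst p))
  | sigma_comp {Γ A B C g a b i j} : Derivable (typed Γ A (univ i)) →
      Derivable (typed (A :: Γ) B (univ i)) →
      Derivable (typed (sigma A B :: Γ) C (univ j)) →
      Derivable (typed (B :: A :: Γ) g (C.instWk 2 (pair (var 1) (var 0)))) →
      Derivable (typed Γ a A) → Derivable (typed Γ b (B.inst a)) →
      Derivable (equal Γ (sigmaInd A B C g (pair a b)) (g.inst₂ a b) (C.inst (pair a b)))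
  -- binary sums
  | sum_form {Γ A B i} : Derivable (typed Γ A (univ i)) → Derivable (typed Γ B (univ i)) →
      Derivable (typed Γ (sum A B) (univ i))
  | sum_form_eq {Γ A A' B B' i} : Derivable (equal Γ A A' (univ i)) →
      Derivable (equal Γ B B' (univ i)) → Derivable (equal Γ (sum A B) (sum A' B') (univ i))
  | sum_inl {Γ A B a i} : Derivable (typed Γ A (univ i)) → Derivable (typed Γ B (univ i)) →
      Derivable (typed Γ a A) → Derivable (typed Γ (inl a) (sum A B))
  | sum_inl_eq {Γ A B a a' i} : Derivable (typed Γ A (univ i)) →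
      Derivable (typed Γ B (univ i)) → Derivable (equal Γ a a' A) →
      Derivable (equal Γ (inl a) (inl a') (sum A B))
  | sum_inr {Γ A B b i} : Derivable (typed Γ A (univ i)) → Derivable (typed Γ B (univ i)) →
      Derivable (typed Γ b B) → Derivable (typed Γ (inr b) (sum A B))
  | sum_inr_eq {Γ A B b b' i} : Derivable (typed Γ A (univ i)) →
      Derivable (typed Γ B (univ i)) → Derivable (equal Γ b b' B) →
      Derivable (equal Γ (inr b) (inr b') (sum A B))
  | sum_elim {Γ A B C c d e i j} : Derivable (typed Γ A (univ i)) →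
      Derivable (typed Γ B (univ i)) → Derivable (typed (sum A B :: Γ) C (univ j)) →
      Derivable (typed (A :: Γ) c (C.instWk 1 (inl (var 0)))) →
      Derivable (typed (B :: Γ) d (C.instWk 1 (inr (var 0)))) →
      Derivable (typed Γ e (sum A B)) →
      Derivable (typed Γ (sumInd A B C c d e) (C.inst e))
  | sum_elim_eq {Γ A A' B B' C C' c c' d d' e e' i j} : Derivable (typed Γ A (univ i)) →
      Derivable (typed Γ B (univ i)) →
      Derivable (equal Γ A A' (univ i)) → Derivable (equal Γ B B' (univ i)) →
      Derivable (equal (sum A B :: Γ) C C' (univ j)) →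
      Derivable (equal (A :: Γ) c c' (C.instWk 1 (inl (var 0)))) →
      Derivable (equal (B :: Γ) d d' (C.instWk 1 (inr (var 0)))) →
      Derivable (equal Γ e e' (sum A B)) →
      Derivable (equal Γ (sumInd A B C c d e) (sumInd A' B' C' c' d' e') (C.inst e))
  | sum_comp_inl {Γ A B C c d a i j} : Derivable (typed Γ A (univ i)) →
      Derivable (typed Γ B (univ i)) → Derivable (typed (sum A B :: Γ) C (univ j)) →
      Derivable (typed (A :: Γ) c (C.instWk 1 (inl (var 0)))) →
      Derivable (typed (B :: Γ) d (C.instWk 1 (inr (var 0)))) →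
      Derivable (typed Γ a A) →
      Derivable (equal Γ (sumInd A B C c d (inl a)) (c.inst a) (C.inst (inl a)))
  | sum_comp_inr {Γ A B C c d b i j} : Derivable (typed Γ A (univ i)) →
      Derivable (typed Γ B (univ i)) → Derivable (typed (sum A B :: Γ) C (univ j)) →
      Derivable (typed (A :: Γ) c (C.instWk 1 (inl (var 0)))) →
      Derivable (typed (B :: Γ) d (C.instWk 1 (inr (var 0)))) →
      Derivable (typed Γ b B) →
      Derivable (equal Γ (sumInd A B C c d (inr b)) (d.inst b) (C.inst (inr b)))
  -- the empty type
  | empty_form {Γ i} : Derivable (ctx Γ) → Derivable (typed Γ empty (univ i))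
  | empty_elim {Γ C e j} : Derivable (typed (empty :: Γ) C (univ j)) →
      Derivable (typed Γ e empty) → Derivable (typed Γ (emptyInd C e) (C.inst e))
  | empty_elim_eq {Γ C C' e e' j} : Derivable (equal (empty :: Γ) C C' (univ j)) →
      Derivable (equal Γ e e' empty) →
      Derivable (equal Γ (emptyInd C e) (emptyInd C' e') (C.inst e))
  -- the unit type
  | unit_form {Γ i} : Derivable (ctx Γ) → Derivable (typed Γ unit (univ i))
  | unit_intro {Γ} : Derivable (ctx Γ) → Derivable (typed Γ star unit)
  | unit_elim {Γ C c e j} : Derivable (typed (unit :: Γ) C (univ j)) →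
      Derivable (typed Γ c (C.inst star)) → Derivable (typed Γ e unit) →
      Derivable (typed Γ (unitInd C c e) (C.inst e))
  | unit_elim_eq {Γ C C' c c' e e' j} : Derivable (equal (unit :: Γ) C C' (univ j)) →
      Derivable (equal Γ c c' (C.inst star)) → Derivable (equal Γ e e' unit) →
      Derivable (equal Γ (unitInd C c e) (unitInd C' c' e') (C.inst e))
  | unit_comp {Γ C c j} : Derivable (typed (unit :: Γ) C (univ j)) →
      Derivable (typed Γ c (C.inst star)) →
      Derivable (equal Γ (unitInd C c star) c (C.inst star))
  -- the natural numbers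
  | nat_form {Γ i} : Derivable (ctx Γ) → Derivable (typed Γ nat (univ i))
  | nat_zero {Γ} : Derivable (ctx Γ) → Derivable (typed Γ zero nat)
  | nat_succ {Γ n} : Derivable (typed Γ n nat) → Derivable (typed Γ (succ n) nat)
  | nat_succ_eq {Γ n n'} : Derivable (equal Γ n n' nat) →
      Derivable (equal Γ (succ n) (succ n') nat)
  | nat_elim {Γ C z s n j} : Derivable (typed (nat :: Γ) C (univ j)) →
      Derivable (typed Γ z (C.inst zero)) →
      Derivable (typed (C :: nat :: Γ) s (C.instWk 2 (succ (var 1)))) →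
      Derivable (typed Γ n nat) → Derivable (typed Γ (natInd C z s n) (C.inst n))
  | nat_elim_eq {Γ C C' z z' s s' n n' j} : Derivable (typed (nat :: Γ) C (univ j)) →
      Derivable (equal (nat :: Γ) C C' (univ j)) →
      Derivable (equal Γ z z' (C.inst zero)) →
      Derivable (equal (C :: nat :: Γ) s s' (C.instWk 2 (succ (var 1)))) →
      Derivable (equal Γ n n' nat) →
      Derivable (equal Γ (natInd C z s n) (natInd C' z' s' n') (C.inst n))
  | nat_comp_zero {Γ C z s j} : Derivable (typed (nat :: Γ) C (univ j)) →
      Derivable (typed Γ z (C.inst zero)) →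
      Derivable (typed (C :: nat :: Γ) s (C.instWk 2 (succ (var 1)))) →
      Derivable (equal Γ (natInd C z s zero) z (C.inst zero))
  | nat_comp_succ {Γ C z s n j} : Derivable (typed (nat :: Γ) C (univ j)) →
      Derivable (typed Γ z (C.inst zero)) →
      Derivable (typed (C :: nat :: Γ) s (C.instWk 2 (succ (var 1)))) →
      Derivable (typed Γ n nat) →
      Derivable (equal Γ (natInd C z s (succ n)) (s.inst₂ n (natInd C z s n))
        (C.inst (succ n)))
  -- identity types
  | id_form {Γ A a b i} : Derivable (typed Γ A (univ i)) → Derivable (typed Γ a A) →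
      Derivable (typed Γ b A) → Derivable (typed Γ (id A a b) (univ i))
  | id_form_eq {Γ A A' a a' b b' i} : Derivable (equal Γ A A' (univ i)) →
      Derivable (equal Γ a a' A) → Derivable (equal Γ b b' A) →
      Derivable (equal Γ (id A a b) (id A' a' b') (univ i))
  | id_intro {Γ A a i} : Derivable (typed Γ A (univ i)) → Derivable (typed Γ a A) →
      Derivable (typed Γ (refl a) (id A a a))
  | id_intro_eq {Γ A a a' i} : Derivable (typed Γ A (univ i)) → Derivable (equal Γ a a' A) →
      Derivable (equal Γ (refl a) (refl a') (id A a a))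
  | id_elim {Γ A C c a b p i j} : Derivable (typed Γ A (univ i)) →
      Derivable (typed (id A.wk.wk (var 1) (var 0) :: A.wk :: A :: Γ) C (univ j)) →
      Derivable (typed (A :: Γ) c
        (C.subst (scons (refl (var 0)) (scons (var 0) (scons (var 0) (shift 1)))))) →
      Derivable (typed Γ a A) → Derivable (typed Γ b A) → Derivable (typed Γ p (id A a b)) →
      Derivable (typed Γ (idInd A C c a b p) (C.inst₃ a b p))
  | id_elim_eq {Γ A A' C C' c c' a a' b b' p p' i j} : Derivable (typed Γ A (univ i)) →
      Derivable (equal Γ A A' (univ i)) →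
      Derivable (equal (id A.wk.wk (var 1) (var 0) :: A.wk :: A :: Γ) C C' (univ j)) →
      Derivable (equal (A :: Γ) c c'
        (C.subst (scons (refl (var 0)) (scons (var 0) (scons (var 0) (shift 1)))))) →
      Derivable (equal Γ a a' A) → Derivable (equal Γ b b' A) →
      Derivable (equal Γ p p' (id A a b)) →
      Derivable (equal Γ (idInd A C c a b p) (idInd A' C' c' a' b' p') (C.inst₃ a b p))
  | id_comp {Γ A C c a i j} : Derivable (typed Γ A (univ i)) →
      Derivable (typed (id A.wk.wk (var 1) (var 0) :: A.wk :: A :: Γ) C (univ j)) →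
      Derivable (typed (A :: Γ) c
        (C.subst (scons (refl (var 0)) (scons (var 0) (scons (var 0) (shift 1)))))) →
      Derivable (typed Γ a A) →
      Derivable (equal Γ (idInd A C c a a (refl a)) (c.inst a) (C.inst₃ a a (refl a)))
  -- truncations: `trunc k A` is the free `(k - 2)`-type on the type `A`
  | trunc_form {Γ k A i} : Derivable (typed Γ k nat) → Derivable (typed Γ A (univ i)) →
      Derivable (typed Γ (trunc k A) (univ i))
  | trunc_form_eq {Γ k k' A A' i} : Derivable (equal Γ k k' nat) →
      Derivable (equal Γ A A' (univ i)) →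
      Derivable (equal Γ (trunc k A) (trunc k' A') (univ i))
  | trunc_intro {Γ k A a i} : Derivable (typed Γ k nat) → Derivable (typed Γ A (univ i)) →
      Derivable (typed Γ a A) → Derivable (typed Γ (tr k a) (trunc k A))
  | trunc_intro_eq {Γ k k' A a a' i} : Derivable (typed Γ A (univ i)) →
      Derivable (equal Γ k k' nat) → Derivable (equal Γ a a' A) →
      Derivable (equal Γ (tr k a) (tr k' a') (trunc k A))
  | trunc_isTrunc {Γ k A i} : Derivable (typed Γ k nat) → Derivable (typed Γ A (univ i)) →
      Derivable (typed Γ (truncIsTrunc i k A) (isTrunc i k (trunc k A)))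
  | trunc_isTrunc_eq {Γ k k' A A' i} : Derivable (equal Γ k k' nat) →
      Derivable (equal Γ A A' (univ i)) →
      Derivable (equal Γ (truncIsTrunc i k A) (truncIsTrunc i k' A') (isTrunc i k (trunc k A)))
  | trunc_elim {Γ k A C h g t i j} : Derivable (typed Γ k nat) →
      Derivable (typed Γ A (univ i)) → Derivable (typed (trunc k A :: Γ) C (univ j)) →
      Derivable (typed (trunc k A :: Γ) h (isTrunc j k.wk C)) →
      Derivable (typed (A :: Γ) g (C.instWk 1 (tr k.wk (var 0)))) →
      Derivable (typed Γ t (trunc k A)) →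
      Derivable (typed Γ (truncInd k A C h g t) (C.inst t))
  | trunc_elim_eq {Γ k k' A A' C C' h h' g g' t t' i j} : Derivable (typed Γ k nat) →
      Derivable (typed Γ A (univ i)) →
      Derivable (equal Γ k k' nat) → Derivable (equal Γ A A' (univ i)) →
      Derivable (equal (trunc k A :: Γ) C C' (univ j)) →
      Derivable (equal (trunc k A :: Γ) h h' (isTrunc j k.wk C)) →
      Derivable (equal (A :: Γ) g g' (C.instWk 1 (tr k.wk (var 0)))) →
      Derivable (equal Γ t t' (trunc k A)) →
      Derivable (equal Γ (truncInd k A C h g t) (truncInd k' A' C' h' g' t') (C.inst t))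
  | trunc_comp {Γ k A C h g a i j} : Derivable (typed Γ k nat) →
      Derivable (typed Γ A (univ i)) → Derivable (typed (trunc k A :: Γ) C (univ j)) →
      Derivable (typed (trunc k A :: Γ) h (isTrunc j k.wk C)) →
      Derivable (typed (A :: Γ) g (C.instWk 1 (tr k.wk (var 0)))) →
      Derivable (typed Γ a A) →
      Derivable (equal Γ (truncInd k A C h g (tr k a)) (g.inst a) (C.inst (tr k a)))

/-! ### The notions of the theorem, as types in the theory -/

/-- `e : A → B` is an equivalence: it has a right inverse `s` and a left inverse `r`, that is
`(Σ (s : B → A), Π (y : B), e (s y) = y) × (Σ (r : B → A), Π (x : A), r (e x) = x)`. -/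
def isEquiv (A B e : Tm) : Tm :=
  prod
    (.sigma (arrow B A)
      (.pi B.wk (.id B.wk.wk (.app e.wk.wk (.app (.var 1) (.var 0))) (.var 0))))
    (.sigma (arrow B A)
      (.pi A.wk (.id A.wk.wk (.app (.var 1) (.app e.wk.wk (.var 0))) (.var 0))))

/-- `A ≃ B`: the type of equivalences. -/
def equiv (A B : Tm) : Tm := .sigma (arrow A B) (isEquiv A.wk B.wk (.var 0))

/-- The identity equivalence of `A`. -/
def idEquiv (A : Tm) : Tm :=
  .pair (.lam A (.var 0))
    (.pair (.pair (.lam A (.var 0)) (.lam A (.refl (.var 0))))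
      (.pair (.lam A (.var 0)) (.lam A (.refl (.var 0)))))

/-- The canonical map `(A = B) → (A ≃ B)`, for `A` and `B` in the `i`-th universe; it is defined
by path induction and sends `refl` to the identity equivalence. -/
def idToEquiv (i : ℕ) (A B : Tm) : Tm :=
  .lam (.id (.univ i) A B)
    (.idInd (.univ i) (equiv (.var 2) (.var 1)) (idEquiv (.var 0)) A.wk B.wk (.var 0))

/-- The univalence axiom for the `i`-th universe: for all `A` and `B` in it, the canonical map
`(A = B) → (A ≃ B)` is an equivalence. -/
def univalence (i : ℕ) : Tm :=
  .pi (.univ i) (.pi (.univ i)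
    (isEquiv (.id (.univ i) (.var 1) (.var 0)) (equiv (.var 1) (.var 0))
      (idToEquiv i (.var 1) (.var 0))))

/-- The law of excluded middle for the `i`-th universe: `P + ¬ P` for all propositions `P`. -/
def excludedMiddle (i : ℕ) : Tm :=
  .pi (.univ i) (arrow (isProp (.var 0)) (.sum (.var 0) (neg (.var 0))))

/-- The propositional truncation `‖A‖`, that is the truncation at level `-1`. -/
def propTrunc (A : Tm) : Tm := .trunc (.succ .zero) A

/-- `A` is `(k - 2)`-connected: its `(k - 2)`-truncation is contractible. -/
def isConnected (k A : Tm) : Tm := isContr (.trunc k A)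

/-- The connected component `Σ (Z : U), ‖Z = A‖` of `A` in the `i`-th universe `U`. -/
def component (i : ℕ) (A : Tm) : Tm :=
  .sigma (.univ i) (propTrunc (.id (.univ i) (.var 0) A.wk))

/-- `A`, a type in the `i`-th universe, is rigid: its component in that universe is
contractible. -/
def isRigid (i : ℕ) (A : Tm) : Tm := isContr (component i A)

/-- The type of the automorphisms `f` of the `i`-th universe `U` such that `‖f A = B‖`:
`Σ (f : U → U), isEquiv f × ‖f A = B‖`. -/
def automorphismSending (i : ℕ) (A B : Tm) : Tm :=
  .sigma (arrow (.univ i) (.univ i))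
    (prod (isEquiv (.univ i) (.univ i) (.var 0))
      (propTrunc (.id (.univ i) (.app (.var 0) A.wk) B.wk)))

end HoTT

/-! ### Metatheory of the formal system: substitution, functionality and presuppositions. -/

namespace HoTT

/-! ### The calculus of substitutions -/

/-! The mathematics. Write T for the n-truncation. Since X is an n-type and A is n-connected, the
first projection of X × A is, up to equivalence, its truncation map: T(X × A) = X, and every fiber
of X × A → T(X × A) equals A (`truncProdEntry`, `fiberTrEntry`). Now let Y be merely equal to X × A.
Each fiber of Y → TY is then merely equal to A, and rigidity of A turns a mere identification with A
into an actual one (`rigidPathEntry`). As Y is the total space of these fibers, Y = TY × A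
(`decomposeEntry`). So Z ↦ TZ and V ↦ V × A are mutually inverse between the components of X × A and
of X, and likewise for B. This half does not need excluded middle.

For the automorphism, excluded middle decides whether Z lies in the component of X × A, in that of X
× B, or in neither; the two components are disjoint because X × A and X × B are not equivalent. Let
f send Z to TZ × B on the first component, to TZ × A on the second, and to Z elsewhere. By the
decomposition f(f(Z)) = Z in all cases, so f is its own inverse, and f(X × A) = T(X × A) × B = X × B
(`swapInvolutionEntry`, `exchangeBackEntry`, `automorphismEntry`). Univalence supplies the
identifications of types, induction on equivalences, and the fragment of function extensionality by
which being truncated is a proposition.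

The formalization. The claim is that a term is derivable in a deeply embedded type theory, and such
derivations are too large to write by hand. They are obtained by reflection: `Exp.ev` is a fuelled
type checker and normalizer for annotated expressions, and `ev_sound` shows that whatever it accepts
is derivable after erasure. The soundness proof rests on stability under substitution
(`SubstClass.stable`), congruence of terms under equal substitutions (`Derivable.functional`) and
well-typedness of everything that a derivable judgment mentions (`Derivable.presupposition`). Since
the checker types every reduct again, neither confluence nor subject reduction nor injectivity of
type formers has to be proved.

The internal proof is a library of entries in a higher-order input language. An elaborator about
which nothing is proved turns each entry into an annotated expression, and the kernel evaluates both
elaborator and checker. Universe levels are relative to a base level, so one check covers every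
universe. At the end the elaborated statement is compared with the intended one (`mainExp_eqb`,
`erase_mainStatement`). -/

@[simp] theorem scons_zero (a : Tm) (σ : ℕ → Tm) : scons a σ 0 = a := rfl

@[simp] theorem scons_succ (a : Tm) (σ : ℕ → Tm) (k : ℕ) : scons a σ (k + 1) = σ k := rfl

@[simp] theorem up_zero (σ : ℕ → Tm) : up σ 0 = .var 0 := rfl

@[simp] theorem up_succ (σ : ℕ → Tm) (k : ℕ) : up σ (k + 1) = (σ k).wk := rfl

@[simp] theorem upRen_zero (ρ : ℕ → ℕ) : upRen ρ 0 = 0 := rfl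

@[simp] theorem upRen_succ (ρ : ℕ → ℕ) (k : ℕ) : upRen ρ (k + 1) = ρ k + 1 := rfl

theorem up_var (ρ : ℕ → ℕ) : up (fun k => .var (ρ k)) = fun k => .var (upRen ρ k) := by
  funext k; cases k <;> rfl

/-- Weakening has to be a renaming because `up` uses it before substitution is available. Seen as a
substitution, it falls under the composition laws below. -/
theorem rename_eq_subst (t : Tm) (ρ : ℕ → ℕ) : t.rename ρ = t.subst fun k => .var (ρ k) := by
  induction t generalizing ρ <;> simp_all [Tm.rename, Tm.subst, up_var]

theorem up_ids : up Tm.var = Tm.var := by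
  funext k; cases k <;> rfl

theorem subst_ids (t : Tm) : t.subst Tm.var = t := by
  induction t <;> simp_all [Tm.subst, up_ids]

theorem wk_eq (t : Tm) : t.wk = t.subst (shift 1) := rename_eq_subst t _

theorem up_comp_ren (ρ : ℕ → ℕ) (σ : ℕ → Tm) :
    (fun k => up σ (upRen ρ k)) = up fun k => σ (ρ k) := by
  funext k; cases k <;> rfl

theorem subst_rename (t : Tm) (ρ : ℕ → ℕ) (σ : ℕ → Tm) :
    (t.rename ρ).subst σ = t.subst fun k => σ (ρ k) := by
  induction t generalizing ρ σ <;> simp_all [Tm.rename, Tm.subst, up_comp_ren]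

theorem upRen_comp (ρ τ : ℕ → ℕ) :
    (fun k => upRen τ (upRen ρ k)) = upRen fun k => τ (ρ k) := by
  funext k; cases k <;> rfl

theorem rename_rename (t : Tm) (ρ τ : ℕ → ℕ) :
    (t.rename ρ).rename τ = t.rename fun k => τ (ρ k) := by
  induction t generalizing ρ τ <;> simp_all [Tm.rename, upRen_comp]

theorem up_rename (σ : ℕ → Tm) (ρ : ℕ → ℕ) :
    (fun k => (up σ k).rename (upRen ρ)) = up fun k => (σ k).rename ρ := by
  funext k; cases k <;> simp [Tm.rename, Tm.wk, rename_rename]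

theorem rename_subst (t : Tm) (σ : ℕ → Tm) (ρ : ℕ → ℕ) :
    (t.subst σ).rename ρ = t.subst fun k => (σ k).rename ρ := by
  induction t generalizing ρ σ <;> simp_all [Tm.rename, Tm.subst, up_rename]

theorem up_subst (σ τ : ℕ → Tm) :
    (fun k => (up σ k).subst (up τ)) = up fun k => (σ k).subst τ := by
  funext k; cases k <;> simp [Tm.subst, Tm.wk, subst_rename, rename_subst]

/-- Under a binder the claim concerns `up`, which involves weakening; hence the compositions with
renamings on either side have to come first. -/
theorem subst_subst (t : Tm) (σ τ : ℕ → Tm) :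
    (t.subst σ).subst τ = t.subst fun k => (σ k).subst τ := by
  induction t generalizing σ τ <;> simp_all [Tm.subst, up_subst]

theorem subst_wk (t : Tm) (σ : ℕ → Tm) : t.wk.subst σ = t.subst fun k => σ (k + 1) :=
  subst_rename t _ _

theorem wk_subst (t : Tm) (σ : ℕ → Tm) : (t.subst σ).wk = t.subst fun k => (σ k).wk :=
  rename_subst t _ _

theorem wk_subst_up (t : Tm) (σ : ℕ → Tm) : t.wk.subst (up σ) = (t.subst σ).wk := by
  rw [subst_wk, wk_subst]; rfl

theorem subst_congr (t : Tm) {σ τ : ℕ → Tm} (h : ∀ k, σ k = τ k) : t.subst σ = t.subst τ := by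
  rw [funext h]

theorem shift_zero : shift 0 = Tm.var := rfl

@[simp] theorem shift_apply (n k : ℕ) : shift n k = .var (k + n) := rfl

theorem wk_inst (t a : Tm) : t.wk.inst a = t := by
  rw [Tm.inst, subst_wk]; exact subst_ids t

theorem rename_add_eq (t : Tm) (n : ℕ) : t.rename (fun j => j + n) = t.subst (shift n) :=
  rename_eq_subst _ _

/-- This law and its variants move a substitution past the kinds of instantiation that occur in the
derivation rules, so that substituted premises again have the shape which the rule demands. -/
theorem inst_subst (t a : Tm) (σ : ℕ → Tm) :
    (t.inst a).subst σ = (t.subst (up σ)).inst (a.subst σ) := by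
  simp only [Tm.inst, subst_subst]
  refine subst_congr _ fun k => ?_
  cases k with
  | zero => rfl
  | succ k => exact (wk_inst (σ k) _).symm

theorem inst₂_subst (t a b : Tm) (σ : ℕ → Tm) :
    (t.inst₂ a b).subst σ = (t.subst (up (up σ))).inst₂ (a.subst σ) (b.subst σ) := by
  simp only [Tm.inst₂, subst_subst]
  refine subst_congr _ fun k => ?_
  rcases k with _ | _ | k
  · rfl
  · rfl
  · simp [Tm.subst, subst_wk]; exact (subst_ids _).symm

theorem inst₃_subst (t a b c : Tm) (σ : ℕ → Tm) :
    (t.inst₃ a b c).subst σ =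
      (t.subst (up (up (up σ)))).inst₃ (a.subst σ) (b.subst σ) (c.subst σ) := by
  simp only [Tm.inst₃, subst_subst]
  refine subst_congr _ fun k => ?_
  rcases k with _ | _ | _ | k
  · rfl
  · rfl
  · rfl
  · simp [Tm.subst, subst_wk]; exact (subst_ids _).symm

theorem instWk_one_subst (t a : Tm) (σ : ℕ → Tm) :
    (t.instWk 1 a).subst (up σ) = (t.subst (up σ)).instWk 1 (a.subst (up σ)) := by
  simp only [Tm.instWk, subst_subst]
  refine subst_congr _ fun k => ?_
  cases k with
  | zero => rfl
  | succ k => simp [Tm.subst, wk_eq, subst_subst]; rfl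

theorem instWk_two_subst (t a : Tm) (σ : ℕ → Tm) :
    (t.instWk 2 a).subst (up (up σ)) = (t.subst (up σ)).instWk 2 (a.subst (up (up σ))) := by
  simp only [Tm.instWk, subst_subst]
  refine subst_congr _ fun k => ?_
  cases k with
  | zero => rfl
  | succ k => simp [Tm.subst, wk_eq, subst_subst]

theorem reflInst_subst (t : Tm) (σ : ℕ → Tm) :
    (t.subst (scons (.refl (.var 0)) (scons (.var 0) (scons (.var 0) (shift 1))))).subst (up σ) =
      (t.subst (up (up (up σ)))).subst
        (scons (.refl (.var 0)) (scons (.var 0) (scons (.var 0) (shift 1)))) := by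
  simp only [subst_subst]
  refine subst_congr _ fun k => ?_
  rcases k with _ | _ | _ | k
  · rfl
  · rfl
  · rfl
  · simp [Tm.subst, wk_eq, subst_subst]; rfl

/-- The recursion that defines truncatedness is a closed function, so the substitution reaches only
the level and the type. -/
theorem isTrunc_subst (i : ℕ) (k A : Tm) (σ : ℕ → Tm) :
    (isTrunc i k A).subst σ = isTrunc i (k.subst σ) (A.subst σ) := by
  simp [isTrunc, isContr, Tm.subst, Tm.wk, Tm.rename]

end HoTT

namespace HoTT

open Judgment Derivable

/-! ### Substitution preserves derivability -/

/-- A class of substitutions between contexts under which derivability is to be preserved. -/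
structure SubstClass (K : Ctx → (ℕ → Tm) → Ctx → Prop) : Prop where
  var {Δ σ Γ k A} : K Δ σ Γ → Derivable (ctx Δ) → Γ[k]? = some A →
    Derivable (typed Δ (σ k) ((A.rename fun j => j + (k + 1)).subst σ))
  up {Δ σ Γ A i} : K Δ σ Γ → Derivable (ctx Δ) → Derivable (typed Δ (A.subst σ) (.univ i)) →
    K (A.subst σ :: Δ) (up σ) (A :: Γ)
  wk {Δ σ Γ A i} : K Δ σ Γ → Derivable (ctx Δ) → Derivable (typed Δ A (.univ i)) →
    K (A :: Δ) (fun k => (σ k).wk) Γ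

/-- The judgment remains derivable under the substitutions of the class `K`. -/
def Judgment.StableUnder (K : Ctx → (ℕ → Tm) → Ctx → Prop) : Judgment → Prop
  | ctx _ => True
  | typed Γ a A => ∀ Δ σ, Derivable (ctx Δ) → K Δ σ Γ →
      Derivable (typed Δ (a.subst σ) (A.subst σ))
  | equal Γ a b A => ∀ Δ σ, Derivable (ctx Δ) → K Δ σ Γ →
      Derivable (equal Δ (a.subst σ) (b.subst σ) (A.subst σ))

/-- The motive of path induction lives over three extra variables, and the well-formedness of their
types is not a premise of the rule; it is derived again after substitution. The stability of `A` is
used along weakened substitutions, which is why the class is required to be closed under weakening.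
-/
theorem SubstClass.path_ctx {K Δ σ Γ A i} (hK : SubstClass K) (hΔ : Derivable (ctx Δ))
    (hσ : K Δ σ Γ) (hA : (typed Γ A (.univ i)).StableUnder K) :
    Derivable (ctx ((Tm.id A.wk.wk (.var 1) (.var 0)).subst (HoTT.up (HoTT.up σ)) ::
      A.wk.subst (HoTT.up σ) :: A.subst σ :: Δ)) ∧
    K ((Tm.id A.wk.wk (.var 1) (.var 0)).subst (HoTT.up (HoTT.up σ)) ::
      A.wk.subst (HoTT.up σ) :: A.subst σ :: Δ) (HoTT.up (HoTT.up (HoTT.up σ)))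
      (Tm.id A.wk.wk (.var 1) (.var 0) :: A.wk :: A :: Γ) := by
  have h0 := hA _ _ hΔ hσ
  have c1 := ctx_cons hΔ h0
  have k1 := hK.up hσ hΔ h0
  have h1 : Derivable (typed (A.subst σ :: Δ) (A.wk.subst (HoTT.up σ)) (.univ i)) := by
    have := hA _ _ c1 (hK.wk hσ hΔ h0)
    rwa [← wk_subst, ← wk_subst_up] at this
  have c2 := ctx_cons c1 h1
  have k2 := hK.up k1 c1 h1
  have h2 : Derivable (typed (A.wk.subst (HoTT.up σ) :: A.subst σ :: Δ)
      (A.wk.wk.subst (HoTT.up (HoTT.up σ))) (.univ i)) := by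
    have := hA _ _ c2 (hK.wk (hK.wk hσ hΔ h0) c1 h1)
    rwa [← wk_subst (σ := fun k => (σ k).wk), ← wk_subst, ← wk_subst_up, ← wk_subst_up] at this
  have v1 : Derivable (typed (A.wk.subst (HoTT.up σ) :: A.subst σ :: Δ) (.var 1)
      (A.wk.wk.subst (HoTT.up (HoTT.up σ)))) := by
    have := Derivable.variable c2 (k := 1) rfl
    rw [rename_add_eq] at this
    simp only [wk_eq, subst_subst, up_succ, Tm.subst, shift_apply] at this ⊢
    exact this
  have v0 : Derivable (typed (A.wk.subst (HoTT.up σ) :: A.subst σ :: Δ) (.var 0)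
      (A.wk.wk.subst (HoTT.up (HoTT.up σ)))) := by
    have := Derivable.variable c2 (k := 0) rfl
    rw [rename_add_eq] at this
    simp only [wk_eq, subst_subst, up_succ, Tm.subst, shift_apply] at this ⊢
    exact this
  have h3 : Derivable (typed (A.wk.subst (HoTT.up σ) :: A.subst σ :: Δ)
      ((Tm.id A.wk.wk (.var 1) (.var 0)).subst (HoTT.up (HoTT.up σ))) (.univ i)) :=
    id_form h2 v1 v0
  exact ⟨ctx_cons c2 h3, hK.up k2 c2 h3⟩

/-- One induction over all rules serves twice: applied to renamings it yields weakening, and with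
weakening available the typed substitutions form such a class as well. Each binder needs only that
the substituted domain is again a type, so that the target context can be extended. -/
theorem SubstClass.stable {K} (hK : SubstClass K) {J : Judgment} (h : Derivable J) :
    J.StableUnder K := by
  induction h with
  | ctx_nil => trivial
  | ctx_cons => trivial
  | eq_refl _ ih => intro Δ σ hΔ hσ; exact eq_refl (ih _ _ hΔ hσ)
  | eq_symm _ ih => intro Δ σ hΔ hσ; exact eq_symm (ih _ _ hΔ hσ)
  | eq_trans _ _ ih ih' => intro Δ σ hΔ hσ; exact eq_trans (ih _ _ hΔ hσ) (ih' _ _ hΔ hσ)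
  | conv _ _ ih ih' => intro Δ σ hΔ hσ; exact conv (ih _ _ hΔ hσ) (ih' _ _ hΔ hσ)
  | eq_conv _ _ ih ih' => intro Δ σ hΔ hσ; exact eq_conv (ih _ _ hΔ hσ) (ih' _ _ hΔ hσ)
  | univ_form => intro Δ σ hΔ hσ; exact univ_form hΔ
  | univ_cumul _ ih => intro Δ σ hΔ hσ; exact univ_cumul (ih _ _ hΔ hσ)
  | univ_cumul_eq _ ih => intro Δ σ hΔ hσ; exact univ_cumul_eq (ih _ _ hΔ hσ)
  | pi_form _ _ ihA ihB =>
    intro Δ σ hΔ hσ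
    have a := ihA _ _ hΔ hσ
    exact pi_form a (ihB _ _ (ctx_cons hΔ a) (hK.up hσ hΔ a))
  | pi_form_eq _ _ _ ihA ihA' ihB =>
    intro Δ σ hΔ hσ
    have a := ihA _ _ hΔ hσ
    exact pi_form_eq a (ihA' _ _ hΔ hσ) (ihB _ _ (ctx_cons hΔ a) (hK.up hσ hΔ a))
  | pi_intro _ _ ihA ihB =>
    intro Δ σ hΔ hσ
    have a := ihA _ _ hΔ hσ
    exact pi_intro a (ihB _ _ (ctx_cons hΔ a) (hK.up hσ hΔ a))
  | pi_intro_eq _ _ _ ihA ihA' ihB =>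
    intro Δ σ hΔ hσ
    have a := ihA _ _ hΔ hσ
    exact pi_intro_eq a (ihA' _ _ hΔ hσ) (ihB _ _ (ctx_cons hΔ a) (hK.up hσ hΔ a))
  | pi_elim _ _ ihf iha =>
    intro Δ σ hΔ hσ
    rw [inst_subst]
    exact pi_elim (ihf _ _ hΔ hσ) (iha _ _ hΔ hσ)
  | pi_elim_eq _ _ ihf iha =>
    intro Δ σ hΔ hσ
    rw [inst_subst]
    exact pi_elim_eq (ihf _ _ hΔ hσ) (iha _ _ hΔ hσ)
  | pi_comp _ _ _ ihA ihb iha =>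
    intro Δ σ hΔ hσ
    rw [inst_subst, inst_subst]
    have a := ihA _ _ hΔ hσ
    exact pi_comp a (ihb _ _ (ctx_cons hΔ a) (hK.up hσ hΔ a)) (iha _ _ hΔ hσ)
  | pi_uniq _ ih =>
    intro Δ σ hΔ hσ
    simp only [Tm.subst, wk_subst_up]
    exact pi_uniq (ih _ _ hΔ hσ)
  | sigma_form _ _ ihA ihB =>
    intro Δ σ hΔ hσ
    have a := ihA _ _ hΔ hσ
    exact sigma_form a (ihB _ _ (ctx_cons hΔ a) (hK.up hσ hΔ a))
  | sigma_form_eq _ _ _ ihA ihA' ihB =>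
    intro Δ σ hΔ hσ
    have a := ihA _ _ hΔ hσ
    exact sigma_form_eq a (ihA' _ _ hΔ hσ) (ihB _ _ (ctx_cons hΔ a) (hK.up hσ hΔ a))
  | sigma_intro _ _ _ _ ihA ihB iha ihb =>
    intro Δ σ hΔ hσ
    have a := ihA _ _ hΔ hσ
    have b := ihb _ _ hΔ hσ
    rw [inst_subst] at b
    exact sigma_intro a (ihB _ _ (ctx_cons hΔ a) (hK.up hσ hΔ a)) (iha _ _ hΔ hσ) b
  | sigma_intro_eq _ _ _ _ ihA ihB iha ihb =>
    intro Δ σ hΔ hσ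
    have a := ihA _ _ hΔ hσ
    have b := ihb _ _ hΔ hσ
    rw [inst_subst] at b
    exact sigma_intro_eq a (ihB _ _ (ctx_cons hΔ a) (hK.up hσ hΔ a)) (iha _ _ hΔ hσ) b
  | sigma_elim _ _ _ _ _ ihA ihB ihC ihg ihp =>
    intro Δ σ hΔ hσ
    have a := ihA _ _ hΔ hσ
    have ca := ctx_cons hΔ a
    have ka := hK.up hσ hΔ a
    have b := ihB _ _ ca ka
    have s := sigma_form a b
    have g := ihg _ _ (ctx_cons ca b) (hK.up ka ca b)
    rw [instWk_two_subst] at g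
    rw [inst_subst]
    exact sigma_elim a b (ihC _ _ (ctx_cons hΔ s) (hK.up (A := .sigma _ _) hσ hΔ s)) g (ihp _ _ hΔ hσ)
  | sigma_elim_eq _ _ _ _ _ _ _ ihA ihB ihA' ihB' ihC ihg ihp =>
    intro Δ σ hΔ hσ
    have a := ihA _ _ hΔ hσ
    have ca := ctx_cons hΔ a
    have ka := hK.up hσ hΔ a
    have b := ihB _ _ ca ka
    have s := sigma_form a b
    have g := ihg _ _ (ctx_cons ca b) (hK.up ka ca b)
    rw [instWk_two_subst] at g
    rw [inst_subst]
    exact sigma_elim_eq a b (ihA' _ _ hΔ hσ) (ihB' _ _ ca ka)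
      (ihC _ _ (ctx_cons hΔ s) (hK.up (A := .sigma _ _) hσ hΔ s)) g (ihp _ _ hΔ hσ)
  | sigma_comp _ _ _ _ _ _ ihA ihB ihC ihg iha ihb =>
    intro Δ σ hΔ hσ
    have a := ihA _ _ hΔ hσ
    have ca := ctx_cons hΔ a
    have ka := hK.up hσ hΔ a
    have b := ihB _ _ ca ka
    have s := sigma_form a b
    have g := ihg _ _ (ctx_cons ca b) (hK.up ka ca b)
    rw [instWk_two_subst] at g
    have b' := ihb _ _ hΔ hσ
    rw [inst_subst] at b'
    rw [inst_subst, inst₂_subst]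
    exact sigma_comp a b (ihC _ _ (ctx_cons hΔ s) (hK.up (A := .sigma _ _) hσ hΔ s)) g (iha _ _ hΔ hσ) b'
  | sum_form _ _ ihA ihB =>
    intro Δ σ hΔ hσ
    exact sum_form (ihA _ _ hΔ hσ) (ihB _ _ hΔ hσ)
  | sum_form_eq _ _ ihA ihB =>
    intro Δ σ hΔ hσ
    exact sum_form_eq (ihA _ _ hΔ hσ) (ihB _ _ hΔ hσ)
  | sum_inl _ _ _ ihA ihB iha =>
    intro Δ σ hΔ hσ
    exact sum_inl (ihA _ _ hΔ hσ) (ihB _ _ hΔ hσ) (iha _ _ hΔ hσ)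
  | sum_inl_eq _ _ _ ihA ihB iha =>
    intro Δ σ hΔ hσ
    exact sum_inl_eq (ihA _ _ hΔ hσ) (ihB _ _ hΔ hσ) (iha _ _ hΔ hσ)
  | sum_inr _ _ _ ihA ihB iha =>
    intro Δ σ hΔ hσ
    exact sum_inr (ihA _ _ hΔ hσ) (ihB _ _ hΔ hσ) (iha _ _ hΔ hσ)
  | sum_inr_eq _ _ _ ihA ihB iha =>
    intro Δ σ hΔ hσ
    exact sum_inr_eq (ihA _ _ hΔ hσ) (ihB _ _ hΔ hσ) (iha _ _ hΔ hσ)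
  | sum_elim _ _ _ _ _ _ ihA ihB ihC ihc ihd ihe =>
    intro Δ σ hΔ hσ
    have a := ihA _ _ hΔ hσ
    have b := ihB _ _ hΔ hσ
    have s := sum_form a b
    have c := ihc _ _ (ctx_cons hΔ a) (hK.up hσ hΔ a)
    have d := ihd _ _ (ctx_cons hΔ b) (hK.up hσ hΔ b)
    rw [instWk_one_subst] at c d
    rw [inst_subst]
    exact sum_elim a b (ihC _ _ (ctx_cons hΔ s) (hK.up (A := .sum _ _) hσ hΔ s)) c d (ihe _ _ hΔ hσ)
  | sum_elim_eq _ _ _ _ _ _ _ _ ihA ihB ihA' ihB' ihC ihc ihd ihe =>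
    intro Δ σ hΔ hσ
    have a := ihA _ _ hΔ hσ
    have b := ihB _ _ hΔ hσ
    have s := sum_form a b
    have c := ihc _ _ (ctx_cons hΔ a) (hK.up hσ hΔ a)
    have d := ihd _ _ (ctx_cons hΔ b) (hK.up hσ hΔ b)
    rw [instWk_one_subst] at c d
    rw [inst_subst]
    exact sum_elim_eq a b (ihA' _ _ hΔ hσ) (ihB' _ _ hΔ hσ) (ihC _ _ (ctx_cons hΔ s) (hK.up (A := .sum _ _) hσ hΔ s)) c d (ihe _ _ hΔ hσ)
  | sum_comp_inl _ _ _ _ _ _ ihA ihB ihC ihc ihd ihe =>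
    intro Δ σ hΔ hσ
    have a := ihA _ _ hΔ hσ
    have b := ihB _ _ hΔ hσ
    have s := sum_form a b
    have c := ihc _ _ (ctx_cons hΔ a) (hK.up hσ hΔ a)
    have d := ihd _ _ (ctx_cons hΔ b) (hK.up hσ hΔ b)
    rw [instWk_one_subst] at c d
    rw [inst_subst, inst_subst]
    exact sum_comp_inl a b (ihC _ _ (ctx_cons hΔ s) (hK.up (A := .sum _ _) hσ hΔ s)) c d (ihe _ _ hΔ hσ)
  | sum_comp_inr _ _ _ _ _ _ ihA ihB ihC ihc ihd ihe =>
    intro Δ σ hΔ hσ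
    have a := ihA _ _ hΔ hσ
    have b := ihB _ _ hΔ hσ
    have s := sum_form a b
    have c := ihc _ _ (ctx_cons hΔ a) (hK.up hσ hΔ a)
    have d := ihd _ _ (ctx_cons hΔ b) (hK.up hσ hΔ b)
    rw [instWk_one_subst] at c d
    rw [inst_subst, inst_subst]
    exact sum_comp_inr a b (ihC _ _ (ctx_cons hΔ s) (hK.up (A := .sum _ _) hσ hΔ s)) c d (ihe _ _ hΔ hσ)
  | empty_form => intro Δ σ hΔ hσ; exact empty_form hΔ
  | empty_elim _ _ ihC ihe =>
    intro Δ σ hΔ hσ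
    rw [inst_subst]
    have s := empty_form (i := 0) hΔ
    exact empty_elim (ihC _ _ (ctx_cons hΔ s) (hK.up (A := .empty) hσ hΔ s)) (ihe _ _ hΔ hσ)
  | empty_elim_eq _ _ ihC ihe =>
    intro Δ σ hΔ hσ
    rw [inst_subst]
    have s := empty_form (i := 0) hΔ
    exact empty_elim_eq (ihC _ _ (ctx_cons hΔ s) (hK.up (A := .empty) hσ hΔ s)) (ihe _ _ hΔ hσ)
  | unit_form => intro Δ σ hΔ hσ; exact unit_form hΔ
  | unit_intro => intro Δ σ hΔ hσ; exact unit_intro hΔ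
  | unit_elim _ _ _ ihC ihc ihe =>
    intro Δ σ hΔ hσ
    have c := ihc _ _ hΔ hσ
    rw [inst_subst] at c ⊢
    have s := unit_form (i := 0) hΔ
    exact unit_elim (ihC _ _ (ctx_cons hΔ s) (hK.up (A := .unit) hσ hΔ s)) c (ihe _ _ hΔ hσ)
  | unit_elim_eq _ _ _ ihC ihc ihe =>
    intro Δ σ hΔ hσ
    have c := ihc _ _ hΔ hσ
    rw [inst_subst] at c ⊢
    have s := unit_form (i := 0) hΔ
    exact unit_elim_eq (ihC _ _ (ctx_cons hΔ s) (hK.up (A := .unit) hσ hΔ s)) c (ihe _ _ hΔ hσ)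
  | unit_comp _ _ ihC ihc =>
    intro Δ σ hΔ hσ
    have c := ihc _ _ hΔ hσ
    rw [inst_subst] at c ⊢
    have s := unit_form (i := 0) hΔ
    exact unit_comp (ihC _ _ (ctx_cons hΔ s) (hK.up (A := .unit) hσ hΔ s)) c
  | nat_form => intro Δ σ hΔ hσ; exact nat_form hΔ
  | nat_zero => intro Δ σ hΔ hσ; exact nat_zero hΔ
  | nat_succ _ ih => intro Δ σ hΔ hσ; exact nat_succ (ih _ _ hΔ hσ)
  | nat_succ_eq _ ih => intro Δ σ hΔ hσ; exact nat_succ_eq (ih _ _ hΔ hσ)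
  | nat_elim _ _ _ _ ihC ihz ihs ihn =>
    intro Δ σ hΔ hσ
    have n := nat_form (i := 0) hΔ
    have cn := ctx_cons hΔ n
    have kn := hK.up (A := .nat) hσ hΔ n
    have c := ihC _ _ cn kn
    have z := ihz _ _ hΔ hσ
    have s := ihs _ _ (ctx_cons cn c) (hK.up kn cn c)
    rw [instWk_two_subst] at s
    rw [inst_subst] at z ⊢
    exact nat_elim c z s (ihn _ _ hΔ hσ)
  | nat_elim_eq _ _ _ _ _ ihC ihC' ihz ihs ihn =>
    intro Δ σ hΔ hσ
    have n := nat_form (i := 0) hΔ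
    have cn := ctx_cons hΔ n
    have kn := hK.up (A := .nat) hσ hΔ n
    have c := ihC _ _ cn kn
    have z := ihz _ _ hΔ hσ
    have s := ihs _ _ (ctx_cons cn c) (hK.up kn cn c)
    rw [instWk_two_subst] at s
    rw [inst_subst] at z ⊢
    exact nat_elim_eq c (ihC' _ _ cn kn) z s (ihn _ _ hΔ hσ)
  | nat_comp_zero _ _ _ ihC ihz ihs =>
    intro Δ σ hΔ hσ
    have n := nat_form (i := 0) hΔ
    have cn := ctx_cons hΔ n
    have kn := hK.up (A := .nat) hσ hΔ n
    have c := ihC _ _ cn kn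
    have z := ihz _ _ hΔ hσ
    have s := ihs _ _ (ctx_cons cn c) (hK.up kn cn c)
    rw [instWk_two_subst] at s
    rw [inst_subst] at z ⊢
    exact nat_comp_zero c z s
  | nat_comp_succ _ _ _ _ ihC ihz ihs ihn =>
    intro Δ σ hΔ hσ
    have n := nat_form (i := 0) hΔ
    have cn := ctx_cons hΔ n
    have kn := hK.up (A := .nat) hσ hΔ n
    have c := ihC _ _ cn kn
    have z := ihz _ _ hΔ hσ
    have s := ihs _ _ (ctx_cons cn c) (hK.up kn cn c)
    rw [instWk_two_subst] at s
    rw [inst_subst] at z ⊢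
    rw [inst₂_subst]
    exact nat_comp_succ c z s (ihn _ _ hΔ hσ)
  | id_form _ _ _ ihA iha ihb =>
    intro Δ σ hΔ hσ
    exact id_form (ihA _ _ hΔ hσ) (iha _ _ hΔ hσ) (ihb _ _ hΔ hσ)
  | id_form_eq _ _ _ ihA iha ihb =>
    intro Δ σ hΔ hσ
    exact id_form_eq (ihA _ _ hΔ hσ) (iha _ _ hΔ hσ) (ihb _ _ hΔ hσ)
  | id_intro _ _ ihA iha =>
    intro Δ σ hΔ hσ
    exact id_intro (ihA _ _ hΔ hσ) (iha _ _ hΔ hσ)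
  | id_intro_eq _ _ ihA iha =>
    intro Δ σ hΔ hσ
    exact id_intro_eq (ihA _ _ hΔ hσ) (iha _ _ hΔ hσ)
  | id_elim _ _ _ _ _ _ ihA ihC ihc iha ihb ihp =>
    intro Δ σ hΔ hσ
    have a := ihA _ _ hΔ hσ
    obtain ⟨cp, kp⟩ := hK.path_ctx hΔ hσ ihA
    have c := ihC _ _ cp kp
    simp only [Tm.subst, wk_subst_up] at c
    have d := ihc _ _ (ctx_cons hΔ a) (hK.up hσ hΔ a)
    rw [reflInst_subst] at d
    rw [inst₃_subst]
    exact id_elim a c d (iha _ _ hΔ hσ) (ihb _ _ hΔ hσ) (ihp _ _ hΔ hσ)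
  | id_elim_eq _ _ _ _ _ _ _ ihA ihA' ihC ihc iha ihb ihp =>
    intro Δ σ hΔ hσ
    have a := ihA _ _ hΔ hσ
    obtain ⟨cp, kp⟩ := hK.path_ctx hΔ hσ ihA
    have c := ihC _ _ cp kp
    simp only [Tm.subst, wk_subst_up] at c
    have d := ihc _ _ (ctx_cons hΔ a) (hK.up hσ hΔ a)
    rw [reflInst_subst] at d
    rw [inst₃_subst]
    exact id_elim_eq a (ihA' _ _ hΔ hσ) c d (iha _ _ hΔ hσ) (ihb _ _ hΔ hσ) (ihp _ _ hΔ hσ)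
  | id_comp _ _ _ _ ihA ihC ihc iha =>
    intro Δ σ hΔ hσ
    have a := ihA _ _ hΔ hσ
    obtain ⟨cp, kp⟩ := hK.path_ctx hΔ hσ ihA
    have c := ihC _ _ cp kp
    simp only [Tm.subst, wk_subst_up] at c
    have d := ihc _ _ (ctx_cons hΔ a) (hK.up hσ hΔ a)
    rw [reflInst_subst] at d
    rw [inst₃_subst, inst_subst]
    exact id_comp a c d (iha _ _ hΔ hσ)
  | trunc_form _ _ ihk ihA =>
    intro Δ σ hΔ hσ
    exact trunc_form (ihk _ _ hΔ hσ) (ihA _ _ hΔ hσ)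
  | trunc_form_eq _ _ ihk ihA =>
    intro Δ σ hΔ hσ
    exact trunc_form_eq (ihk _ _ hΔ hσ) (ihA _ _ hΔ hσ)
  | trunc_intro _ _ _ ihk ihA iha =>
    intro Δ σ hΔ hσ
    exact trunc_intro (ihk _ _ hΔ hσ) (ihA _ _ hΔ hσ) (iha _ _ hΔ hσ)
  | trunc_intro_eq _ _ _ ihA ihk iha =>
    intro Δ σ hΔ hσ
    exact trunc_intro_eq (ihA _ _ hΔ hσ) (ihk _ _ hΔ hσ) (iha _ _ hΔ hσ)
  | trunc_isTrunc _ _ ihk ihA =>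
    intro Δ σ hΔ hσ
    rw [isTrunc_subst]
    exact trunc_isTrunc (ihk _ _ hΔ hσ) (ihA _ _ hΔ hσ)
  | trunc_isTrunc_eq _ _ ihk ihA =>
    intro Δ σ hΔ hσ
    rw [isTrunc_subst]
    exact trunc_isTrunc_eq (ihk _ _ hΔ hσ) (ihA _ _ hΔ hσ)
  | trunc_elim _ _ _ _ _ _ ihk ihA ihC ihh ihg iht =>
    intro Δ σ hΔ hσ
    have k := ihk _ _ hΔ hσ
    have a := ihA _ _ hΔ hσ
    have s := trunc_form k a
    have cs := ctx_cons hΔ s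
    have ks := hK.up (A := .trunc _ _) hσ hΔ s
    have c := ihC _ _ cs ks
    have h := ihh _ _ cs ks
    rw [isTrunc_subst, wk_subst_up] at h
    have g := ihg _ _ (ctx_cons hΔ a) (hK.up hσ hΔ a)
    rw [instWk_one_subst, Tm.subst, wk_subst_up] at g
    rw [inst_subst]
    exact trunc_elim k a c h g (iht _ _ hΔ hσ)
  | trunc_elim_eq _ _ _ _ _ _ _ _ ihk ihA ihk' ihA' ihC ihh ihg iht =>
    intro Δ σ hΔ hσ
    have k := ihk _ _ hΔ hσ
    have a := ihA _ _ hΔ hσ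
    have s := trunc_form k a
    have cs := ctx_cons hΔ s
    have ks := hK.up (A := .trunc _ _) hσ hΔ s
    have c := ihC _ _ cs ks
    have h := ihh _ _ cs ks
    rw [isTrunc_subst, wk_subst_up] at h
    have g := ihg _ _ (ctx_cons hΔ a) (hK.up hσ hΔ a)
    rw [instWk_one_subst, Tm.subst, wk_subst_up] at g
    rw [inst_subst]
    exact trunc_elim_eq k a (ihk' _ _ hΔ hσ) (ihA' _ _ hΔ hσ) c h g (iht _ _ hΔ hσ)
  | trunc_comp _ _ _ _ _ _ ihk ihA ihC ihh ihg iha =>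
    intro Δ σ hΔ hσ
    have k := ihk _ _ hΔ hσ
    have a := ihA _ _ hΔ hσ
    have s := trunc_form k a
    have cs := ctx_cons hΔ s
    have ks := hK.up (A := .trunc _ _) hσ hΔ s
    have c := ihC _ _ cs ks
    have h := ihh _ _ cs ks
    rw [isTrunc_subst, wk_subst_up] at h
    have g := ihg _ _ (ctx_cons hΔ a) (hK.up hσ hΔ a)
    rw [instWk_one_subst, Tm.subst, wk_subst_up] at g
    rw [inst_subst, inst_subst]
    exact trunc_comp k a c h g (iha _ _ hΔ hσ)
  -- The variable rule is the only one left.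
  | _ => rename_i hk _; intro Δ σ hΔ hσ; exact hK.var hσ hΔ hk

end HoTT

namespace HoTT

open Judgment Derivable

/-! ### Weakening and substitution -/

/-- The context of a judgment. -/
def Judgment.context : Judgment → Ctx
  | ctx Γ => Γ
  | typed Γ _ _ => Γ
  | equal Γ _ _ _ => Γ

theorem Derivable.ctx_of {J : Judgment} (h : Derivable J) : Derivable (ctx J.context) := by
  induction h <;> first
    | exact ctx_nil
    | (apply ctx_cons <;> assumption)
    | assumption

/-- `σ` renames the variables of `Γ` to variables of `Δ`. -/
def IsRenaming (Δ : Ctx) (σ : ℕ → Tm) (Γ : Ctx) : Prop :=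
  ∃ ρ : ℕ → ℕ, (σ = fun k => .var (ρ k)) ∧ ∀ k A, Γ[k]? = some A →
    ∃ B, Δ[ρ k]? = some B ∧ B.subst (shift (ρ k + 1)) = (A.subst (shift (k + 1))).subst σ

/-- Being a renaming is a syntactic condition on the two contexts, so passing under binders and
weakening require no derivations. This breaks the circle between weakening and substitution. -/
theorem isRenaming_substClass : SubstClass IsRenaming where
  var := by
    rintro Δ _ Γ k A ⟨ρ, rfl, h⟩ hΔ hk
    obtain ⟨B, hB, e⟩ := h k A hk
    rw [rename_add_eq, ← e, ← rename_add_eq]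
    exact Derivable.variable hΔ hB
  up := by
    rintro Δ _ Γ A i ⟨ρ, rfl, h⟩ - -
    refine ⟨upRen ρ, up_var ρ, fun k B hk => ?_⟩
    cases k with
    | zero =>
      obtain rfl : A = B := by simpa using hk
      refine ⟨_, rfl, ?_⟩
      simp only [subst_subst]; rfl
    | succ k =>
      obtain ⟨C, hC, e⟩ := h k B (by simpa using hk)
      refine ⟨C, by simpa using hC, ?_⟩
      have e' := congrArg Tm.wk e
      simp only [wk_eq, subst_subst] at e'
      simp only [subst_subst]
      exact e'
  wk := by
    rintro Δ _ Γ A i ⟨ρ, rfl, h⟩ - -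
    refine ⟨fun k => ρ k + 1, rfl, fun k B hk => ?_⟩
    obtain ⟨C, hC, e⟩ := h k B hk
    refine ⟨C, by simpa using hC, ?_⟩
    have e' := congrArg Tm.wk e
    simp only [wk_eq, subst_subst] at e'
    simp only [subst_subst]
    exact e'

theorem isRenaming_shift_one (Γ : Ctx) (B : Tm) : IsRenaming (B :: Γ) (shift 1) Γ :=
  ⟨fun k => k + 1, rfl, fun k A hk => ⟨A, by simpa using hk, by simp only [subst_subst]; rfl⟩⟩

theorem Derivable.weaken {Γ a A B i} (h : Derivable (typed Γ a A))
    (hB : Derivable (typed Γ B (.univ i))) : Derivable (typed (B :: Γ) a.wk A.wk) := by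
  rw [wk_eq, wk_eq]
  exact isRenaming_substClass.stable h _ _ (ctx_cons hB.ctx_of hB) (isRenaming_shift_one Γ B)

theorem Derivable.weaken_eq {Γ a b A B i} (h : Derivable (equal Γ a b A))
    (hB : Derivable (typed Γ B (.univ i))) : Derivable (equal (B :: Γ) a.wk b.wk A.wk) := by
  rw [wk_eq, wk_eq, wk_eq]
  exact isRenaming_substClass.stable h _ _ (ctx_cons hB.ctx_of hB) (isRenaming_shift_one Γ B)

/-- `σ` sends the variables of `Γ` to terms of the corresponding types in the context `Δ`. -/
def IsSubst (Δ : Ctx) (σ : ℕ → Tm) (Γ : Ctx) : Prop :=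
  ∀ k A, Γ[k]? = some A → Derivable (typed Δ (σ k) (A.subst fun j => σ (j + (k + 1))))

/-- Passing under a binder weakens the derivations of the terms `σ k`; this is where the weakening
obtained from renamings is needed. -/
theorem isSubst_substClass : SubstClass IsSubst where
  var := by
    intro Δ σ Γ k A h hΔ hk
    rw [subst_rename]
    exact h k A hk
  up := by
    intro Δ σ Γ A i h hΔ hA k B hk
    cases k with
    | zero =>
      obtain rfl : A = B := by simpa using hk
      have := Derivable.variable (ctx_cons hΔ hA) (k := 0) rfl
      rw [rename_add_eq, ← wk_eq, wk_subst] at this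
      exact this
    | succ k =>
      have := (h k B (by simpa using hk)).weaken hA
      rw [wk_subst] at this
      exact this
  wk := by
    intro Δ σ Γ A i h hΔ hA k B hk
    have := (h k B hk).weaken hA
    rw [wk_subst] at this
    exact this

theorem isSubst_ids {Γ : Ctx} (hΓ : Derivable (ctx Γ)) : IsSubst Γ Tm.var Γ := by
  intro k A hk
  have := Derivable.variable hΓ hk
  rw [rename_add_eq] at this
  exact this

theorem IsSubst.scons {Δ σ Γ a A} (h : IsSubst Δ σ Γ) (ha : Derivable (typed Δ a (A.subst σ))) :
    IsSubst Δ (scons a σ) (A :: Γ) := by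
  intro k B hk
  cases k with
  | zero =>
    obtain rfl : A = B := by simpa using hk
    exact ha
  | succ k => exact h k B (by simpa using hk)

theorem IsSubst.weaken {Δ σ Γ A i} (h : IsSubst Δ σ Γ) (hA : Derivable (typed Δ A (.univ i))) :
    IsSubst (A :: Δ) (fun k => (σ k).wk) Γ :=
  isSubst_substClass.wk h hA.ctx_of hA

theorem Derivable.subst {Δ σ Γ a A} (h : Derivable (typed Γ a A)) (hΔ : Derivable (ctx Δ))
    (hσ : IsSubst Δ σ Γ) : Derivable (typed Δ (a.subst σ) (A.subst σ)) :=
  isSubst_substClass.stable h _ _ hΔ hσ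

theorem Derivable.subst_eq {Δ σ Γ a b A} (h : Derivable (equal Γ a b A)) (hΔ : Derivable (ctx Δ))
    (hσ : IsSubst Δ σ Γ) : Derivable (equal Δ (a.subst σ) (b.subst σ) (A.subst σ)) :=
  isSubst_substClass.stable h _ _ hΔ hσ

theorem isSubst_inst {Γ a A} (ha : Derivable (typed Γ a A)) :
    IsSubst Γ (scons a (shift 0)) (A :: Γ) :=
  (isSubst_ids ha.ctx_of).scons (by rw [subst_ids]; exact ha)

theorem Derivable.inst {Γ a A b B} (h : Derivable (typed (A :: Γ) b B))
    (ha : Derivable (typed Γ a A)) : Derivable (typed Γ (b.inst a) (B.inst a)) :=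
  h.subst ha.ctx_of (isSubst_inst ha)

theorem Derivable.inst_eq {Γ a A b b' B} (h : Derivable (equal (A :: Γ) b b' B))
    (ha : Derivable (typed Γ a A)) : Derivable (equal Γ (b.inst a) (b'.inst a) (B.inst a)) :=
  h.subst_eq ha.ctx_of (isSubst_inst ha)

theorem isSubst_shift_one {Γ A i} (hA : Derivable (typed Γ A (.univ i))) :
    IsSubst (A :: Γ) (shift 1) Γ :=
  (isSubst_ids hA.ctx_of).weaken hA

theorem var_zero_typed {Γ A i} (hA : Derivable (typed Γ A (.univ i))) :
    Derivable (typed (A :: Γ) (.var 0) A.wk) := by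
  have := Derivable.variable (ctx_cons hA.ctx_of hA) (k := 0) rfl
  rwa [rename_add_eq, ← wk_eq] at this

/-- The type of the last variable may be replaced by an equal type. -/
theorem isSubst_ctx_conv {Γ A A' i} (hA' : Derivable (typed Γ A' (.univ i)))
    (h : Derivable (equal Γ A A' (.univ i))) : IsSubst (A' :: Γ) Tm.var (A :: Γ) := by
  have := (isSubst_shift_one hA').scons (A := A)
    (conv (var_zero_typed hA') (eq_symm (by rw [← wk_eq]; exact h.weaken_eq hA')))
  have e : scons (.var 0) (shift 1) = Tm.var := by funext k; cases k <;> rfl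
  rwa [e] at this

theorem Derivable.ctx_conv {Γ A A' i b B} (h : Derivable (typed (A :: Γ) b B))
    (hA' : Derivable (typed Γ A' (.univ i))) (e : Derivable (equal Γ A A' (.univ i))) :
    Derivable (typed (A' :: Γ) b B) := by
  have := h.subst (ctx_cons hA'.ctx_of hA') (isSubst_ctx_conv hA' e)
  rwa [subst_ids, subst_ids] at this

/-! ### Equal substitutions -/

/-- `σ` and `τ` send the variables of `Γ` to equal terms in the context `Δ`. -/
structure IsSubstEq (Δ : Ctx) (σ τ : ℕ → Tm) (Γ : Ctx) : Prop where
  left : IsSubst Δ σ Γ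
  eq : ∀ k A, Γ[k]? = some A →
    Derivable (equal Δ (σ k) (τ k) (A.subst fun j => σ (j + (k + 1))))

theorem IsSubstEq.weaken {Δ σ τ Γ A i} (h : IsSubstEq Δ σ τ Γ)
    (hA : Derivable (typed Δ A (.univ i))) :
    IsSubstEq (A :: Δ) (fun k => (σ k).wk) (fun k => (τ k).wk) Γ := by
  refine ⟨h.left.weaken hA, fun k B hk => ?_⟩
  have := (h.eq k B hk).weaken_eq hA
  rw [wk_subst] at this
  exact this

theorem IsSubstEq.scons {Δ σ τ Γ a b A} (h : IsSubstEq Δ σ τ Γ)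
    (ha : Derivable (typed Δ a (A.subst σ))) (hab : Derivable (equal Δ a b (A.subst σ))) :
    IsSubstEq Δ (scons a σ) (scons b τ) (A :: Γ) := by
  refine ⟨h.left.scons ha, fun k B hk => ?_⟩
  cases k with
  | zero =>
    obtain rfl : A = B := by simpa using hk
    exact hab
  | succ k => exact h.eq k B (by simpa using hk)

theorem up_eq_scons (σ : ℕ → Tm) : up σ = scons (.var 0) fun k => (σ k).wk := by
  funext k; cases k <;> rfl

theorem IsSubstEq.up {Δ σ τ Γ A i} (h : IsSubstEq Δ σ τ Γ)
    (hA : Derivable (typed Δ (A.subst σ) (.univ i))) :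
    IsSubstEq (A.subst σ :: Δ) (up σ) (up τ) (A :: Γ) := by
  rw [up_eq_scons, up_eq_scons]
  have v := var_zero_typed hA
  rw [wk_subst] at v
  exact (h.weaken hA).scons v (eq_refl v)

/-- Equal substitutions turn the judgment into a judgmental equality. -/
def Judgment.Functional : Judgment → Prop
  | typed Γ a A => ∀ Δ σ τ, Derivable (ctx Δ) → IsSubstEq Δ σ τ Γ →
      Derivable (equal Δ (a.subst σ) (a.subst τ) (A.subst σ))
  | _ => True

theorem IsSubst.up {Δ σ Γ A i} (hΔ : Derivable (ctx Δ)) (h : IsSubst Δ σ Γ)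
    (hA : Derivable (typed Δ (A.subst σ) (.univ i))) :
    IsSubst (A.subst σ :: Δ) (HoTT.up σ) (A :: Γ) :=
  isSubst_substClass.up h hΔ hA

theorem IsSubstEq.path_ctx {Δ σ τ Γ A i} (hΔ : Derivable (ctx Δ)) (h : IsSubstEq Δ σ τ Γ)
    (hA : Derivable (typed Γ A (.univ i))) :
    Derivable (ctx ((Tm.id A.wk.wk (.var 1) (.var 0)).subst (HoTT.up (HoTT.up σ)) ::
      A.wk.subst (HoTT.up σ) :: A.subst σ :: Δ)) ∧
    IsSubstEq ((Tm.id A.wk.wk (.var 1) (.var 0)).subst (HoTT.up (HoTT.up σ)) ::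
      A.wk.subst (HoTT.up σ) :: A.subst σ :: Δ) (HoTT.up (HoTT.up (HoTT.up σ)))
      (HoTT.up (HoTT.up (HoTT.up τ))) (Tm.id A.wk.wk (.var 1) (.var 0) :: A.wk :: A :: Γ) := by
  obtain ⟨c, -⟩ := isSubst_substClass.path_ctx hΔ h.left (isSubst_substClass.stable hA)
  refine ⟨c, ?_⟩
  -- The types of the three new entries are recovered by inverting the well-formedness of the
  -- extended context.
  cases c with | ctx_cons c₁ h₁ =>
  cases c₁ with | ctx_cons c₂ h₂ =>
  cases c₂ with | ctx_cons c₃ h₃ =>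
  exact ((h.up h₃).up h₂).up h₁

/-- Every term former comes with a congruence rule, which closes its case. The result is
indispensable for dependent types: the two sides of a congruence naturally have types such as
`B.inst a` and `B.inst a'`, and these have to be identified before the sides can be compared. -/
theorem Derivable.functional {J : Judgment} (hJ : Derivable J) : J.Functional := by
  induction hJ with
  | conv _ hAB ih =>
    intro Δ σ τ hΔ h
    exact eq_conv (ih _ _ _ hΔ h) (hAB.subst_eq hΔ h.left)
  | univ_form => intro Δ σ τ hΔ h; exact eq_refl (univ_form hΔ)
  | univ_cumul _ ih => intro Δ σ τ hΔ h; exact univ_cumul_eq (ih _ _ _ hΔ h)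
  | pi_form hA _ ihA ihB =>
    intro Δ σ τ hΔ h
    have a := hA.subst hΔ h.left
    exact pi_form_eq a (ihA _ _ _ hΔ h) (ihB _ _ _ (ctx_cons hΔ a) (h.up a))
  | pi_intro hA _ ihA ihB =>
    intro Δ σ τ hΔ h
    have a := hA.subst hΔ h.left
    exact pi_intro_eq a (ihA _ _ _ hΔ h) (ihB _ _ _ (ctx_cons hΔ a) (h.up a))
  | pi_elim _ _ ihf iha =>
    intro Δ σ τ hΔ h
    rw [inst_subst]
    exact pi_elim_eq (ihf _ _ _ hΔ h) (iha _ _ _ hΔ h)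
  | sigma_form hA _ ihA ihB =>
    intro Δ σ τ hΔ h
    have a := hA.subst hΔ h.left
    exact sigma_form_eq a (ihA _ _ _ hΔ h) (ihB _ _ _ (ctx_cons hΔ a) (h.up a))
  | sigma_intro hA hB _ _ _ _ iha ihb =>
    intro Δ σ τ hΔ h
    have a := hA.subst hΔ h.left
    have b := ihb _ _ _ hΔ h
    rw [inst_subst] at b
    exact sigma_intro_eq a (hB.subst (ctx_cons hΔ a) (h.up a).left) (iha _ _ _ hΔ h) b
  | sigma_elim hA hB hC hg hp ihA ihB ihC ihg ihp =>
    intro Δ σ τ hΔ h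
    have a := hA.subst hΔ h.left
    have ca := ctx_cons hΔ a
    have b := hB.subst ca (h.up a).left
    have s := sigma_form a b
    have g := ihg _ _ _ (ctx_cons ca b) ((h.up a).up b)
    rw [instWk_two_subst] at g
    rw [inst_subst]
    exact sigma_elim_eq a b (ihA _ _ _ hΔ h) (ihB _ _ _ ca (h.up a))
      (ihC _ _ _ (ctx_cons hΔ s) (h.up (A := .sigma _ _) s)) g (ihp _ _ _ hΔ h)
  | sum_form _ _ ihA ihB =>
    intro Δ σ τ hΔ h
    exact sum_form_eq (ihA _ _ _ hΔ h) (ihB _ _ _ hΔ h)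
  | sum_inl hA hB _ _ _ iha =>
    intro Δ σ τ hΔ h
    exact sum_inl_eq (hA.subst hΔ h.left) (hB.subst hΔ h.left) (iha _ _ _ hΔ h)
  | sum_inr hA hB _ _ _ iha =>
    intro Δ σ τ hΔ h
    exact sum_inr_eq (hA.subst hΔ h.left) (hB.subst hΔ h.left) (iha _ _ _ hΔ h)
  | sum_elim hA hB _ _ _ _ ihA ihB ihC ihc ihd ihe =>
    intro Δ σ τ hΔ h
    have a := hA.subst hΔ h.left
    have b := hB.subst hΔ h.left
    have s := sum_form a b
    have c := ihc _ _ _ (ctx_cons hΔ a) (h.up a)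
    have d := ihd _ _ _ (ctx_cons hΔ b) (h.up b)
    rw [instWk_one_subst] at c d
    rw [inst_subst]
    exact sum_elim_eq a b (ihA _ _ _ hΔ h) (ihB _ _ _ hΔ h)
      (ihC _ _ _ (ctx_cons hΔ s) (h.up (A := .sum _ _) s)) c d (ihe _ _ _ hΔ h)
  | empty_form => intro Δ σ τ hΔ h; exact eq_refl (empty_form hΔ)
  | empty_elim _ _ ihC ihe =>
    intro Δ σ τ hΔ h
    rw [inst_subst]
    have s := empty_form (i := 0) hΔ
    exact empty_elim_eq (ihC _ _ _ (ctx_cons hΔ s) (h.up (A := .empty) s)) (ihe _ _ _ hΔ h)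
  | unit_form => intro Δ σ τ hΔ h; exact eq_refl (unit_form hΔ)
  | unit_intro => intro Δ σ τ hΔ h; exact eq_refl (unit_intro hΔ)
  | unit_elim _ _ _ ihC ihc ihe =>
    intro Δ σ τ hΔ h
    have c := ihc _ _ _ hΔ h
    rw [inst_subst] at c ⊢
    have s := unit_form (i := 0) hΔ
    exact unit_elim_eq (ihC _ _ _ (ctx_cons hΔ s) (h.up (A := .unit) s)) c (ihe _ _ _ hΔ h)
  | nat_form => intro Δ σ τ hΔ h; exact eq_refl (nat_form hΔ)
  | nat_zero => intro Δ σ τ hΔ h; exact eq_refl (nat_zero hΔ)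
  | nat_succ _ ih => intro Δ σ τ hΔ h; exact nat_succ_eq (ih _ _ _ hΔ h)
  | nat_elim hC _ _ _ ihC ihz ihs ihn =>
    intro Δ σ τ hΔ h
    have n := nat_form (i := 0) hΔ
    have cn := ctx_cons hΔ n
    have hn := h.up (A := .nat) n
    have c := hC.subst cn hn.left
    have z := ihz _ _ _ hΔ h
    have s := ihs _ _ _ (ctx_cons cn c) (hn.up c)
    rw [instWk_two_subst] at s
    rw [inst_subst] at z ⊢
    exact nat_elim_eq c (ihC _ _ _ cn hn) z s (ihn _ _ _ hΔ h)
  | id_form _ _ _ ihA iha ihb =>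
    intro Δ σ τ hΔ h
    exact id_form_eq (ihA _ _ _ hΔ h) (iha _ _ _ hΔ h) (ihb _ _ _ hΔ h)
  | id_intro hA _ _ iha =>
    intro Δ σ τ hΔ h
    exact id_intro_eq (hA.subst hΔ h.left) (iha _ _ _ hΔ h)
  | id_elim hA _ _ _ _ _ ihA ihC ihc iha ihb ihp =>
    intro Δ σ τ hΔ h
    have a := hA.subst hΔ h.left
    obtain ⟨cp, hp⟩ := h.path_ctx hΔ hA
    have c := ihC _ _ _ cp hp
    simp only [Tm.subst, wk_subst_up] at c
    have d := ihc _ _ _ (ctx_cons hΔ a) (h.up a)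
    rw [reflInst_subst] at d
    rw [inst₃_subst]
    exact id_elim_eq a (ihA _ _ _ hΔ h) c d (iha _ _ _ hΔ h) (ihb _ _ _ hΔ h) (ihp _ _ _ hΔ h)
  | trunc_form _ _ ihk ihA =>
    intro Δ σ τ hΔ h
    exact trunc_form_eq (ihk _ _ _ hΔ h) (ihA _ _ _ hΔ h)
  | trunc_intro _ hA _ ihk _ iha =>
    intro Δ σ τ hΔ h
    exact trunc_intro_eq (hA.subst hΔ h.left) (ihk _ _ _ hΔ h) (iha _ _ _ hΔ h)
  | trunc_isTrunc _ _ ihk ihA =>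
    intro Δ σ τ hΔ h
    rw [isTrunc_subst]
    exact trunc_isTrunc_eq (ihk _ _ _ hΔ h) (ihA _ _ _ hΔ h)
  | trunc_elim hk hA _ _ _ _ ihk ihA ihC ihh ihg iht =>
    intro Δ σ τ hΔ h
    have k := hk.subst hΔ h.left
    have a := hA.subst hΔ h.left
    have s := trunc_form k a
    have cs := ctx_cons hΔ s
    have hs := h.up (A := .trunc _ _) s
    have h' := ihh _ _ _ cs hs
    rw [isTrunc_subst, wk_subst_up] at h'
    have g := ihg _ _ _ (ctx_cons hΔ a) (h.up a)
    rw [instWk_one_subst, Tm.subst, wk_subst_up] at g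
    rw [inst_subst]
    exact trunc_elim_eq k a (ihk _ _ _ hΔ h) (ihA _ _ _ hΔ h) (ihC _ _ _ cs hs) h' g
      (iht _ _ _ hΔ h)
  | ctx_nil | ctx_cons | eq_refl | eq_symm | eq_trans | eq_conv | univ_cumul_eq | pi_form_eq
  | pi_intro_eq | pi_elim_eq | pi_comp | pi_uniq | sigma_form_eq | sigma_intro_eq
  | sigma_elim_eq | sigma_comp | sum_form_eq | sum_inl_eq | sum_inr_eq | sum_elim_eq
  | sum_comp_inl | sum_comp_inr | empty_elim_eq | unit_elim_eq | unit_comp | nat_succ_eq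
  | nat_elim_eq | nat_comp_zero | nat_comp_succ | id_form_eq | id_intro_eq | id_elim_eq
  | id_comp | trunc_form_eq | trunc_intro_eq | trunc_isTrunc_eq | trunc_elim_eq
  | trunc_comp => trivial
  | _ =>
    rename_i hk _
    intro Δ σ τ hΔ h
    rw [subst_rename]
    exact h.eq _ _ hk

theorem Derivable.inst_congr {Γ A a a' b B} (h : Derivable (typed (A :: Γ) b B))
    (ha : Derivable (typed Γ a A)) (e : Derivable (equal Γ a a' A)) :
    Derivable (equal Γ (b.inst a) (b.inst a') (B.inst a)) := by
  refine h.functional _ _ _ ha.ctx_of (IsSubstEq.scons ⟨isSubst_ids ha.ctx_of, fun k A hk => ?_⟩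
    (by rw [shift_zero, subst_ids]; exact ha) (by rw [shift_zero, subst_ids]; exact e))
  exact eq_refl (isSubst_ids ha.ctx_of k A hk)

end HoTT

namespace HoTT

open Judgment Derivable

/-! ### Presuppositions -/

theorem Derivable.univ_le {Γ A i j} (h : Derivable (typed Γ A (.univ i))) (hij : i ≤ j) :
    Derivable (typed Γ A (.univ j)) := by
  induction hij with
  | refl => exact h
  | step _ ih => exact univ_cumul ih

theorem Derivable.univ_le_eq {Γ A B i j} (h : Derivable (equal Γ A B (.univ i))) (hij : i ≤ j) :
    Derivable (equal Γ A B (.univ j)) := by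
  induction hij with
  | refl => exact h
  | step _ ih => exact univ_cumul_eq ih

theorem instWk_two_inst₂ (C t a b : Tm) : (C.instWk 2 t).inst₂ a b = C.inst (t.inst₂ a b) := by
  simp only [Tm.instWk, Tm.inst₂, Tm.inst, subst_subst]
  refine subst_congr _ fun k => ?_
  cases k <;> rfl

theorem instWk_one_inst (C t a : Tm) : (C.instWk 1 t).inst a = C.inst (t.inst a) := by
  simp only [Tm.instWk, Tm.inst, subst_subst]
  refine subst_congr _ fun k => ?_
  cases k <;> rfl

theorem reflInst_inst (C a : Tm) :
    (C.subst (scons (.refl (.var 0)) (scons (.var 0) (scons (.var 0) (shift 1))))).inst a =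
      C.inst₃ a a (.refl a) := by
  simp only [Tm.inst₃, Tm.inst, subst_subst]
  refine subst_congr _ fun k => ?_
  rcases k with _ | _ | _ | k <;> rfl

theorem tr_inst (k a : Tm) : (Tm.tr k.wk (.var 0)).inst a = .tr k a := by
  rw [Tm.inst, Tm.subst, ← Tm.inst, wk_inst]; rfl

/-- Applied repeatedly, this exchanges several context entries for equal ones, while the underlying
substitution remains the identity. -/
theorem IsSubst.extend_conv {Δ Γ A A' i} (h : IsSubst Δ Tm.var Γ)
    (hA' : Derivable (typed Δ A' (.univ i)))
    (e : Derivable (equal Δ (A.subst Tm.var) A' (.univ i))) : IsSubst (A' :: Δ) Tm.var (A :: Γ) := by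
  rw [subst_ids] at e
  have := (h.weaken hA').scons (A := A) (a := .var 0)
    (conv (var_zero_typed hA') (eq_symm (by
      rw [← wk_subst, subst_ids]; exact e.weaken_eq hA')))
  rw [← up_eq_scons, up_ids] at this
  exact this

/-- Apart from conversions of the type and cumulativity, such a derivation must end in the formation
rule. This inverts formation only, and does not assert injectivity of products; it recovers the
codomain in the elimination rule, which does not have it as a premise. -/
theorem Derivable.pi_inv {Γ A B T} (h : Derivable (typed Γ (.pi A B) T)) :
    ∃ i, Derivable (typed Γ A (.univ i)) ∧ Derivable (typed (A :: Γ) B (.univ i)) := by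
  generalize e : typed Γ (.pi A B) T = J at h
  induction h generalizing T with
  | conv _ _ ih => cases e; exact ih rfl
  | univ_cumul _ ih => cases e; exact ih rfl
  | pi_form hA hB => cases e; exact ⟨_, hA, hB⟩
  | _ => cases e

theorem isSubst_shift_two {Γ A B i j} (hA : Derivable (typed Γ A (.univ i)))
    (hB : Derivable (typed (A :: Γ) B (.univ j))) : IsSubst (B :: A :: Γ) (shift 2) Γ :=
  (isSubst_shift_one hA).weaken hB

theorem var_one_typed {Γ A B i j} (hA : Derivable (typed Γ A (.univ i)))
    (hB : Derivable (typed (A :: Γ) B (.univ j))) :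
    Derivable (typed (B :: A :: Γ) (.var 1) (A.subst (shift 2))) := by
  have := (var_zero_typed hA).weaken hB
  simp only [wk_eq, subst_subst] at this
  exact this

theorem isSubst_pair {Γ A B i} (hA : Derivable (typed Γ A (.univ i)))
    (hB : Derivable (typed (A :: Γ) B (.univ i))) :
    IsSubst (B :: A :: Γ) (scons (.pair (.var 1) (.var 0)) (shift 2)) (.sigma A B :: Γ) := by
  have s := isSubst_shift_two hA hB
  have c := ctx_cons hB.ctx_of hB
  have hA' := hA.subst c s
  refine s.scons (sigma_intro hA' (hB.subst (ctx_cons c hA') (s.up c hA')) (var_one_typed hA hB) ?_)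
  have v := var_zero_typed hB
  have e : (B.subst (up (shift 2))).inst (.var 1) = B.wk := by
    rw [Tm.inst, subst_subst, wk_eq]
    refine subst_congr _ fun k => ?_
    cases k <;> rfl
  rwa [e]

theorem isSubst_inl {Γ A B i} (hA : Derivable (typed Γ A (.univ i)))
    (hB : Derivable (typed Γ B (.univ i))) :
    IsSubst (A :: Γ) (scons (.inl (.var 0)) (shift 1)) (.sum A B :: Γ) := by
  refine (isSubst_shift_one hA).scons ?_
  rw [← wk_eq]
  exact sum_inl (hA.weaken hA) (hB.weaken hA) (var_zero_typed hA)

theorem isSubst_inr {Γ A B i} (hA : Derivable (typed Γ A (.univ i)))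
    (hB : Derivable (typed Γ B (.univ i))) :
    IsSubst (B :: Γ) (scons (.inr (.var 0)) (shift 1)) (.sum A B :: Γ) := by
  refine (isSubst_shift_one hB).scons ?_
  rw [← wk_eq]
  exact sum_inr (hA.weaken hB) (hB.weaken hB) (var_zero_typed hB)

theorem isSubst_succ {Γ C j} (hC : Derivable (typed (.nat :: Γ) C (.univ j))) :
    IsSubst (C :: .nat :: Γ) (scons (.succ (.var 1)) (shift 2)) (.nat :: Γ) := by
  have hΓ : Derivable (ctx Γ) := by cases hC.ctx_of; assumption
  have n := nat_form (i := 0) hΓ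
  exact (isSubst_shift_two n hC).scons (nat_succ (var_one_typed n hC))

theorem isSubst_tr {Γ A k i} (hk : Derivable (typed Γ k .nat))
    (hA : Derivable (typed Γ A (.univ i))) :
    IsSubst (A :: Γ) (scons (.tr k.wk (.var 0)) (shift 1)) (.trunc k A :: Γ) := by
  refine (isSubst_shift_one hA).scons ?_
  rw [← wk_eq]
  exact trunc_intro (hk.weaken hA) (hA.weaken hA) (var_zero_typed hA)

theorem isSubst_refl {Γ A i} (hA : Derivable (typed Γ A (.univ i))) :
    IsSubst (A :: Γ) (scons (.refl (.var 0)) (scons (.var 0) (scons (.var 0) (shift 1))))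
      (.id A.wk.wk (.var 1) (.var 0) :: A.wk :: A :: Γ) := by
  have v := var_zero_typed hA
  have hA' := hA.weaken hA
  have s₁ := (isSubst_shift_one hA).scons (A := A) (by rw [← wk_eq]; exact v)
  have s₂ := s₁.scons (A := A.wk) (a := .var 0) (by
    rw [subst_wk]; simp only [scons_succ]; rw [← wk_eq]; exact v)
  refine s₂.scons ?_
  simp only [Tm.subst, scons_zero, scons_succ, subst_wk]
  rw [← wk_eq]
  exact id_intro hA' v

theorem id_ctx {Γ A i} (hA : Derivable (typed Γ A (.univ i))) :
    Derivable (typed (A :: Γ) A.wk (.univ i)) ∧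
    Derivable (typed (A.wk :: A :: Γ) (.id A.wk.wk (.var 1) (.var 0)) (.univ i)) := by
  have h := hA.weaken hA
  exact ⟨h, id_form (h.weaken h) ((var_zero_typed hA).weaken h) (var_zero_typed h)⟩

theorem isSubst_inst₃ {Γ A a b p} (ha : Derivable (typed Γ a A)) (hb : Derivable (typed Γ b A))
    (hp : Derivable (typed Γ p (.id A a b))) :
    IsSubst Γ (scons p (scons b (scons a (shift 0))))
      (.id A.wk.wk (.var 1) (.var 0) :: A.wk :: A :: Γ) := by
  have s := isSubst_inst ha
  have hb' : Derivable (typed Γ b (A.wk.subst (scons a (shift 0)))) := by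
    rw [← Tm.inst, wk_inst]; exact hb
  refine (s.scons hb').scons ?_
  simp only [Tm.subst, scons_zero, scons_succ, subst_wk, shift_zero]
  rw [show (fun k => Tm.var k) = Tm.var from rfl, subst_ids]
  exact hp

theorem isSubst_inst₂ {Γ A B a b} (ha : Derivable (typed Γ a A))
    (hb : Derivable (typed Γ b (B.inst a))) :
    IsSubst Γ (scons b (scons a (shift 0))) (B :: A :: Γ) :=
  (isSubst_inst ha).scons hb

theorem Derivable.inst₂ {Γ A B a b t T} (h : Derivable (typed (B :: A :: Γ) t T))
    (ha : Derivable (typed Γ a A)) (hb : Derivable (typed Γ b (B.inst a))) :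
    Derivable (typed Γ (t.inst₂ a b) (T.inst₂ a b)) :=
  h.subst ha.ctx_of (isSubst_inst₂ ha hb)

theorem isSubstEq_inst₃ {Γ A a a' b b' p p'} (ha : Derivable (typed Γ a A))
    (hb : Derivable (typed Γ b A)) (hp : Derivable (typed Γ p (.id A a b)))
    (haa' : Derivable (equal Γ a a' A)) (hbb' : Derivable (equal Γ b b' A))
    (hpp' : Derivable (equal Γ p p' (.id A a b))) :
    IsSubstEq Γ (scons p (scons b (scons a (shift 0)))) (scons p' (scons b' (scons a' (shift 0))))
      (.id A.wk.wk (.var 1) (.var 0) :: A.wk :: A :: Γ) := by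
  have hs := isSubst_inst₃ ha hb hp
  refine ⟨hs, fun k B hk => ?_⟩
  have h₂ : A.subst (shift 0) = A := subst_ids A
  rcases k with _ | _ | _ | k
  · obtain rfl : Tm.id A.wk.wk (.var 1) (.var 0) = B := by simpa using hk
    simp only [Tm.subst, scons_zero, scons_succ, subst_wk]
    rw [show (A.subst fun k => shift 0 k) = A from h₂]
    exact hpp'
  · obtain rfl : A.wk = B := by simpa using hk
    rw [subst_wk]
    exact cast (congrArg (fun T => Derivable (equal Γ b b' T)) h₂.symm) hbb'
  · obtain rfl : A = B := by simpa using hk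
    exact cast (congrArg (fun T => Derivable (equal Γ a a' T)) h₂.symm) haa'
  · exact eq_refl (hs (k + 3) B hk)

theorem pi_uniq_typed {Γ A B f i} (hA : Derivable (typed Γ A (.univ i)))
    (hf : Derivable (typed Γ f (.pi A B))) :
    Derivable (typed Γ (.lam A (.app f.wk (.var 0))) (.pi A B)) := by
  have := pi_elim (B := B.rename (upRen (fun k => k + 1))) (hf.weaken hA) (var_zero_typed hA)
  have e : (B.rename (upRen (fun k => k + 1))).inst (.var 0) = B := by
    rw [Tm.inst, subst_rename]
    refine (subst_congr _ fun k => ?_).trans (subst_ids B)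
    cases k <;> rfl
  rw [e] at this
  exact pi_intro hA this

theorem isTrunc_typed_aux (Γ : Ctx) (i : ℕ) (hΓ : Derivable (ctx Γ)) :
    Derivable (typed (.nat :: Γ) (.pi (.univ i) (.univ i)) (.univ (i + 1))) ∧
    Derivable (typed Γ (.lam (.univ i) (isContr (.var 0))) (.pi (.univ i) (.univ i))) ∧
    Derivable (typed (.pi (.univ i) (.univ i) :: .nat :: Γ)
      (.lam (.univ i)
        (.pi (.var 0) (.pi (.var 1) (.app (.var 3) (.id (.var 2) (.var 1) (.var 0))))))
      (.pi (.univ i) (.univ i))) := by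
  have pi_ty : ∀ {Δ}, Derivable (ctx Δ) →
      Derivable (typed Δ (.pi (.univ i) (.univ i)) (.univ (i + 1))) := fun h =>
    pi_form (univ_form h) (univ_form (ctx_cons h (univ_form h)))
  have cN := ctx_cons hΓ (nat_form (i := 0) hΓ)
  refine ⟨pi_ty cN, ?_, ?_⟩
  · refine pi_intro (univ_form hΓ) ?_
    have c₁ := ctx_cons hΓ (univ_form (i := i) hΓ)
    have v : Derivable (typed (.univ i :: Γ) (.var 0) (.univ i)) := var_zero_typed (univ_form hΓ)
    have v₁ := v.weaken v
    have v₂ := v₁.weaken v₁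
    exact sigma_form v (pi_form v₁ (id_form v₂ ((var_zero_typed v).weaken v₁) (var_zero_typed v₁)))
  · have c₀ := ctx_cons cN (pi_ty cN)
    have u : Derivable (typed _ (Tm.univ i) _) := univ_form c₀
    have f := (var_zero_typed (pi_ty cN)).weaken u
    refine pi_intro u ?_
    have v := var_zero_typed u
    have v₁ := v.weaken v
    have v₂ := v₁.weaken v₁
    refine pi_form v (pi_form v₁ ?_)
    have f' := (f.weaken v).weaken v₁
    exact pi_elim f' (id_form v₂ ((var_zero_typed v).weaken v₁) (var_zero_typed v₁))

theorem isTrunc_typed {Γ k A i} (hk : Derivable (typed Γ k .nat))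
    (hA : Derivable (typed Γ A (.univ i))) : Derivable (typed Γ (isTrunc i k A) (.univ i)) := by
  obtain ⟨c, z, s⟩ := isTrunc_typed_aux Γ i hA.ctx_of
  exact pi_elim (B := .univ i) (nat_elim c z s hk) hA

theorem isTrunc_congr {Γ k k' A A' i} (hk : Derivable (equal Γ k k' .nat))
    (hA : Derivable (equal Γ A A' (.univ i))) :
    Derivable (equal Γ (isTrunc i k A) (isTrunc i k' A') (.univ i)) := by
  obtain ⟨c, z, s⟩ := isTrunc_typed_aux Γ i hA.ctx_of
  exact pi_elim_eq (B := .univ i) (nat_elim_eq c (eq_refl c) (eq_refl z) (eq_refl s) hk) hA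

theorem isTrunc_zero {Γ A i} (hA : Derivable (typed Γ A (.univ i))) :
    Derivable (equal Γ (isTrunc i .zero A) (isContr A) (.univ i)) := by
  obtain ⟨c, z, s⟩ := isTrunc_typed_aux Γ i hA.ctx_of
  have h := pi_elim_eq (B := .univ i) (nat_comp_zero c z s) (eq_refl hA)
  refine eq_trans h ?_
  have u : Derivable (typed Γ (Tm.univ i) _) := univ_form hA.ctx_of
  have v : Derivable (typed (.univ i :: Γ) (.var 0) (.univ i)) := var_zero_typed u
  have v₁ := v.weaken v
  have v₂ := v₁.weaken v₁
  have := pi_comp u (sigma_form v (pi_form v₁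
    (id_form v₂ ((var_zero_typed v).weaken v₁) (var_zero_typed v₁)))) hA
  simp only [Tm.inst, Tm.subst, scons_zero, up_zero] at this
  exact this

theorem isTrunc_succ {Γ k A i} (hk : Derivable (typed Γ k .nat))
    (hA : Derivable (typed Γ A (.univ i))) :
    Derivable (equal Γ (isTrunc i (.succ k) A)
      (.pi A (.pi A.wk (isTrunc i k.wk.wk (.id A.wk.wk (.var 1) (.var 0))))) (.univ i)) := by
  obtain ⟨c, z, s⟩ := isTrunc_typed_aux Γ i hA.ctx_of
  have h := pi_elim_eq (B := .univ i) (nat_comp_succ c z s hk) (eq_refl hA)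
  refine eq_trans h ?_
  have u : Derivable (typed Γ (Tm.univ i) _) := univ_form hA.ctx_of
  have v : Derivable (typed (.univ i :: Γ) (.var 0) (.univ i)) := var_zero_typed u
  have v₁ := v.weaken v
  have v₂ := v₁.weaken v₁
  have hk' := ((hk.weaken u).weaken v).weaken v₁
  have := pi_comp u (pi_form v (pi_form v₁ (isTrunc_typed hk'
    (id_form v₂ ((var_zero_typed v).weaken v₁) (var_zero_typed v₁))))) hA
  simp only [Tm.inst, Tm.subst, scons_zero, up_zero, isTrunc_subst, wk_subst_up] at this
  rw [← Tm.inst, wk_inst] at this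
  exact this

/-- The presuppositions of the judgment, other than its context being well-formed. -/
def Judgment.Presupposition : Judgment → Prop
  | ctx Γ => ∀ (k : ℕ) (A : Tm), Γ[k]? = some A →
      ∃ i, Derivable (typed Γ (Tm.rename A fun j => j + (k + 1)) (.univ i))
  | typed Γ _ A => ∃ i, Derivable (typed Γ A (.univ i))
  | equal Γ a b A => Derivable (typed Γ a A) ∧ Derivable (typed Γ b A) ∧
      ∃ i, Derivable (typed Γ A (.univ i))

/-- The work is in the congruence rules. The right-hand term is built over the primed data, so its
ingredients are first moved along equal contexts and converted, and its type is then converted back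
by functionality. The clause for contexts is what the variable rule needs. -/
theorem Derivable.presupposition {J : Judgment} (h : Derivable J) : J.Presupposition := by
  induction h with
  | ctx_nil => intro k A hk; simp at hk
  | ctx_cons hΓ hA ih _ =>
    intro k B hk
    cases k with
    | zero =>
      rw [List.getElem?_cons_zero, Option.some.injEq] at hk
      subst hk
      exact ⟨_, hA.weaken hA⟩
    | succ k =>
      obtain ⟨j, hB⟩ := ih k B (by simpa using hk)
      refine ⟨j, ?_⟩
      have := hB.weaken hA
      rw [Tm.wk, rename_rename] at this
      exact this
  | eq_refl h ih => exact ⟨h, h, ih⟩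
  | eq_symm _ ih => exact ⟨ih.2.1, ih.1, ih.2.2⟩
  | eq_trans _ _ ih ih' => exact ⟨ih.1, ih'.2.1, ih.2.2⟩
  | conv _ _ _ ih => exact ⟨_, ih.2.1⟩
  | eq_conv _ h ih ih' => exact ⟨conv ih.1 h, conv ih.2.1 h, _, ih'.2.1⟩
  | univ_form hΓ => exact ⟨_, univ_form hΓ⟩
  | univ_cumul h => exact ⟨_, univ_form h.ctx_of⟩
  | univ_cumul_eq h ih => exact ⟨univ_cumul ih.1, univ_cumul ih.2.1, _, univ_form h.ctx_of⟩
  | pi_form h => exact ⟨_, univ_form h.ctx_of⟩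
  | pi_form_eq hA hAA' _ _ ihA ihB =>
    exact ⟨pi_form hA ihB.1, pi_form ihA.2.1 (ihB.2.1.ctx_conv ihA.2.1 hAA'), _,
      univ_form hA.ctx_of⟩
  | pi_intro hA _ _ ih =>
    obtain ⟨j, hB⟩ := ih
    exact ⟨_, pi_form (hA.univ_le (le_max_left _ j)) (hB.univ_le (le_max_right _ j))⟩
  | @pi_intro_eq _ _ _ _ _ _ i hA hAA' _ _ ihA ihb =>
    obtain ⟨hb, hb', j, hB⟩ := ihb
    have a := hA.univ_le (le_max_left _ j)
    have b := hB.univ_le (le_max_right i j)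
    exact ⟨pi_intro hA hb, conv (pi_intro ihA.2.1 (hb'.ctx_conv ihA.2.1 hAA'))
      (eq_symm (pi_form_eq a (hAA'.univ_le_eq (le_max_left _ j)) (eq_refl b))), _, pi_form a b⟩
  | pi_elim _ ha ihf =>
    obtain ⟨_, h⟩ := ihf
    obtain ⟨j, _, hB⟩ := h.pi_inv
    exact ⟨j, hB.inst ha⟩
  | pi_elim_eq _ haa' ihf iha =>
    obtain ⟨_, h⟩ := ihf.2.2
    obtain ⟨j, _, hB⟩ := h.pi_inv
    exact ⟨pi_elim ihf.1 iha.1,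
      conv (pi_elim ihf.2.1 iha.2.1) (eq_symm (hB.inst_congr iha.1 haa')), j, hB.inst iha.1⟩
  | pi_comp hA hb ha _ ihb =>
    obtain ⟨j, hB⟩ := ihb
    exact ⟨pi_elim (pi_intro hA hb) ha, hb.inst ha, j, hB.inst ha⟩
  | pi_uniq hf ih =>
    obtain ⟨_, h⟩ := ih
    obtain ⟨j, hA, hB⟩ := h.pi_inv
    exact ⟨hf, pi_uniq_typed hA hf, _, h⟩
  | sigma_form h => exact ⟨_, univ_form h.ctx_of⟩
  | sigma_form_eq hA hAA' _ _ ihA ihB =>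
    exact ⟨sigma_form hA ihB.1, sigma_form ihA.2.1 (ihB.2.1.ctx_conv ihA.2.1 hAA'), _,
      univ_form hA.ctx_of⟩
  | sigma_intro hA hB => exact ⟨_, sigma_form hA hB⟩
  | sigma_intro_eq hA hB haa' _ _ _ iha ihb =>
    exact ⟨sigma_intro hA hB iha.1 ihb.1,
      sigma_intro hA hB iha.2.1 (conv ihb.2.1 (hB.inst_congr iha.1 haa')), _, sigma_form hA hB⟩
  | sigma_elim _ _ hC _ hp => exact ⟨_, hC.inst hp⟩
  | sigma_elim_eq hA hB hAA' hBB' hCC' _ hpp' _ _ ihA ihB ihC ihg ihp =>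
    have e := sigma_form_eq hA hAA' hBB'
    have s := sigma_form hA hB
    have B' := ihB.2.1.ctx_conv ihA.2.1 hAA'
    have s' := sigma_form ihA.2.1 B'
    have C' := ihC.2.1.ctx_conv s' e
    have g₁ := conv ihg.2.1 (hCC'.subst_eq (ctx_cons hB.ctx_of hB) (isSubst_pair hA hB))
    have g₂ := g₁.ctx_conv ihB.2.1 hBB'
    have cA := isSubst_ctx_conv ihA.2.1 hAA'
    have cB := cA.up (A := _) B'.ctx_of (by rw [subst_ids]; exact B')
    rw [subst_ids, up_ids] at cB
    have g₃ := g₂.subst (ctx_cons B'.ctx_of B') cB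
    rw [subst_ids, subst_ids] at g₃
    exact ⟨sigma_elim hA hB ihC.1 ihg.1 ihp.1,
      conv (sigma_elim ihA.2.1 B' C' g₃ (conv ihp.2.1 e))
        (eq_symm (eq_trans (ihC.1.inst_congr ihp.1 hpp') (hCC'.inst_eq ihp.2.1))),
      _, ihC.1.inst ihp.1⟩
  | sigma_comp hA hB hC hg ha hb =>
    have p := sigma_intro hA hB ha hb
    have h := hg.inst₂ ha hb
    refine ⟨sigma_elim hA hB hC hg p, ?_, _, hC.inst p⟩
    rwa [instWk_two_inst₂] at h
  | sum_form h => exact ⟨_, univ_form h.ctx_of⟩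
  | sum_form_eq hA _ ihA ihB =>
    exact ⟨sum_form ihA.1 ihB.1, sum_form ihA.2.1 ihB.2.1, _, univ_form hA.ctx_of⟩
  | sum_inl hA hB => exact ⟨_, sum_form hA hB⟩
  | sum_inl_eq hA hB _ _ _ ih =>
    exact ⟨sum_inl hA hB ih.1, sum_inl hA hB ih.2.1, _, sum_form hA hB⟩
  | sum_inr hA hB => exact ⟨_, sum_form hA hB⟩
  | sum_inr_eq hA hB _ _ _ ih =>
    exact ⟨sum_inr hA hB ih.1, sum_inr hA hB ih.2.1, _, sum_form hA hB⟩
  | sum_elim _ _ hC _ _ he => exact ⟨_, hC.inst he⟩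
  | sum_elim_eq hA hB hAA' hBB' hCC' _ _ hee' _ _ ihA ihB ihC ihc ihd ihe =>
    have e := sum_form_eq hAA' hBB'
    have C' := ihC.2.1.ctx_conv (sum_form ihA.2.1 ihB.2.1) e
    have c := (conv ihc.2.1 (hCC'.subst_eq ihc.1.ctx_of (isSubst_inl hA hB))).ctx_conv ihA.2.1 hAA'
    have d := (conv ihd.2.1 (hCC'.subst_eq ihd.1.ctx_of (isSubst_inr hA hB))).ctx_conv ihB.2.1 hBB'
    exact ⟨sum_elim hA hB ihC.1 ihc.1 ihd.1 ihe.1,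
      conv (sum_elim ihA.2.1 ihB.2.1 C' c d (conv ihe.2.1 e))
        (eq_symm (eq_trans (ihC.1.inst_congr ihe.1 hee') (hCC'.inst_eq ihe.2.1))),
      _, ihC.1.inst ihe.1⟩
  | sum_comp_inl hA hB hC hc hd ha =>
    have p := sum_inl hA hB ha
    have h := hc.inst ha
    refine ⟨sum_elim hA hB hC hc hd p, ?_, _, hC.inst p⟩
    rwa [instWk_one_inst] at h
  | sum_comp_inr hA hB hC hc hd ha =>
    have p := sum_inr hA hB ha
    have h := hd.inst ha
    refine ⟨sum_elim hA hB hC hc hd p, ?_, _, hC.inst p⟩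
    rwa [instWk_one_inst] at h
  | empty_form hΓ => exact ⟨_, univ_form hΓ⟩
  | empty_elim hC he => exact ⟨_, hC.inst he⟩
  | empty_elim_eq hCC' hee' ihC ihe =>
    exact ⟨empty_elim ihC.1 ihe.1, conv (empty_elim ihC.2.1 ihe.2.1)
      (eq_symm (eq_trans (ihC.1.inst_congr ihe.1 hee') (hCC'.inst_eq ihe.2.1))),
      _, ihC.1.inst ihe.1⟩
  | unit_form hΓ => exact ⟨_, univ_form hΓ⟩
  | unit_intro hΓ => exact ⟨0, unit_form hΓ⟩
  | unit_elim hC _ he => exact ⟨_, hC.inst he⟩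
  | unit_elim_eq hCC' _ hee' ihC ihc ihe =>
    have c := conv ihc.2.1 (hCC'.inst_eq (unit_intro ihe.1.ctx_of))
    exact ⟨unit_elim ihC.1 ihc.1 ihe.1, conv (unit_elim ihC.2.1 c ihe.2.1)
      (eq_symm (eq_trans (ihC.1.inst_congr ihe.1 hee') (hCC'.inst_eq ihe.2.1))),
      _, ihC.1.inst ihe.1⟩
  | unit_comp hC hc _ ihc => exact ⟨unit_elim hC hc (unit_intro hc.ctx_of), hc, ihc⟩
  | nat_form hΓ => exact ⟨_, univ_form hΓ⟩
  | nat_zero hΓ => exact ⟨0, nat_form hΓ⟩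
  | nat_succ h => exact ⟨0, nat_form h.ctx_of⟩
  | nat_succ_eq h ih => exact ⟨nat_succ ih.1, nat_succ ih.2.1, 0, nat_form h.ctx_of⟩
  | nat_elim hC _ _ hn => exact ⟨_, hC.inst hn⟩
  | nat_elim_eq hC hCC' _ _ hnn' _ ihC ihz ihs ihn =>
    have z := conv ihz.2.1 (hCC'.inst_eq (nat_zero ihz.1.ctx_of))
    have s := (conv ihs.2.1 (hCC'.subst_eq ihs.1.ctx_of (isSubst_succ hC))).ctx_conv ihC.2.1 hCC'
    exact ⟨nat_elim hC ihz.1 ihs.1 ihn.1, conv (nat_elim ihC.2.1 z s ihn.2.1)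
      (eq_symm (eq_trans (hC.inst_congr ihn.1 hnn') (hCC'.inst_eq ihn.2.1))),
      _, hC.inst ihn.1⟩
  | nat_comp_zero hC hz hs _ ih => exact ⟨nat_elim hC hz hs (nat_zero hz.ctx_of), hz, ih⟩
  | nat_comp_succ hC hz hs hn =>
    have h := hs.inst₂ hn (nat_elim hC hz hs hn)
    refine ⟨nat_elim hC hz hs (nat_succ hn), ?_, _, hC.inst (nat_succ hn)⟩
    rwa [instWk_two_inst₂] at h
  | id_form h => exact ⟨_, univ_form h.ctx_of⟩
  | id_form_eq hAA' haa' hbb' ihA iha ihb =>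
    exact ⟨id_form ihA.1 iha.1 ihb.1,
      id_form ihA.2.1 (conv iha.2.1 hAA') (conv ihb.2.1 hAA'), _, univ_form hAA'.ctx_of⟩
  | id_intro hA ha => exact ⟨_, id_form hA ha ha⟩
  | id_intro_eq hA haa' _ ih =>
    exact ⟨id_intro hA ih.1, conv (id_intro hA ih.2.1)
      (eq_symm (id_form_eq (eq_refl hA) haa' haa')), _, id_form hA ih.1 ih.1⟩
  | id_elim _ hC _ ha hb hp =>
    exact ⟨_, hC.subst ha.ctx_of (isSubst_inst₃ ha hb hp)⟩
  | id_elim_eq hA hAA' hCC' hcc' haa' hbb' hpp' _ ihA ihC ihc iha ihb ihp =>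
    have hA' := ihA.2.1
    have e := id_form_eq hAA' haa' hbb'
    have c := (conv ihc.2.1 (hCC'.subst_eq ihc.1.ctx_of (isSubst_refl hA))).ctx_conv hA' hAA'
    obtain ⟨w, i⟩ := id_ctx hA'
    have ew := hAA'.weaken_eq hA'
    have eww := ew.weaken_eq w
    have ei := id_form_eq eww
      (eq_refl (conv ((var_zero_typed hA').weaken w) (eq_symm eww)))
      (eq_refl (conv (var_zero_typed w) (eq_symm eww)))
    -- The motive on the right must live over the primed type, its weakening and the primed identity
    -- type; the three entries are exchanged one after the other.
    have s := (((isSubst_ids hA.ctx_of).extend_conv hA' (by rwa [subst_ids])).extend_conv w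
      (by rwa [subst_ids])).extend_conv i (by rwa [subst_ids])
    have C' := ihC.2.1.subst (ctx_cons i.ctx_of i) s
    rw [subst_ids, subst_ids] at C'
    have hs := isSubst_inst₃ iha.1 ihb.1 ihp.1
    have hst := isSubstEq_inst₃ iha.1 ihb.1 ihp.1 haa' hbb' hpp'
    exact ⟨id_elim hA ihC.1 ihc.1 iha.1 ihb.1 ihp.1,
      conv (id_elim hA' C' c (conv iha.2.1 hAA') (conv ihb.2.1 hAA') (conv ihp.2.1 e))
        (eq_symm (eq_trans (hCC'.subst_eq hA.ctx_of hs)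
          (ihC.2.1.functional _ _ _ hA.ctx_of hst))),
      _, ihC.1.subst hA.ctx_of hs⟩
  | id_comp hA hC hc ha =>
    have h := hc.inst ha
    have r := id_intro hA ha
    refine ⟨id_elim hA hC hc ha ha r, ?_, _, hC.subst ha.ctx_of (isSubst_inst₃ ha ha r)⟩
    rwa [reflInst_inst] at h
  | trunc_form hk hA => exact ⟨_, univ_form hA.ctx_of⟩
  | trunc_form_eq _ hA ihk ihA =>
    exact ⟨trunc_form ihk.1 ihA.1, trunc_form ihk.2.1 ihA.2.1, _, univ_form hA.ctx_of⟩
  | trunc_intro hk hA => exact ⟨_, trunc_form hk hA⟩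
  | trunc_intro_eq hA hkk' _ _ ihk iha =>
    exact ⟨trunc_intro ihk.1 hA iha.1, conv (trunc_intro ihk.2.1 hA iha.2.1)
      (eq_symm (trunc_form_eq hkk' (eq_refl hA))), _, trunc_form ihk.1 hA⟩
  | trunc_isTrunc hk hA => exact ⟨_, isTrunc_typed hk (trunc_form hk hA)⟩
  | trunc_isTrunc_eq hkk' hAA' ihk ihA =>
    have t := trunc_form ihk.1 ihA.1
    exact ⟨trunc_isTrunc ihk.1 ihA.1, conv (trunc_isTrunc ihk.2.1 ihA.2.1)
      (eq_symm (isTrunc_congr hkk' (trunc_form_eq hkk' hAA'))), _, isTrunc_typed ihk.1 t⟩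
  | trunc_elim _ _ hC _ _ ht => exact ⟨_, hC.inst ht⟩
  | trunc_elim_eq hk hA hkk' hAA' hCC' _ _ htt' _ _ ihk ihA ihC ihh ihg iht =>
    have e := trunc_form_eq hkk' hAA'
    have t := trunc_form hk hA
    have t' := trunc_form ihk.2.1 ihA.2.1
    have C' := ihC.2.1.ctx_conv t' e
    have eT := isTrunc_congr (hkk'.weaken_eq t) hCC'
    have h' := (conv ihh.2.1 eT).ctx_conv t' e
    have g₁ := conv ihg.2.1 (hCC'.subst_eq ihg.1.ctx_of (isSubst_tr hk hA))
    -- The right-hand method is typed over `tr k`, but the elimination rule at `k'` asks for `tr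
    -- k'`; functionality of the motive bridges the two.
    have eg := ihC.2.1.functional _ _ _ ihg.1.ctx_of (IsSubstEq.scons
      (a := .tr (Tm.wk _) (.var 0)) (b := .tr (Tm.wk _) (.var 0))
      ⟨isSubst_shift_one hA, fun k B hk => eq_refl (isSubst_shift_one hA k B hk)⟩
      (by have := isSubst_tr hk hA 0 _ rfl; exact this)
      (by
        show Derivable (equal _ _ _ (.trunc _ _))
        rw [← wk_eq, ← wk_eq]
        exact trunc_intro_eq (hA.weaken hA) (hkk'.weaken_eq hA) (eq_refl (var_zero_typed hA))))
    have g := (conv g₁ eg).ctx_conv ihA.2.1 hAA'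
    exact ⟨trunc_elim hk hA ihC.1 ihh.1 ihg.1 iht.1,
      conv (trunc_elim ihk.2.1 ihA.2.1 C' h' g (conv iht.2.1 e))
        (eq_symm (eq_trans (ihC.1.inst_congr iht.1 htt') (hCC'.inst_eq iht.2.1))),
      _, ihC.1.inst iht.1⟩
  | trunc_comp hk hA hC hh hg ha =>
    have p := trunc_intro hk hA ha
    have h := hg.inst ha
    refine ⟨trunc_elim hk hA hC hh hg p, ?_, _, hC.inst p⟩
    rwa [instWk_one_inst, tr_inst] at h
  | _ =>
    rename_i hΓ hk ih
    exact ih _ _ hk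

end HoTT

/-! ### A type checker with normalization, and the erasure of its expressions to raw terms. -/

namespace HoTT

open Judgment Derivable

/-! ### Annotated expressions -/

/-- Expressions from which types can be inferred. They extend the raw terms by annotations, by
constants `const c` for closed terms derived earlier, by `eta A B f` for the uniqueness
principle of functions as an identification, and by explicit cumulativity `cum n A`.
Universe levels are relative to a base level. -/
inductive Exp : Type
  | var (k : ℕ)
  | const (c : ℕ)
  | univ (n : ℕ)
  | pi (A B : Exp)
  | lam (A b : Exp)
  | app (f a : Exp)
  | sigma (A B : Exp)
  | pair (A B a b : Exp)
  | sigmaInd (A B C g p : Exp)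
  | sum (A B : Exp)
  /-- case distinction with values in the type `D` -/
  | sumRec (A B D c d e : Exp)
  | empty
  | emptyInd (C e : Exp)
  | nat
  | zero
  | succ (n : Exp)
  | natInd (C z s n : Exp)
  | id (A a b : Exp)
  | refl (A a : Exp)
  | idInd (A C c a b p : Exp)
  | trunc (k A : Exp)
  | tr (k A a : Exp)
  | truncIsTrunc (n : ℕ) (k A : Exp)
  | truncInd (k A C h g t : Exp)
  | isTrunc (n : ℕ) (k A : Exp)
  | eta (A B f : Exp)
  | cum (n : ℕ) (A : Exp)

noncomputable section

namespace Exp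

/-- The raw term of an expression, for the base level `i` and the meaning `γ` of the constants. -/
def erase (i : ℕ) (γ : ℕ → Tm) : Exp → Tm
  | var k => .var k
  | const c => γ c
  | univ n => .univ (i + n)
  | pi A B => .pi (A.erase i γ) (B.erase i γ)
  | lam A b => .lam (A.erase i γ) (b.erase i γ)
  | app f a => .app (f.erase i γ) (a.erase i γ)
  | sigma A B => .sigma (A.erase i γ) (B.erase i γ)
  | pair _ _ a b => .pair (a.erase i γ) (b.erase i γ)
  | sigmaInd A B C g p =>
      .sigmaInd (A.erase i γ) (B.erase i γ) (C.erase i γ) (g.erase i γ) (p.erase i γ)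
  | sum A B => .sum (A.erase i γ) (B.erase i γ)
  | sumRec A B D c d e =>
      .sumInd (A.erase i γ) (B.erase i γ) (D.erase i γ).wk (c.erase i γ) (d.erase i γ)
        (e.erase i γ)
  | empty => .empty
  | emptyInd C e => .emptyInd (C.erase i γ) (e.erase i γ)
  | nat => .nat
  | zero => .zero
  | succ n => .succ (n.erase i γ)
  | natInd C z s n => .natInd (C.erase i γ) (z.erase i γ) (s.erase i γ) (n.erase i γ)
  | id A a b => .id (A.erase i γ) (a.erase i γ) (b.erase i γ)
  | refl _ a => .refl (a.erase i γ)
  | idInd A C c a b p =>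
      .idInd (A.erase i γ) (C.erase i γ) (c.erase i γ) (a.erase i γ) (b.erase i γ) (p.erase i γ)
  | trunc k A => .trunc (k.erase i γ) (A.erase i γ)
  | tr k _ a => .tr (k.erase i γ) (a.erase i γ)
  | truncIsTrunc n k A => .truncIsTrunc (i + n) (k.erase i γ) (A.erase i γ)
  | truncInd k A C h g t =>
      .truncInd (k.erase i γ) (A.erase i γ) (C.erase i γ) (h.erase i γ) (g.erase i γ)
        (t.erase i γ)
  | isTrunc n k A => HoTT.isTrunc (i + n) (k.erase i γ) (A.erase i γ)
  | eta _ _ f => .refl (f.erase i γ)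
  | cum _ A => A.erase i γ

/-- Weaken by `s` variables, below `c` binders. This function and some others are defined by the
recursor because this makes their evaluation faster. -/
def lift (s : ℕ) (t : Exp) : ℕ → Exp :=
  Exp.rec (motive := fun _ => ℕ → Exp)
    (fun k c => cond (Nat.ble c k) (var (Nat.add k s)) (var k))
    (fun n _ => const n)
    (fun n _ => univ n)
    (fun _ _ A B c => pi (A c) (B (c.succ)))
    (fun _ _ A B c => lam (A c) (B (c.succ)))
    (fun _ _ A B c => app (A c) (B c))
    (fun _ _ A B c => sigma (A c) (B (c.succ)))
    (fun _ _ _ _ A B C D c => pair (A c) (B (c.succ)) (C c) (D c))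
    (fun _ _ _ _ _ A B C D E c => sigmaInd (A c) (B (c.succ)) (C (c.succ)) (D (c.succ.succ)) (E c))
    (fun _ _ A B c => sum (A c) (B c))
    (fun _ _ _ _ _ _ A B C D E F c => sumRec (A c) (B c) (C c) (D (c.succ)) (E (c.succ)) (F c))
    (fun _ => empty)
    (fun _ _ A B c => emptyInd (A (c.succ)) (B c))
    (fun _ => nat)
    (fun _ => zero)
    (fun _ A c => succ (A c))
    (fun _ _ _ _ A B C D c => natInd (A (c.succ)) (B c) (C (c.succ.succ)) (D c))
    (fun _ _ _ A B C c => id (A c) (B c) (C c))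
    (fun _ _ A B c => refl (A c) (B c))
    (fun _ _ _ _ _ _ A B C D E F c => idInd (A c) (B (c.succ.succ.succ)) (C (c.succ)) (D c) (E c) (F c))
    (fun _ _ A B c => trunc (A c) (B c))
    (fun _ _ _ A B C c => tr (A c) (B c) (C c))
    (fun n _ _ A B c => truncIsTrunc n (A c) (B c))
    (fun _ _ _ _ _ _ A B C D E F c => truncInd (A c) (B c) (C (c.succ)) (D (c.succ)) (E (c.succ)) (F c))
    (fun n _ _ A B c => isTrunc n (A c) (B c))
    (fun _ _ _ A B C c => eta (A c) (B (c.succ)) (C c))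
    (fun n _ A c => cum n (A c))
    t

/-- The value of the variable `j`, counted from below `d` binders, under the substitution that
sends the first variables to the entries of the list and weakens the remaining ones by `s`. -/
def pick (s d : ℕ) : List Exp → ℕ → Exp
  | [], j => var (Nat.add (Nat.add j s) d)
  | u :: _, 0 => u.lift d 0
  | _ :: us, j + 1 => pick s d us j

/-- Substitute the entries of the list for the first variables and weaken the remaining ones
by `s`, below `c` binders. -/
def subst (us : List Exp) (s : ℕ) (t : Exp) : ℕ → Exp :=
  Exp.rec (motive := fun _ => ℕ → Exp)
    (fun k c => cond (Nat.ble c k) (pick s c us (Nat.sub k c)) (var k))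
    (fun n _ => const n)
    (fun n _ => univ n)
    (fun _ _ A B c => pi (A c) (B (c.succ)))
    (fun _ _ A B c => lam (A c) (B (c.succ)))
    (fun _ _ A B c => app (A c) (B c))
    (fun _ _ A B c => sigma (A c) (B (c.succ)))
    (fun _ _ _ _ A B C D c => pair (A c) (B (c.succ)) (C c) (D c))
    (fun _ _ _ _ _ A B C D E c => sigmaInd (A c) (B (c.succ)) (C (c.succ)) (D (c.succ.succ)) (E c))
    (fun _ _ A B c => sum (A c) (B c))
    (fun _ _ _ _ _ _ A B C D E F c => sumRec (A c) (B c) (C c) (D (c.succ)) (E (c.succ)) (F c))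
    (fun _ => empty)
    (fun _ _ A B c => emptyInd (A (c.succ)) (B c))
    (fun _ => nat)
    (fun _ => zero)
    (fun _ A c => succ (A c))
    (fun _ _ _ _ A B C D c => natInd (A (c.succ)) (B c) (C (c.succ.succ)) (D c))
    (fun _ _ _ A B C c => id (A c) (B c) (C c))
    (fun _ _ A B c => refl (A c) (B c))
    (fun _ _ _ _ _ _ A B C D E F c => idInd (A c) (B (c.succ.succ.succ)) (C (c.succ)) (D c) (E c) (F c))
    (fun _ _ A B c => trunc (A c) (B c))
    (fun _ _ _ A B C c => tr (A c) (B c) (C c))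
    (fun n _ _ A B c => truncIsTrunc n (A c) (B c))
    (fun _ _ _ _ _ _ A B C D E F c => truncInd (A c) (B c) (C (c.succ)) (D (c.succ)) (E (c.succ)) (F c))
    (fun n _ _ A B c => isTrunc n (A c) (B c))
    (fun _ _ _ A B C c => eta (A c) (B (c.succ)) (C c))
    (fun n _ A c => cum n (A c))
    t

/-- Forget explicit cumulativity at the head. -/
def strip : Exp → Exp
  | cum _ A => A.strip
  | t => t

/-- Equality of expressions up to annotations. -/
def eqb (t : Exp) : Exp → Bool :=
  Exp.rec (motive := fun _ => Exp → Bool)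
    (fun n u => match u.strip with
      | var n' => Nat.beq n n'
      | _ => false)
    (fun n u => match u.strip with
      | const n' => Nat.beq n n'
      | _ => false)
    (fun n u => match u.strip with
      | univ n' => Nat.beq n n'
      | _ => false)
    (fun _ _ A B u => match u.strip with
      | pi A' B' => A A' && B B'
      | _ => false)
    (fun _ _ A B u => match u.strip with
      | lam A' B' => A A' && B B'
      | _ => false)
    (fun _ _ A B u => match u.strip with
      | app A' B' => A A' && B B'
      | _ => false)
    (fun _ _ A B u => match u.strip with
      | sigma A' B' => A A' && B B'
      | _ => false)
    (fun _ _ _ _ _ _ C D u => match u.strip with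
      | pair _ _ C' D' => C C' && D D'
      | _ => false)
    (fun _ _ _ _ _ A B C D E u => match u.strip with
      | sigmaInd A' B' C' D' E' => E E' && D D' && C C' && B B' && A A'
      | _ => false)
    (fun _ _ A B u => match u.strip with
      | sum A' B' => A A' && B B'
      | _ => false)
    (fun _ _ _ _ _ _ A B C D E F u => match u.strip with
      | sumRec A' B' C' D' E' F' => F F' && E E' && D D' && C C' && B B' && A A'
      | _ => false)
    (fun u => match u.strip with
      | empty => true
      | _ => false)
    (fun _ _ A B u => match u.strip with
      | emptyInd A' B' => A A' && B B'
      | _ => false)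
    (fun u => match u.strip with
      | nat => true
      | _ => false)
    (fun u => match u.strip with
      | zero => true
      | _ => false)
    (fun _ A u => match u.strip with
      | succ A' => A A'
      | _ => false)
    (fun _ _ _ _ A B C D u => match u.strip with
      | natInd A' B' C' D' => D D' && C C' && B B' && A A'
      | _ => false)
    (fun _ _ _ A B C u => match u.strip with
      | id A' B' C' => A A' && B B' && C C'
      | _ => false)
    (fun _ _ _ B u => match u.strip with
      | refl _ B' => B B'
      | _ => false)
    (fun _ _ _ _ _ _ A B C D E F u => match u.strip with
      | idInd A' B' C' D' E' F' => F F' && E E' && D D' && C C' && B B' && A A'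
      | _ => false)
    (fun _ _ A B u => match u.strip with
      | trunc A' B' => A A' && B B'
      | _ => false)
    (fun _ _ _ A _ C u => match u.strip with
      | tr A' _ C' => A A' && C C'
      | _ => false)
    (fun n _ _ A B u => match u.strip with
      | truncIsTrunc n' A' B' => Nat.beq n n' && A A' && B B'
      | _ => false)
    (fun _ _ _ _ _ _ A B C D E F u => match u.strip with
      | truncInd A' B' C' D' E' F' => F F' && E E' && D D' && C C' && B B' && A A'
      | _ => false)
    (fun n _ _ A B u => match u.strip with
      | isTrunc n' A' B' => Nat.beq n n' && A A' && B B'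
      | _ => false)
    (fun _ _ _ _ _ C u => match u.strip with
      | eta _ _ C' => C C'
      | _ => false)
    (fun _ _ A u => A u)
    t

/-- All variables are below `d`. -/
def closedAt : Exp → ℕ → Bool
  | var k, d => Nat.ble (k + 1) d
  | const _, _ | univ _, _ | empty, _ | nat, _ | zero, _ => true
  | pi A B, d | lam A B, d | sigma A B, d => A.closedAt d && B.closedAt (d + 1)
  | app A B, d | sum A B, d | trunc A B, d => A.closedAt d && B.closedAt d
  | pair _ _ a b, d => a.closedAt d && b.closedAt d
  | sigmaInd A B C g p, d => A.closedAt d && B.closedAt (d + 1) && C.closedAt (d + 1) &&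
      g.closedAt (d + 2) && p.closedAt d
  | sumRec A B D x y e, d => A.closedAt d && B.closedAt d && D.closedAt d &&
      x.closedAt (d + 1) && y.closedAt (d + 1) && e.closedAt d
  | emptyInd C e, d => C.closedAt (d + 1) && e.closedAt d
  | succ n, d => n.closedAt d
  | natInd C z x n, d => C.closedAt (d + 1) && z.closedAt d && x.closedAt (d + 2) && n.closedAt d
  | id A a b, d => A.closedAt d && a.closedAt d && b.closedAt d
  | refl _ a, d => a.closedAt d
  | idInd A C x a b p, d => A.closedAt d && C.closedAt (d + 3) && x.closedAt (d + 1) &&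
      a.closedAt d && b.closedAt d && p.closedAt d
  | tr k _ a, d => k.closedAt d && a.closedAt d
  | truncIsTrunc _ k A, d | isTrunc _ k A, d => k.closedAt d && A.closedAt d
  | truncInd k A C h g t, d => k.closedAt d && A.closedAt d && C.closedAt (d + 1) &&
      h.closedAt (d + 1) && g.closedAt (d + 1) && t.closedAt d
  | eta _ _ f, d => f.closedAt d
  | cum _ A, d => A.closedAt d

/-- No constant occurs outside of the annotations. -/
def constFree : Exp → Bool
  | const _ => false
  | var _ | univ _ | empty | nat | zero => true
  | pi A B | lam A B | sigma A B | app A B | sum A B | trunc A B | emptyInd A B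
  | pair _ _ A B | tr A _ B | truncIsTrunc _ A B | isTrunc _ A B => A.constFree && B.constFree
  | sigmaInd A B C g p =>
      A.constFree && B.constFree && C.constFree && g.constFree && p.constFree
  | sumRec A B C c d e | truncInd A B C c d e | idInd A B C c d e =>
      A.constFree && B.constFree && C.constFree && c.constFree && d.constFree && e.constFree
  | succ n | refl _ n | eta _ _ n | cum _ n => n.constFree
  | natInd C z x n => C.constFree && z.constFree && x.constFree && n.constFree
  | id A a b => A.constFree && a.constFree && b.constFree

variable {i : ℕ} {γ : ℕ → Tm}

theorem erase_strip (t : Exp) : t.strip.erase i γ = t.erase i γ := by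
  induction t <;> simp_all [strip, erase]

/-- The comparison skips only annotations and explicit cumulativity, and erasure discards both. -/
theorem erase_eq_of_eqb {t u : Exp} (h : t.eqb u = true) : t.erase i γ = u.erase i γ := by
  induction t generalizing u
  case cum ih => exact ih h
  all_goals
    dsimp only [eqb] at h
    rw [← erase_strip u]
    split at h
    · rename_i heq
      rewrite [heq]
      try simp only [Bool.and_eq_true, Nat.beq_eq] at h
      simp only [erase]
      all_goals congr 1 <;> first
          | (apply_assumption; tauto)
          | (apply congrArg; apply_assumption)
          | exact congrArg _ h
          | tauto
    · cases h

/-- Applied to the types of library entries, this shows that their meaning is unaffected when a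
constant is added. -/
theorem erase_constFree {t : Exp} (h : t.constFree = true) (δ : ℕ → Tm) :
    t.erase i γ = t.erase i δ := by
  induction t <;> simp_all [erase, constFree]

theorem up_iterate_lt (σ : ℕ → Tm) {d k : ℕ} (h : k < d) : up^[d] σ k = .var k := by
  induction d generalizing k with
  | zero => omega
  | succ d ih =>
    rw [Function.iterate_succ_apply']
    cases k with
    | zero => rfl
    | succ k => rw [up_succ, ih (by omega)]; rfl

theorem up_iterate_add (σ : ℕ → Tm) (d j : ℕ) :
    up^[d] σ (j + d) = (σ j).subst (shift d) := by
  induction d with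
  | zero => exact (subst_ids _).symm
  | succ d ih =>
    rw [Function.iterate_succ_apply', ← add_assoc, up_succ, ih, wk_eq, subst_subst]
    rfl

theorem wk_subst_up_iterate (t : Tm) (σ : ℕ → Tm) (d : ℕ) :
    t.wk.subst (up^[d] (up σ)) = (t.subst (up^[d] σ)).wk := by
  rw [← Function.iterate_succ_apply, Function.iterate_succ_apply', wk_subst_up]

theorem erase_closedAt {t : Exp} {d : ℕ} (hγ : ∀ c σ, (γ c).subst σ = γ c)
    (h : t.closedAt d = true) (σ : ℕ → Tm) : (t.erase i γ).subst (up^[d] σ) = t.erase i γ := by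
  induction t generalizing d <;>
    simp_all [erase, closedAt, Tm.subst, isTrunc_subst, ← Function.iterate_succ_apply',
      -Function.iterate_succ]
  · exact up_iterate_lt _ (by omega)
  · rw [Function.iterate_succ_apply', wk_subst_up]
    simp_all only

/-- Expressions count the binders that have been passed; on raw terms this corresponds to iterating
`up`. -/
theorem erase_lift (hγ : ∀ c σ, (γ c).subst σ = γ c) (s : ℕ) (t : Exp) (c : ℕ) :
    (t.lift s c).erase i γ = (t.erase i γ).subst (up^[c] (shift s)) := by
  induction t generalizing c <;>
    simp_all [erase, lift, Tm.subst, isTrunc_subst, wk_subst_up_iterate, ← Function.iterate_succ_apply']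
  case var k =>
    rcases h : Nat.ble c k
    · have : k < c := by
        by_contra hh; rw [Nat.ble_eq_true_of_le (by omega)] at h; cases h
      simp [erase, up_iterate_lt _ this]
    · obtain ⟨j, rfl⟩ := Nat.exists_eq_add_of_le' (Nat.le_of_ble_eq_true h)
      simp only [cond_true, erase, up_iterate_add, shift_apply, Tm.subst]
      congr 1; omega

/-- The substitution of raw terms that belongs to the arguments of `Exp.subst`. -/
def substOf (i : ℕ) (γ : ℕ → Tm) (us : List Exp) (s : ℕ) : ℕ → Tm :=
  us.foldr (fun u σ => scons (u.erase i γ) σ) (shift s)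

theorem erase_pick (hγ : ∀ c σ, (γ c).subst σ = γ c) (s d : ℕ) (us : List Exp) (j : ℕ) :
    (pick s d us j).erase i γ = (substOf i γ us s j).subst (shift d) := by
  induction us generalizing j with
  | nil => rfl
  | cons u us ih =>
    cases j with
    | zero => exact erase_lift hγ _ _ _
    | succ j => exact ih j

theorem erase_subst (hγ : ∀ c σ, (γ c).subst σ = γ c) (us : List Exp) (s : ℕ) (t : Exp) (d : ℕ) :
    (t.subst us s d).erase i γ = (t.erase i γ).subst (up^[d] (substOf i γ us s)) := by
  induction t generalizing d <;>
    simp_all [erase, subst, Tm.subst, isTrunc_subst, wk_subst_up_iterate, ← Function.iterate_succ_apply']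
  case var k =>
    rcases h : Nat.ble d k
    · have : k < d := by
        by_contra hh; rw [Nat.ble_eq_true_of_le (by omega)] at h; cases h
      simp [erase, up_iterate_lt _ this]
    · obtain ⟨j, rfl⟩ := Nat.exists_eq_add_of_le' (Nat.le_of_ble_eq_true h)
      simp only [cond_true, up_iterate_add, Nat.add_sub_cancel, erase_pick hγ]

end Exp

end

end HoTT

noncomputable section

namespace HoTT

open Judgment Derivable

namespace Exp

/-! ### Type inference and normalization -/

/-- A function that, with `false`, infers the type of an expression and, with `true`, normalizes
the expression as well. -/
abbrev Eval : Type := Bool → List Exp → Exp → Option (Exp × Exp)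

/-- Substitute `a` for the last variable. -/
def inst (t a : Exp) : Exp := t.subst [a] 0 0

/-- Weaken by `s` variables. -/
def wk (s : ℕ) (t : Exp) : Exp := t.lift s 0

def univLevel (T : Exp) : Option ℕ :=
  match T.strip with
  | univ n => some n
  | _ => none

def guard {α : Type} (b : Bool) (x : Option α) : Option α :=
  match b with
  | true => x
  | false => none

/-- After normalization the inferred type must be a universe as well: an equality of types is always
a judgment in some universe, and that universe has to be exhibited. -/
def asUniv (r : Eval) (Γ : List Exp) (T : Exp) : Option ℕ :=
  match T.strip with
  | univ n => some n
  | _ => (r true Γ T).bind fun q => (univLevel q.2).bind fun _ => univLevel q.1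

def ty (r : Eval) (m : Bool) (Γ : List Exp) (A : Exp) : Option (Exp × ℕ) :=
  (r m Γ A).bind fun q => (asUniv r Γ q.2).bind fun n => some (q.1, n)

def piParts (T : Exp) : Option (Exp × Exp) :=
  match T.strip with
  | pi A B => some (A, B)
  | _ => none

def asPi (r : Eval) (Γ : List Exp) (T : Exp) : Option (Exp × Exp) :=
  match T.strip with
  | pi A B => some (A, B)
  | _ => (ty r true Γ T).bind fun q => piParts q.1

/-- Equality of types: syntactically or after normalization. -/
def conv (r : Eval) (Γ : List Exp) (T U : Exp) : Bool :=
  match T.eqb U with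
  | true => true
  | false =>
    match ty r true Γ T with
    | none => false
    | some q =>
      match ty r true Γ U with
      | none => false
      | some q' => q.1.eqb q'.1

/-- Inclusion of types: equality or cumulativity. -/
def sub (r : Eval) (Γ : List Exp) (T U : Exp) : Bool :=
  match conv r Γ T U with
  | true => true
  | false =>
    match asUniv r Γ T with
    | none => false
    | some n =>
      match asUniv r Γ U with
      | none => false
      | some n' => Nat.ble n n'

def chk (r : Eval) (m : Bool) (Γ : List Exp) (a A : Exp) : Option Exp :=
  (r m Γ a).bind fun q => guard (sub r Γ q.2 A) (some q.1)

/-- Normalize `t`, which is to have the type `T`. -/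
def red (r : Eval) (Γ : List Exp) (t T : Exp) : Option (Exp × Exp) :=
  (chk r true Γ t T).bind fun t' => some (t', T)

/-- The motive of a path induction, at reflexivity. -/
def instRefl (A C : Exp) : Exp := C.subst [refl (A.wk 1) (var 0), var 0, var 0] 1 0

/-- The motive of an induction on a truncation, at the constructor. -/
def instTr (k A C : Exp) : Exp := C.subst [tr (k.wk 1) (A.wk 1) (var 0)] 1 0

/-- The context of the motive of a path induction. -/
def idCtx (A : Exp) (Γ : List Exp) : List Exp :=
  id (A.wk 2) (var 1) (var 0) :: A.wk 1 :: A :: Γ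

/-- The definition of contractibility. -/
def isContr (A : Exp) : Exp := sigma A (pi (A.wk 1) (id (A.wk 2) (var 1) (var 0)))

/-- The definition of truncatedness at a successor level. -/
def isTruncSucc (n : ℕ) (k A : Exp) : Exp :=
  pi A (pi (A.wk 1) (isTrunc n (k.wk 2) (id (A.wk 2) (var 1) (var 0))))

/-- The eta-expansion of a function `f` with domain `A`. -/
def expand (A f : Exp) : Exp := lam A (app (f.wk 1) (var 0))

section Branches

variable (r : Eval) (m : Bool) (Γ : List Exp)

def evBinder (c : Exp → Exp → Exp) (A B : Exp) : Option (Exp × Exp) :=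
  (ty r m Γ A).bind fun q => (ty r m (A :: Γ) B).bind fun q' =>
    some (c q.1 q'.1, univ (max q.2 q'.2))

def evLam (A b : Exp) : Option (Exp × Exp) :=
  (ty r m Γ A).bind fun q => (r m (A :: Γ) b).bind fun q' => some (lam q.1 q'.1, pi A q'.2)

/-- The body is typed but not normalized before the argument is inserted, so that the expensive
normalization is performed on the instance only. -/
def evBeta (A b a : Exp) : Option (Exp × Exp) :=
  (ty r false Γ A).bind fun _ => (r false (A :: Γ) b).bind fun q => (chk r true Γ a A).bind fun a' =>
    -- The reduct is checked anew against the type of the redex, which makes a theorem on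
    -- preservation of types under reduction unnecessary.
    red r Γ (b.inst a') (q.2.inst a)

def evSpine (f a : Exp) : Option (Exp × Exp) :=
  (r m Γ f).bind fun q => (asPi r Γ q.2).bind fun AB => (chk r m Γ a AB.1).bind fun a' =>
    match m, q.1.strip with
    | true, lam _ _ => red r Γ (app q.1 a') (AB.2.inst a)
    | _, _ => some (app q.1 a', AB.2.inst a)

def evApp (f a : Exp) : Option (Exp × Exp) :=
  match m, f.strip with
  | true, lam A b => evBeta r Γ A b a
  | _, _ => evSpine r m Γ f a

def evPair (A B a b : Exp) : Option (Exp × Exp) :=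
  (ty r m Γ A).bind fun q => (ty r m (A :: Γ) B).bind fun q' =>
    (chk r m Γ a A).bind fun a' => (chk r m Γ b (B.inst a)).bind fun b' =>
      some (pair q.1 q'.1 a' b', sigma A B)

def evSigmaInd (A B C g p : Exp) : Option (Exp × Exp) :=
  (ty r m Γ A).bind fun A' => (ty r m (A :: Γ) B).bind fun B' =>
  (ty r m (sigma A B :: Γ) C).bind fun C' =>
  (chk r m (B :: A :: Γ) g
    (C.subst [pair (A.wk 2) (B.lift 2 1) (var 1) (var 0)] 2 0)).bind fun g' =>
  (chk r m Γ p (sigma A B)).bind fun p' =>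
    match m, p'.strip with
    -- The components of the normal form are typed again: reading their types off the type of the
    -- pair would require injectivity of `sigma`.
    | true, pair _ _ a b => (chk r false Γ a A).bind fun _ => (chk r false Γ b (B.inst a)).bind fun _ =>
        red r Γ (g.subst [b, a] 0 0) (C.inst p)
    | _, _ => some (sigmaInd A'.1 B'.1 C'.1 g' p', C.inst p)

def evSum (A B : Exp) : Option (Exp × Exp) :=
  (ty r m Γ A).bind fun q => (ty r m Γ B).bind fun q' => some (sum q.1 q'.1, univ (max q.2 q'.2))

def evSumRec (A B D c d e : Exp) : Option (Exp × Exp) :=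
  (ty r m Γ A).bind fun A' => (ty r m Γ B).bind fun B' => (ty r m Γ D).bind fun D' =>
  (chk r m (A :: Γ) c (D.wk 1)).bind fun c' => (chk r m (B :: Γ) d (D.wk 1)).bind fun d' =>
  (chk r m Γ e (sum A B)).bind fun e' => some (sumRec A'.1 B'.1 D'.1 c' d' e', D)

def evEmptyInd (C e : Exp) : Option (Exp × Exp) :=
  (ty r m (empty :: Γ) C).bind fun C' => (chk r m Γ e empty).bind fun e' =>
    some (emptyInd C'.1 e', C.inst e)

def evSucc (n : Exp) : Option (Exp × Exp) :=
  (chk r m Γ n nat).bind fun n' => some (succ n', nat)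

def evNatInd (C z s n : Exp) : Option (Exp × Exp) :=
  (ty r m (nat :: Γ) C).bind fun C' => (chk r m Γ z (C.inst zero)).bind fun z' =>
  (chk r m (C :: nat :: Γ) s (C.subst [succ (var 1)] 2 0)).bind fun s' =>
  (chk r m Γ n nat).bind fun n' => some (natInd C'.1 z' s' n', C.inst n)

def evId (A a b : Exp) : Option (Exp × Exp) :=
  (ty r m Γ A).bind fun q => (chk r m Γ a A).bind fun a' => (chk r m Γ b A).bind fun b' =>
    some (id q.1 a' b', univ q.2)

def evRefl (A a : Exp) : Option (Exp × Exp) :=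
  (ty r m Γ A).bind fun q => (chk r m Γ a A).bind fun a' => some (refl q.1 a', id A a a)

def evIdInd (A C c a b p : Exp) : Option (Exp × Exp) :=
  (ty r m Γ A).bind fun A' => (ty r m (idCtx A Γ) C).bind fun C' =>
  (chk r m (A :: Γ) c (instRefl A C)).bind fun c' =>
  (chk r m Γ a A).bind fun a' => (chk r m Γ b A).bind fun b' =>
  (chk r m Γ p (id A a b)).bind fun p' =>
    match m, p'.strip with
    -- The computation rule is used only if both normalized endpoints coincide with `x`; the typing
    -- of the reflexivity path is not inverted.
    | true, refl _ x => guard (a'.eqb x && b'.eqb x)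
        (red r Γ (c.inst x) (C.subst [p, b, a] 0 0))
    | _, _ => some (idInd A'.1 C'.1 c' a' b' p', C.subst [p, b, a] 0 0)

def evTrunc (k A : Exp) : Option (Exp × Exp) :=
  (chk r m Γ k nat).bind fun k' => (ty r m Γ A).bind fun q => some (trunc k' q.1, univ q.2)

def evTr (k A a : Exp) : Option (Exp × Exp) :=
  (chk r m Γ k nat).bind fun k' => (ty r m Γ A).bind fun q => (chk r m Γ a A).bind fun a' =>
    some (tr k' q.1 a', trunc k A)

def evTruncIsTrunc (n : ℕ) (k A : Exp) : Option (Exp × Exp) :=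
  (chk r m Γ k nat).bind fun k' => (chk r m Γ A (univ n)).bind fun A' =>
    some (truncIsTrunc n k' A', isTrunc n k (trunc k A))

def evTruncInd (k A C h g t : Exp) : Option (Exp × Exp) :=
  (chk r m Γ k nat).bind fun k' => (ty r m Γ A).bind fun A' =>
  (ty r m (trunc k A :: Γ) C).bind fun C' =>
  (chk r m (trunc k A :: Γ) h (isTrunc C'.2 (k.wk 1) C)).bind fun h' =>
  (chk r m (A :: Γ) g (instTr k A C)).bind fun g' =>
  (chk r m Γ t (trunc k A)).bind fun t' =>
    match m, t'.strip with
    | true, tr k₁ _ x => guard (k'.eqb k₁) ((chk r false Γ x A).bind fun _ =>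
        red r Γ (g.inst x) (C.inst t))
    | _, _ => some (truncInd k' A'.1 C'.1 h' g' t', C.inst t)

def evIsTrunc (n : ℕ) (k A : Exp) : Option (Exp × Exp) :=
  (chk r m Γ k nat).bind fun k' => (chk r m Γ A (univ n)).bind fun A' =>
    match m, k'.strip with
    | true, zero => red r Γ (isContr A') (univ n)
    | true, succ k₁ => (chk r false Γ k₁ nat).bind fun _ => red r Γ (isTruncSucc n k₁ A') (univ n)
    | _, _ => some (isTrunc n k' A', univ n)

/-- The uniqueness rule for functions is not part of the conversion test. It enters only through
this path, which erases to reflexivity. -/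
def evEta (A B f : Exp) : Option (Exp × Exp) :=
  (ty r m Γ A).bind fun A' => (ty r m (A :: Γ) B).bind fun B' =>
  (chk r m Γ f (pi A B)).bind fun f' =>
    some (eta A'.1 B'.1 f', id (pi A B) (expand A f) f)

def evCum (n : ℕ) (A : Exp) : Option (Exp × Exp) :=
  (ty r m Γ A).bind fun q => guard (Nat.ble q.2 n) (some (cum n q.1, univ n))

end Branches

/-- The type of a constant; the list starts with the type of the last one. -/
def constType (G : List Exp) (c : ℕ) : Option Exp := G.reverse[c]?

/-- One layer of recursion, with the recursive calls as a parameter. Soundness can thus be shown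
rule by rule, assuming that the calls are sound. -/
def step (G : List Exp) (r : Eval) (m : Bool) (Γ : List Exp) : Exp → Option (Exp × Exp)
  | var k => Γ[k]?.bind fun A => some (var k, A.wk (k + 1))
  | const c => (constType G c).bind fun A => some (const c, A)
  | univ n => some (univ n, univ (n + 1))
  | pi A B => evBinder r m Γ pi A B
  | lam A b => evLam r m Γ A b
  | app f a => evApp r m Γ f a
  | sigma A B => evBinder r m Γ sigma A B
  | pair A B a b => evPair r m Γ A B a b
  | sigmaInd A B C g p => evSigmaInd r m Γ A B C g p
  | sum A B => evSum r m Γ A B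
  | sumRec A B D c d e => evSumRec r m Γ A B D c d e
  | empty => some (empty, univ 0)
  | emptyInd C e => evEmptyInd r m Γ C e
  | nat => some (nat, univ 0)
  | zero => some (zero, nat)
  | succ n => evSucc r m Γ n
  | natInd C z s n => evNatInd r m Γ C z s n
  | id A a b => evId r m Γ A a b
  | refl A a => evRefl r m Γ A a
  | idInd A C c a b p => evIdInd r m Γ A C c a b p
  | trunc k A => evTrunc r m Γ k A
  | tr k A a => evTr r m Γ k A a
  | truncIsTrunc n k A => evTruncIsTrunc r m Γ n k A
  | truncInd k A C h g t => evTruncInd r m Γ k A C h g t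
  | isTrunc n k A => evIsTrunc r m Γ n k A
  | eta A B f => evEta r m Γ A B f
  | cum n A => evCum r m Γ n A

/-- Type inference and normalization, with recursion depth `fuel`. -/
def ev (G : List Exp) (fuel : ℕ) : Eval :=
  Nat.rec (fun _ _ _ => none) (fun _ r => step G r) fuel

/-! ### Soundness -/

variable {i : ℕ} {γ : ℕ → Tm} {r : Eval} {m : Bool} {Γ : List Exp}

section

variable (i γ)

/-- The context of raw terms of a context of expressions. -/
abbrev eraseCtx (Γ : List Exp) : Ctx := Γ.map (erase i γ)

abbrev Typed (Γ : List Exp) (a A : Exp) : Prop :=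
  Derivable (typed (eraseCtx i γ Γ) (a.erase i γ) (A.erase i γ))

abbrev Equal (Γ : List Exp) (a b A : Exp) : Prop :=
  Derivable (equal (eraseCtx i γ Γ) (a.erase i γ) (b.erase i γ) (A.erase i γ))

def IsType (Γ : List Exp) (A : Exp) : Prop := ∃ n, Typed i γ Γ A (univ n)

def EqType (Γ : List Exp) (A B : Exp) : Prop := ∃ n, Equal i γ Γ A B (univ n)

/-- Constants are closed. -/
def ClosedConsts : Prop := ∀ c σ, (γ c).subst σ = γ c

/-- A single statement covers inference and normalization, because an equality presupposes the
typing of its left side. -/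
def Sound (r : Eval) : Prop := ∀ m Γ t t' T, r m Γ t = some (t', T) →
  Derivable (ctx (eraseCtx i γ Γ)) → Equal i γ Γ t t' T

end

theorem univ_of_le {Γ : Ctx} {A : Tm} {n : ℕ} (h : Derivable (typed Γ A (.univ n))) :
    Derivable (typed Γ A (.univ (i + n))) :=
  h.univ_le (by omega)

/-- Expressions can name only universes above the base level; cumulativity lifts any other universe
to one of these. -/
theorem isType_iff {A : Exp} :
    IsType i γ Γ A ↔ ∃ n, Derivable (typed (eraseCtx i γ Γ) (A.erase i γ) (.univ n)) :=
  ⟨fun ⟨_, h⟩ => ⟨_, h⟩, fun ⟨n, h⟩ => ⟨n, univ_of_le h⟩⟩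

theorem Equal.left {a b A : Exp} (h : Equal i γ Γ a b A) : Typed i γ Γ a A := h.presupposition.1

theorem Equal.right {a b A : Exp} (h : Equal i γ Γ a b A) : Typed i γ Γ b A :=
  h.presupposition.2.1

theorem Equal.isType {a b A : Exp} (h : Equal i γ Γ a b A) : IsType i γ Γ A :=
  isType_iff.2 h.presupposition.2.2

theorem Typed.isType {a A : Exp} (h : Typed i γ Γ a A) : IsType i γ Γ A :=
  isType_iff.2 h.presupposition

theorem Equal.conv {a b A B : Exp} (h : Equal i γ Γ a b A) (e : EqType i γ Γ A B) :
    Equal i γ Γ a b B :=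
  eq_conv h e.choose_spec

theorem EqType.symm {A B : Exp} (h : EqType i γ Γ A B) : EqType i γ Γ B A :=
  ⟨_, eq_symm h.choose_spec⟩

theorem EqType.trans {A B C : Exp} (h : EqType i γ Γ A B) (h' : EqType i γ Γ B C) :
    EqType i γ Γ A C := by
  obtain ⟨n, h⟩ := h
  obtain ⟨n', h'⟩ := h'
  exact ⟨max n n', eq_trans (h.univ_le_eq (by omega)) (h'.univ_le_eq (by omega))⟩

theorem IsType.eqType {A B : Exp} (h : IsType i γ Γ A) (e : A.erase i γ = B.erase i γ) :
    EqType i γ Γ A B := by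
  obtain ⟨n, h⟩ := h
  refine ⟨n, ?_⟩
  rw [Equal, ← e]
  exact eq_refl h

theorem Equal.to_eqType {A B : Exp} {n : ℕ} (h : Equal i γ Γ A B (univ n)) : EqType i γ Γ A B :=
  ⟨n, h⟩

theorem guard_eq_some {α : Type} {b : Bool} {x : Option α} {y : α} :
    guard b x = some y ↔ b = true ∧ x = some y := by
  cases b <;> simp [guard]

theorem univLevel_eq_some {T : Exp} {n : ℕ} (h : univLevel T = some n) :
    T.erase i γ = .univ (i + n) := by
  rw [univLevel] at h
  split at h
  · rename_i e
    cases h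
    rw [← erase_strip, e]; rfl
  · cases h

theorem asUniv_sound (hr : Sound i γ r) (hΓ : Derivable (ctx (eraseCtx i γ Γ))) {T : Exp} {n : ℕ}
    (h : asUniv r Γ T = some n) (hT : IsType i γ Γ T) : EqType i γ Γ T (univ n) := by
  rw [asUniv] at h
  split at h
  · rename_i e
    cases h
    exact hT.eqType (by rw [← erase_strip, e])
  · simp only [Option.bind_eq_some_iff] at h
    obtain ⟨⟨T', S⟩, h, n', hn', hn⟩ := h
    have h := hr _ _ _ _ _ h hΓ
    refine ⟨n', ?_⟩
    rw [Equal, univLevel_eq_some hn', univLevel_eq_some hn] at h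
    exact h

theorem ty_sound (hr : Sound i γ r) (hΓ : Derivable (ctx (eraseCtx i γ Γ))) {A : Exp}
    {q : Exp × ℕ} (h : ty r m Γ A = some q) : Equal i γ Γ A q.1 (univ q.2) := by
  simp only [ty, Option.bind_eq_some_iff, Option.some.injEq] at h
  obtain ⟨⟨A', S⟩, h, n, hn, rfl⟩ := h
  have h := hr _ _ _ _ _ h hΓ
  exact h.conv (asUniv_sound hr hΓ hn h.isType)

theorem piParts_eq_some {T : Exp} {q : Exp × Exp} (h : piParts T = some q) :
    T.erase i γ = (pi q.1 q.2).erase i γ := by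
  rw [piParts] at h
  split at h
  · rename_i e
    cases h
    rw [← erase_strip, e]
  · cases h

theorem asPi_sound (hr : Sound i γ r) (hΓ : Derivable (ctx (eraseCtx i γ Γ))) {T : Exp}
    {q : Exp × Exp} (h : asPi r Γ T = some q) (hT : IsType i γ Γ T) :
    EqType i γ Γ T (pi q.1 q.2) := by
  rw [asPi] at h
  split at h
  · rename_i e
    cases h
    exact hT.eqType (by rw [← erase_strip, e])
  · simp only [Option.bind_eq_some_iff] at h
    obtain ⟨⟨T', n⟩, h, hp⟩ := h
    have h := ty_sound hr hΓ h
    rw [Equal, piParts_eq_some hp] at h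
    exact ⟨_, h⟩

/-- Each side equals its normal form judgmentally, and the normal forms have the same erasure.
Nothing is claimed about completeness of the test, so confluence plays no role. -/
theorem conv_sound (hr : Sound i γ r) (hΓ : Derivable (ctx (eraseCtx i γ Γ))) {T U : Exp}
    (h : conv r Γ T U = true) (hT : IsType i γ Γ T) : EqType i γ Γ T U := by
  rw [conv] at h
  split at h
  · rename_i e
    exact hT.eqType (erase_eq_of_eqb e)
  · split at h
    · cases h
    · rename_i q hq
      split at h
      · cases h
      · rename_i q' hq'
        have e := (ty_sound hr hΓ hq).to_eqType
        have e' := (ty_sound hr hΓ hq').to_eqType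
        have e₂ := erase_eq_of_eqb (i := i) (γ := γ) h
        refine e.trans (EqType.trans (IsType.eqType ?_ e₂) e'.symm)
        exact ⟨_, Equal.right e.choose_spec⟩

theorem chk_sound (hr : Sound i γ r) (hΓ : Derivable (ctx (eraseCtx i γ Γ))) {a a' A : Exp}
    (h : chk r m Γ a A = some a') (hA : IsType i γ Γ A) : Equal i γ Γ a a' A := by
  simp only [chk, Option.bind_eq_some_iff, guard_eq_some, Option.some.injEq] at h
  obtain ⟨⟨a', T⟩, h, hs, rfl⟩ := h
  have h := hr _ _ _ _ _ h hΓ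
  rw [sub] at hs
  split at hs
  · rename_i hc
    exact h.conv (conv_sound hr hΓ hc h.isType)
  · split at hs
    · cases hs
    · rename_i n hn
      split at hs
      · cases hs
      · rename_i n' hn'
        have h₁ := h.conv (asUniv_sound hr hΓ hn h.isType)
        refine Equal.conv ?_ (asUniv_sound hr hΓ hn' hA).symm
        exact Derivable.univ_le_eq h₁ (Nat.add_le_add_left (Nat.le_of_ble_eq_true hs) i)

theorem red_sound (hr : Sound i γ r) (hΓ : Derivable (ctx (eraseCtx i γ Γ))) {t T : Exp}
    {q : Exp × Exp} (h : red r Γ t T = some q) (hT : IsType i γ Γ T) :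
    Equal i γ Γ t q.1 T ∧ q.2 = T := by
  simp only [red, Option.bind_eq_some_iff, Option.some.injEq] at h
  obtain ⟨t', h, rfl⟩ := h
  exact ⟨chk_sound hr hΓ h hT, rfl⟩

/-! ### Erasure of particular substitutions -/

theorem erase_inst (hγ : ClosedConsts γ) (t a : Exp) :
    (t.inst a).erase i γ = (t.erase i γ).inst (a.erase i γ) :=
  erase_subst hγ _ _ _ _

theorem erase_inst₂ (hγ : ClosedConsts γ) (t a b : Exp) :
    (t.subst [b, a] 0 0).erase i γ = (t.erase i γ).inst₂ (a.erase i γ) (b.erase i γ) :=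
  erase_subst hγ _ _ _ _

theorem erase_inst₃ (hγ : ClosedConsts γ) (t a b c : Exp) :
    (t.subst [c, b, a] 0 0).erase i γ =
      (t.erase i γ).inst₃ (a.erase i γ) (b.erase i γ) (c.erase i γ) :=
  erase_subst hγ _ _ _ _

theorem erase_instWk (hγ : ClosedConsts γ) (n : ℕ) (t a : Exp) :
    (t.subst [a] n 0).erase i γ = (t.erase i γ).instWk n (a.erase i γ) :=
  erase_subst hγ _ _ _ _

theorem erase_instRefl (hγ : ClosedConsts γ) (A C : Exp) :
    (instRefl A C).erase i γ = (C.erase i γ).subst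
      (scons (.refl (.var 0)) (scons (.var 0) (scons (.var 0) (shift 1)))) :=
  erase_subst hγ _ _ _ _

theorem erase_wk (hγ : ClosedConsts γ) (s : ℕ) (t : Exp) :
    (t.wk s).erase i γ = (t.erase i γ).subst (shift s) :=
  erase_lift hγ _ _ _

theorem erase_wk_one (hγ : ClosedConsts γ) (t : Exp) : (t.wk 1).erase i γ = (t.erase i γ).wk := by
  rw [erase_wk hγ, wk_eq]

theorem erase_wk_two (hγ : ClosedConsts γ) (t : Exp) :
    (t.wk 2).erase i γ = (t.erase i γ).wk.wk := by
  rw [erase_wk hγ, wk_eq, wk_eq, subst_subst]; rfl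

theorem erase_instTr (hγ : ClosedConsts γ) (k A C : Exp) :
    (instTr k A C).erase i γ = (C.erase i γ).instWk 1 (.tr (k.erase i γ).wk (.var 0)) := by
  rw [instTr, erase_instWk hγ, erase, erase_wk_one hγ]; rfl

theorem eraseCtx_idCtx (hγ : ClosedConsts γ) (A : Exp) :
    eraseCtx i γ (idCtx A Γ) =
      .id (A.erase i γ).wk.wk (.var 1) (.var 0) :: (A.erase i γ).wk :: A.erase i γ ::
        eraseCtx i γ Γ := by
  simp only [idCtx, eraseCtx, List.map_cons, erase, erase_wk_one hγ, erase_wk_two hγ]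

theorem erase_isContr (hγ : ClosedConsts γ) (A : Exp) :
    (isContr A).erase i γ = HoTT.isContr (A.erase i γ) := by
  simp only [isContr, HoTT.isContr, erase, erase_wk_one hγ, erase_wk_two hγ]

end Exp
end HoTT

end

/-! ### Soundness of the individual rules of the checker, and libraries of derivable constants. -/

noncomputable section

namespace HoTT

open Judgment Derivable

namespace Exp

variable {i : ℕ} {γ : ℕ → Tm} {r : Eval} {m : Bool} {Γ : List Exp}

theorem Typed.ctx_cons {A : Exp} {n : ℕ} (h : Typed i γ Γ A (univ n)) :
    Derivable (ctx (eraseCtx i γ (A :: Γ))) :=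
  Derivable.ctx_cons (Derivable.ctx_of h) h

theorem Equal.le {A B : Exp} {n n' : ℕ} (h : Equal i γ Γ A B (univ n)) (hn : n ≤ n') :
    Equal i γ Γ A B (univ n') :=
  Derivable.univ_le_eq h (by omega)

theorem Typed.le {A : Exp} {n n' : ℕ} (h : Typed i γ Γ A (univ n)) (hn : n ≤ n') :
    Typed i γ Γ A (univ n') :=
  Derivable.univ_le h (by omega)

theorem Typed.isType_inst (hγ : ClosedConsts γ) {A B a : Exp} {n : ℕ}
    (hB : Typed i γ (A :: Γ) B (univ n)) (ha : Typed i γ Γ a A) :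
    Typed i γ Γ (B.inst a) (univ n) := by
  rw [Typed, erase_inst hγ]
  exact Derivable.inst hB ha

theorem Equal.inst_congr (hγ : ClosedConsts γ) {A B a a' : Exp} {n : ℕ}
    (hB : Typed i γ (A :: Γ) B (univ n)) (ha : Equal i γ Γ a a' A) :
    EqType i γ Γ (B.inst a) (B.inst a') := by
  refine ⟨n, ?_⟩
  rw [Equal, erase_inst hγ, erase_inst hγ]
  exact Derivable.inst_congr hB ha.left ha

theorem erase_of_strip {t u : Exp} (h : t.strip = u) : t.erase i γ = u.erase i γ := by
  rw [← erase_strip, h]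

variable (hr : Sound i γ r) (hγ : ClosedConsts γ) (hΓ : Derivable (ctx (eraseCtx i γ Γ)))
include hr hΓ

theorem evPi_sound {A B : Exp} {q : Exp × Exp} (h : evBinder r m Γ pi A B = some q) :
    Equal i γ Γ (pi A B) q.1 q.2 := by
  simp only [evBinder, Option.bind_eq_some_iff, Option.some.injEq] at h
  obtain ⟨A', hA, B', hB, rfl⟩ := h
  replace hA := ty_sound hr hΓ hA
  replace hB := ty_sound hr hA.left.ctx_cons hB
  have hA := hA.le (Nat.le_max_left _ B'.2)
  exact pi_form_eq hA.left hA (hB.le (Nat.le_max_right _ _))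

theorem evSigma_sound {A B : Exp} {q : Exp × Exp} (h : evBinder r m Γ sigma A B = some q) :
    Equal i γ Γ (sigma A B) q.1 q.2 := by
  simp only [evBinder, Option.bind_eq_some_iff, Option.some.injEq] at h
  obtain ⟨A', hA, B', hB, rfl⟩ := h
  replace hA := ty_sound hr hΓ hA
  replace hB := ty_sound hr hA.left.ctx_cons hB
  have hA := hA.le (Nat.le_max_left _ B'.2)
  exact sigma_form_eq hA.left hA (hB.le (Nat.le_max_right _ _))

theorem evLam_sound {A b : Exp} {q : Exp × Exp} (h : evLam r m Γ A b = some q) :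
    Equal i γ Γ (lam A b) q.1 q.2 := by
  simp only [evLam, Option.bind_eq_some_iff, Option.some.injEq] at h
  obtain ⟨A', hA, b', hb, rfl⟩ := h
  replace hA := ty_sound hr hΓ hA
  exact pi_intro_eq hA.left hA (hr _ _ _ _ _ hb hA.left.ctx_cons)

include hγ

theorem evBeta_sound {A b a : Exp} {q : Exp × Exp} (h : evBeta r Γ A b a = some q) :
    Equal i γ Γ (app (lam A b) a) q.1 q.2 := by
  simp only [evBeta, Option.bind_eq_some_iff] at h
  obtain ⟨A', hA, ⟨b', B⟩, hb, a', ha, h⟩ := h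
  replace hA := (ty_sound hr hΓ hA).left
  replace hb := (hr _ _ _ _ _ hb hA.ctx_cons).left
  replace ha := chk_sound hr hΓ ha ⟨_, hA⟩
  obtain ⟨n, hB⟩ := hb.isType
  obtain ⟨h, e⟩ := red_sound hr hΓ h ⟨_, hB.isType_inst hγ ha.left⟩
  rw [e]
  have h₁ : Equal i γ Γ (app (lam A b) a) (app (lam A b) a') (B.inst a) := by
    rw [Equal, erase_inst hγ]
    exact pi_elim_eq (eq_refl (pi_intro hA hb)) ha
  have h₂ : Equal i γ Γ (app (lam A b) a') (b.inst a') (B.inst a') := by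
    rw [Equal, erase_inst hγ, erase_inst hγ]
    exact pi_comp hA hb ha.right
  exact eq_trans h₁ (eq_trans (h₂.conv (Equal.inst_congr hγ hB ha).symm) h)

theorem evSpine_sound {f a : Exp} {q : Exp × Exp} (h : evSpine r m Γ f a = some q) :
    Equal i γ Γ (app f a) q.1 q.2 := by
  simp only [evSpine, Option.bind_eq_some_iff] at h
  obtain ⟨⟨f', F⟩, hf, ⟨A, B⟩, hF, a', ha, h⟩ := h
  replace hf := hr _ _ _ _ _ hf hΓ
  replace hF := asPi_sound hr hΓ hF hf.isType
  have hf := hf.conv hF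
  obtain ⟨n, hA, hB⟩ := Derivable.pi_inv (Equal.right hF.choose_spec)
  replace ha := chk_sound hr hΓ ha ⟨n, univ_of_le hA⟩
  have h₁ : Equal i γ Γ (app f a) (app f' a') (B.inst a) := by
    rw [Equal, erase_inst hγ]
    exact pi_elim_eq hf ha
  split at h
  · obtain ⟨h, e⟩ := red_sound hr hΓ h h₁.isType
    rw [e]
    exact eq_trans h₁ h
  · cases h
    exact h₁

theorem evApp_sound {f a : Exp} {q : Exp × Exp} (h : evApp r m Γ f a = some q) :
    Equal i γ Γ (app f a) q.1 q.2 := by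
  unfold evApp at h
  split at h
  · rename_i e
    have := evBeta_sound hr hγ hΓ h
    rw [Equal, erase, ← erase_of_strip e] at this
    exact this
  · exact evSpine_sound hr hγ hΓ h

theorem evPair_sound {A B a b : Exp} {q : Exp × Exp} (h : evPair r m Γ A B a b = some q) :
    Equal i γ Γ (pair A B a b) q.1 q.2 := by
  simp only [evPair, Option.bind_eq_some_iff, Option.some.injEq] at h
  obtain ⟨A', hA, B', hB, a', ha, b', hb, rfl⟩ := h
  replace hA := (ty_sound hr hΓ hA).left
  replace hB := (ty_sound hr hA.ctx_cons hB).left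
  replace ha := chk_sound hr hΓ ha ⟨_, hA⟩
  replace hb := chk_sound hr hΓ hb ⟨_, hB.isType_inst hγ ha.left⟩
  rw [Equal, erase_inst hγ] at hb
  exact sigma_intro_eq (hA.le (Nat.le_max_left _ B'.2)) (hB.le (Nat.le_max_right _ _)) ha hb

theorem evSigmaInd_sound {A B C g p : Exp} {q : Exp × Exp}
    (h : evSigmaInd r m Γ A B C g p = some q) :
    Equal i γ Γ (sigmaInd A B C g p) q.1 q.2 := by
  simp only [evSigmaInd, Option.bind_eq_some_iff] at h
  obtain ⟨A', hA, B', hB, C', hC, g', hg, p', hp, h⟩ := h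
  replace hA := ty_sound hr hΓ hA
  replace hB := ty_sound hr hA.left.ctx_cons hB
  have hA := hA.le (Nat.le_max_left _ B'.2)
  have hB := hB.le (Nat.le_max_right A'.2 _)
  have hAB : Typed i γ Γ (sigma A B) (univ _) := sigma_form hA.left hB.left
  replace hC := ty_sound hr hAB.ctx_cons hC
  have e : ((C.subst [pair (A.wk 2) (B.lift 2 1) (var 1) (var 0)] 2 0).erase i γ) =
      (C.erase i γ).instWk 2 (.pair (.var 1) (.var 0)) := erase_instWk hγ _ _ _
  replace hg := chk_sound hr hB.left.ctx_cons hg ⟨C'.2, by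
    rw [Typed, e]
    exact hC.left.subst hB.left.ctx_cons (isSubst_pair hA.left hB.left)⟩
  rw [Equal, e] at hg
  replace hp := chk_sound hr hΓ hp ⟨_, hAB⟩
  have h₁ : Equal i γ Γ (sigmaInd A B C g p) (sigmaInd A'.1 B'.1 C'.1 g' p') (C.inst p) := by
    rw [Equal, erase_inst hγ]
    exact sigma_elim_eq hA.left hB.left hA hB hC hg hp
  split at h
  · rename_i a b hs
    simp only [Option.bind_eq_some_iff] at h
    obtain ⟨_, ha, _, hb, h⟩ := h
    replace ha := (chk_sound hr hΓ ha ⟨_, hA.left⟩).left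
    replace hb := (chk_sound hr hΓ hb ⟨_, hB.left.isType_inst hγ ha⟩).left
    rw [Typed, erase_inst hγ] at hb
    obtain ⟨h, e'⟩ := red_sound hr hΓ h h₁.isType
    rw [e']
    refine eq_trans ?_ h
    rw [erase_inst₂ hγ]
    rw [Equal, erase_of_strip hs] at hp
    have hC' := Derivable.inst_congr hC.left hp.presupposition.1 hp
    rw [erase_inst hγ]
    refine eq_trans (sigma_elim_eq hA.left hB.left (eq_refl hA.left) (eq_refl hB.left)
      (eq_refl hC.left) (eq_refl hg.presupposition.1) hp) ?_
    exact eq_conv (sigma_comp hA.left hB.left hC.left hg.presupposition.1 ha hb) (eq_symm hC')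
  · cases h
    exact h₁

omit hγ in
theorem evSum_sound {A B : Exp} {q : Exp × Exp} (h : evSum r m Γ A B = some q) :
    Equal i γ Γ (sum A B) q.1 q.2 := by
  simp only [evSum, Option.bind_eq_some_iff, Option.some.injEq] at h
  obtain ⟨A', hA, B', hB, rfl⟩ := h
  exact sum_form_eq ((ty_sound hr hΓ hA).le (Nat.le_max_left _ _))
    ((ty_sound hr hΓ hB).le (Nat.le_max_right _ _))

theorem evSumRec_sound {A B D c d e : Exp} {q : Exp × Exp}
    (h : evSumRec r m Γ A B D c d e = some q) : Equal i γ Γ (sumRec A B D c d e) q.1 q.2 := by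
  simp only [evSumRec, Option.bind_eq_some_iff, Option.some.injEq] at h
  obtain ⟨A', hA, B', hB, D', hD, c', hc, d', hd, e', he, rfl⟩ := h
  replace hA := (ty_sound hr hΓ hA).le (Nat.le_max_left _ B'.2)
  replace hB := (ty_sound hr hΓ hB).le (Nat.le_max_right A'.2 _)
  replace hD := ty_sound hr hΓ hD
  have hS : Typed i γ Γ (sum A B) (univ _) := sum_form hA.left hB.left
  replace hc := chk_sound hr hA.left.ctx_cons hc ⟨D'.2, by
    rw [Typed, erase_wk_one hγ]; exact hD.left.weaken hA.left⟩
  replace hd := chk_sound hr hB.left.ctx_cons hd ⟨D'.2, by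
    rw [Typed, erase_wk_one hγ]; exact hD.left.weaken hB.left⟩
  replace he := chk_sound hr hΓ he ⟨_, hS⟩
  have key : ∀ t, (D.erase i γ).wk.instWk 1 t = (D.erase i γ).wk := fun t => by
    rw [Tm.instWk, subst_wk, wk_eq]; rfl
  rw [Equal, erase_wk_one hγ, ← key] at hc hd
  have := sum_elim_eq hA.left hB.left hA hB (hD.weaken_eq hS) hc hd he
  rw [wk_inst] at this
  exact this

theorem evEmptyInd_sound {C e : Exp} {q : Exp × Exp} (h : evEmptyInd r m Γ C e = some q) :
    Equal i γ Γ (emptyInd C e) q.1 q.2 := by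
  simp only [evEmptyInd, Option.bind_eq_some_iff, Option.some.injEq] at h
  obtain ⟨C', hC, e', he, rfl⟩ := h
  have hE : Typed i γ Γ empty (univ 0) := empty_form hΓ
  replace hC := ty_sound hr hE.ctx_cons hC
  rw [Equal, erase_inst hγ]
  exact empty_elim_eq hC (chk_sound hr hΓ he ⟨_, hE⟩)

omit hγ in
theorem evSucc_sound {n : Exp} {q : Exp × Exp} (h : evSucc r m Γ n = some q) :
    Equal i γ Γ (succ n) q.1 q.2 := by
  simp only [evSucc, Option.bind_eq_some_iff, Option.some.injEq] at h
  obtain ⟨n', hn, rfl⟩ := h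
  exact nat_succ_eq (chk_sound hr hΓ hn ⟨0, nat_form hΓ⟩)

theorem evNatInd_sound {C z s n : Exp} {q : Exp × Exp} (h : evNatInd r m Γ C z s n = some q) :
    Equal i γ Γ (natInd C z s n) q.1 q.2 := by
  simp only [evNatInd, Option.bind_eq_some_iff, Option.some.injEq] at h
  obtain ⟨C', hC, z', hz, s', hs, n', hn, rfl⟩ := h
  have hN : Typed i γ Γ nat (univ 0) := nat_form hΓ
  replace hC := ty_sound hr hN.ctx_cons hC
  replace hz := chk_sound hr hΓ hz ⟨_, hC.left.isType_inst hγ (nat_zero hΓ)⟩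
  have e : (C.subst [succ (var 1)] 2 0).erase i γ = (C.erase i γ).instWk 2 (.succ (.var 1)) :=
    erase_instWk hγ _ _ _
  replace hs := chk_sound hr hC.left.ctx_cons hs ⟨C'.2, by
    rw [Typed, e]
    exact hC.left.subst hC.left.ctx_cons (isSubst_succ hC.left)⟩
  rw [Equal, e] at hs
  rw [Equal, erase_inst hγ] at hz ⊢
  exact nat_elim_eq hC.left hC hz hs (chk_sound hr hΓ hn ⟨_, hN⟩)

omit hγ in
theorem evId_sound {A a b : Exp} {q : Exp × Exp} (h : evId r m Γ A a b = some q) :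
    Equal i γ Γ (id A a b) q.1 q.2 := by
  simp only [evId, Option.bind_eq_some_iff, Option.some.injEq] at h
  obtain ⟨A', hA, a', ha, b', hb, rfl⟩ := h
  replace hA := ty_sound hr hΓ hA
  exact id_form_eq hA (chk_sound hr hΓ ha ⟨_, hA.left⟩) (chk_sound hr hΓ hb ⟨_, hA.left⟩)

omit hγ in
theorem evRefl_sound {A a : Exp} {q : Exp × Exp} (h : evRefl r m Γ A a = some q) :
    Equal i γ Γ (refl A a) q.1 q.2 := by
  simp only [evRefl, Option.bind_eq_some_iff, Option.some.injEq] at h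
  obtain ⟨A', hA, a', ha, rfl⟩ := h
  replace hA := ty_sound hr hΓ hA
  exact id_intro_eq hA.left (chk_sound hr hΓ ha ⟨_, hA.left⟩)

theorem evIdInd_sound {A C c a b p : Exp} {q : Exp × Exp}
    (h : evIdInd r m Γ A C c a b p = some q) : Equal i γ Γ (idInd A C c a b p) q.1 q.2 := by
  simp only [evIdInd, Option.bind_eq_some_iff] at h
  obtain ⟨A', hA, C', hC, c', hc, a', ha, b', hb, p', hp, h⟩ := h
  replace hA := ty_sound hr hΓ hA
  obtain ⟨hA₁, hA₂⟩ := id_ctx hA.left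
  have hΓ₃ : Derivable (ctx (eraseCtx i γ (idCtx A Γ))) := by
    rw [eraseCtx_idCtx hγ]; exact Derivable.ctx_cons hA₂.ctx_of hA₂
  replace hC := ty_sound hr hΓ₃ hC
  rw [Equal, eraseCtx_idCtx hγ] at hC
  have hC' := hC.presupposition.1
  replace hc := chk_sound hr hA.left.ctx_cons hc ⟨C'.2, by
    rw [Typed, erase_instRefl hγ]
    exact hC'.subst hA.left.ctx_cons (isSubst_refl hA.left)⟩
  rw [Equal, erase_instRefl hγ] at hc
  replace ha := chk_sound hr hΓ ha ⟨_, hA.left⟩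
  replace hb := chk_sound hr hΓ hb ⟨_, hA.left⟩
  replace hp := chk_sound hr hΓ hp ⟨A'.2, id_form hA.left ha.left hb.left⟩
  have h₁ : Equal i γ Γ (idInd A C c a b p) (idInd A'.1 C'.1 c' a' b' p')
      (C.subst [p, b, a] 0 0) := by
    rw [Equal, erase_inst₃ hγ]
    exact id_elim_eq hA.left hA hC hc ha hb hp
  split at h
  · rename_i x hs
    simp only [guard_eq_some, Bool.and_eq_true] at h
    obtain ⟨⟨e₁, e₂⟩, h⟩ := h
    obtain ⟨h, e'⟩ := red_sound hr hΓ h h₁.isType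
    rw [e']
    refine eq_trans ?_ h
    rw [Equal, erase_of_strip hs] at hp
    rw [Equal, erase_eq_of_eqb e₁] at ha
    rw [Equal, erase_eq_of_eqb e₂] at hb
    rw [erase_inst₃ hγ, erase_inst hγ]
    refine eq_trans (id_elim_eq hA.left (eq_refl hA.left) (eq_refl hC')
      (eq_refl hc.presupposition.1) ha hb hp) ?_
    -- The computation rule yields the motive at `x`, `x` and reflexivity; functionality identifies
    -- this with the motive at the given endpoints and path.
    have e₃ := hC'.functional _ _ _ hΓ (isSubstEq_inst₃ ha.presupposition.1 hb.presupposition.1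
      hp.presupposition.1 ha hb hp)
    exact eq_conv (id_comp hA.left hC' hc.presupposition.1 ha.presupposition.2.1) (eq_symm e₃)
  · cases h
    exact h₁

omit hγ in
theorem evTrunc_sound {k A : Exp} {q : Exp × Exp} (h : evTrunc r m Γ k A = some q) :
    Equal i γ Γ (trunc k A) q.1 q.2 := by
  simp only [evTrunc, Option.bind_eq_some_iff, Option.some.injEq] at h
  obtain ⟨k', hk, A', hA, rfl⟩ := h
  exact trunc_form_eq (chk_sound hr hΓ hk ⟨0, nat_form hΓ⟩) (ty_sound hr hΓ hA)

omit hγ in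
theorem evTr_sound {k A a : Exp} {q : Exp × Exp} (h : evTr r m Γ k A a = some q) :
    Equal i γ Γ (tr k A a) q.1 q.2 := by
  simp only [evTr, Option.bind_eq_some_iff, Option.some.injEq] at h
  obtain ⟨k', hk, A', hA, a', ha, rfl⟩ := h
  replace hA := (ty_sound hr hΓ hA).left
  exact trunc_intro_eq hA (chk_sound hr hΓ hk ⟨0, nat_form hΓ⟩) (chk_sound hr hΓ ha ⟨_, hA⟩)

omit hγ in
theorem evTruncIsTrunc_sound {n : ℕ} {k A : Exp} {q : Exp × Exp}
    (h : evTruncIsTrunc r m Γ n k A = some q) : Equal i γ Γ (truncIsTrunc n k A) q.1 q.2 := by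
  simp only [evTruncIsTrunc, Option.bind_eq_some_iff, Option.some.injEq] at h
  obtain ⟨k', hk, A', hA, rfl⟩ := h
  exact trunc_isTrunc_eq (chk_sound hr hΓ hk ⟨0, nat_form hΓ⟩)
    (chk_sound hr hΓ hA ⟨n + 1, univ_form hΓ⟩)

theorem evTruncInd_sound {k A C h₀ g t : Exp} {q : Exp × Exp}
    (h : evTruncInd r m Γ k A C h₀ g t = some q) :
    Equal i γ Γ (truncInd k A C h₀ g t) q.1 q.2 := by
  simp only [evTruncInd, Option.bind_eq_some_iff] at h
  obtain ⟨k', hk, A', hA, C', hC, h₀', hh, g', hg, t', ht, h⟩ := h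
  replace hk := chk_sound hr hΓ hk ⟨0, nat_form hΓ⟩
  replace hA := ty_sound hr hΓ hA
  have hT : Typed i γ Γ (trunc k A) (univ A'.2) := trunc_form hk.left hA.left
  replace hC := ty_sound hr hT.ctx_cons hC
  have hk₁ : Derivable (typed (eraseCtx i γ (trunc k A :: Γ)) (k.erase i γ).wk .nat) :=
    hk.left.weaken hT
  have eh : (isTrunc C'.2 (k.wk 1) C).erase i γ =
      HoTT.isTrunc (i + C'.2) (k.erase i γ).wk (C.erase i γ) := by rw [erase, erase_wk_one hγ]
  replace hh := chk_sound hr hT.ctx_cons hh ⟨C'.2, by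
    rw [Typed, eh]; exact isTrunc_typed hk₁ hC.left⟩
  rw [Equal, eh] at hh
  replace hg := chk_sound hr hA.left.ctx_cons hg ⟨C'.2, by
    rw [Typed, erase_instTr hγ]
    exact hC.left.subst hA.left.ctx_cons (isSubst_tr hk.left hA.left)⟩
  rw [Equal, erase_instTr hγ] at hg
  replace ht := chk_sound hr hΓ ht ⟨_, hT⟩
  have h₁ : Equal i γ Γ (truncInd k A C h₀ g t) (truncInd k' A'.1 C'.1 h₀' g' t') (C.inst t) := by
    rw [Equal, erase_inst hγ]
    exact trunc_elim_eq hk.left hA.left hk hA hC hh hg ht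
  split at h
  · rename_i k₁ _ x hs
    simp only [guard_eq_some, Option.bind_eq_some_iff] at h
    obtain ⟨ek, _, hx, h⟩ := h
    replace hx := (chk_sound hr hΓ hx ⟨_, hA.left⟩).left
    obtain ⟨h, e'⟩ := red_sound hr hΓ h h₁.isType
    rw [e']
    refine eq_trans ?_ h
    have e₂ : Derivable (equal (eraseCtx i γ Γ) (.tr (k.erase i γ) (x.erase i γ))
        (t'.erase i γ) (.trunc (k.erase i γ) (A.erase i γ))) := by
      rw [erase_of_strip hs, erase, ← erase_eq_of_eqb ek]
      exact trunc_intro_eq hA.left hk (eq_refl hx)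
    have e₃ := eq_trans ht (eq_symm e₂)
    rw [erase_inst hγ, erase_inst hγ]
    refine eq_trans (trunc_elim_eq hk.left hA.left (eq_refl hk.left) (eq_refl hA.left)
      (eq_refl hC.left) (eq_refl hh.presupposition.1) (eq_refl hg.presupposition.1) e₃) ?_
    exact eq_conv (trunc_comp hk.left hA.left hC.left hh.presupposition.1 hg.presupposition.1 hx)
      (eq_symm (Derivable.inst_congr hC.left ht.left e₃))
  · cases h
    exact h₁

theorem evIsTrunc_sound {n : ℕ} {k A : Exp} {q : Exp × Exp}
    (h : evIsTrunc r m Γ n k A = some q) : Equal i γ Γ (isTrunc n k A) q.1 q.2 := by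
  simp only [evIsTrunc, Option.bind_eq_some_iff] at h
  obtain ⟨k', hk, A', hA, h⟩ := h
  have hU : IsType i γ Γ (univ n) := ⟨n + 1, univ_form hΓ⟩
  replace hk := chk_sound hr hΓ hk ⟨0, nat_form hΓ⟩
  replace hA := chk_sound hr hΓ hA hU
  have h₁ : Equal i γ Γ (isTrunc n k A) (isTrunc n k' A') (univ n) := isTrunc_congr hk hA
  split at h
  · rename_i hs
    obtain ⟨h, e⟩ := red_sound hr hΓ h hU
    rw [e]
    refine eq_trans h₁ (eq_trans ?_ h)
    change Derivable (equal _ (HoTT.isTrunc (i + n) (k'.erase i γ) (A'.erase i γ)) _ _)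
    rw [erase_of_strip hs, erase_isContr hγ]
    exact isTrunc_zero hA.right
  · rename_i k₁ hs
    simp only [Option.bind_eq_some_iff] at h
    obtain ⟨_, hk₁, h⟩ := h
    replace hk₁ := (chk_sound hr hΓ hk₁ ⟨0, nat_form hΓ⟩).left
    obtain ⟨h, e⟩ := red_sound hr hΓ h hU
    rw [e]
    refine eq_trans h₁ (eq_trans ?_ h)
    have := isTrunc_succ hk₁ hA.right
    change Derivable (equal _ (HoTT.isTrunc (i + n) (k'.erase i γ) (A'.erase i γ)) _ _)
    rw [isTruncSucc, erase_of_strip hs]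
    simp only [erase, erase_wk_one hγ, erase_wk_two hγ]
    exact this
  · cases h
    exact h₁

theorem evEta_sound {A B f : Exp} {q : Exp × Exp} (h : evEta r m Γ A B f = some q) :
    Equal i γ Γ (eta A B f) q.1 q.2 := by
  simp only [evEta, Option.bind_eq_some_iff, Option.some.injEq] at h
  obtain ⟨A', hA, B', hB, f', hf, rfl⟩ := h
  replace hA := ty_sound hr hΓ hA
  replace hB := ty_sound hr hA.left.ctx_cons hB
  have hA := hA.le (Nat.le_max_left _ B'.2)
  have hB := hB.le (Nat.le_max_right A'.2 _)
  have hP : Typed i γ Γ (pi A B) (univ _) := pi_form hA.left hB.left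
  replace hf := chk_sound hr hΓ hf ⟨_, hP⟩
  -- Reflexivity at `f` receives the eta-expansion as its left endpoint by conversion along the
  -- uniqueness rule.
  refine eq_conv (id_intro_eq hP hf) (id_form_eq (eq_refl hP) ?_ (eq_refl hf.left))
  simp only [expand, erase, erase_wk_one hγ]
  exact pi_uniq hf.left

omit hγ in
theorem evCum_sound {n : ℕ} {A : Exp} {q : Exp × Exp} (h : evCum r m Γ n A = some q) :
    Equal i γ Γ (cum n A) q.1 q.2 := by
  simp only [evCum, Option.bind_eq_some_iff, guard_eq_some, Option.some.injEq] at h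
  obtain ⟨A', hA, hn, rfl⟩ := h
  exact (ty_sound hr hΓ hA).le (Nat.le_of_ble_eq_true hn)

omit hr hγ hΓ

/-- The types of the constants are closed, and derivable for the meaning `γ`. -/
def ConstsTyped (i : ℕ) (γ : ℕ → Tm) (G : List Exp) : Prop :=
  ∀ c A, constType G c = some A → ∀ Γ : Ctx, Derivable (ctx Γ) →
    Derivable (typed Γ (γ c) (A.erase i γ))

theorem step_sound {G : List Exp} (hγ : ClosedConsts γ) (hG : ConstsTyped i γ G)
    (hr : Sound i γ r) : Sound i γ (step G r) := by
  intro m Γ t t' T h hΓ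
  cases t with
  | var k =>
    simp only [step, Option.bind_eq_some_iff, Option.some.injEq, Prod.mk.injEq] at h
    obtain ⟨A, hA, rfl, rfl⟩ := h
    rw [Equal, erase_wk hγ, ← rename_add_eq]
    exact eq_refl (Derivable.variable hΓ (by rw [List.getElem?_map, hA]; rfl))
  | const c =>
    simp only [step, Option.bind_eq_some_iff, Option.some.injEq, Prod.mk.injEq] at h
    obtain ⟨A, hA, rfl, rfl⟩ := h
    exact eq_refl (hG c A hA _ hΓ)
  | univ n => cases h; exact eq_refl (univ_form hΓ)
  | pi A B => exact evPi_sound hr hΓ h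
  | lam A b => exact evLam_sound hr hΓ h
  | app f a => exact evApp_sound hr hγ hΓ h
  | sigma A B => exact evSigma_sound hr hΓ h
  | pair A B a b => exact evPair_sound hr hγ hΓ h
  | sigmaInd A B C g p => exact evSigmaInd_sound hr hγ hΓ h
  | sum A B => exact evSum_sound hr hΓ h
  | sumRec A B D c d e => exact evSumRec_sound hr hγ hΓ h
  | empty => cases h; exact eq_refl (empty_form hΓ)
  | emptyInd C e => exact evEmptyInd_sound hr hγ hΓ h
  | nat => cases h; exact eq_refl (nat_form hΓ)
  | zero => cases h; exact eq_refl (nat_zero hΓ)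
  | succ n => exact evSucc_sound hr hΓ h
  | natInd C z s n => exact evNatInd_sound hr hγ hΓ h
  | id A a b => exact evId_sound hr hΓ h
  | refl A a => exact evRefl_sound hr hΓ h
  | idInd A C c a b p => exact evIdInd_sound hr hγ hΓ h
  | trunc k A => exact evTrunc_sound hr hΓ h
  | tr k A a => exact evTr_sound hr hΓ h
  | truncIsTrunc n k A => exact evTruncIsTrunc_sound hr hΓ h
  | truncInd k A C h₀ g t => exact evTruncInd_sound hr hγ hΓ h
  | isTrunc n k A => exact evIsTrunc_sound hr hγ hΓ h
  | eta A B f => exact evEta_sound hr hγ hΓ h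
  | cum n A => exact evCum_sound hr hΓ h

theorem ev_sound {G : List Exp} (hγ : ClosedConsts γ) (hG : ConstsTyped i γ G) (fuel : ℕ) :
    Sound i γ (ev G fuel) := by
  induction fuel with
  | zero => intro m Γ t t' T h; cases h
  | succ n ih => exact step_sound hγ hG ih

/-! ### Libraries of derived types -/

/-- For every base level, closed terms of all types in the list are derivable, where
constants in a type stand for terms of the types further down the list. -/
def Realizable (G : List Exp) : Prop :=
  ∀ i, ∃ γ, ClosedConsts γ ∧ ConstsTyped i γ G

/-- Check the closed expression `t` against the closed type `A`. -/
def accepts (G : List Exp) (fuel : ℕ) (A t : Exp) : Bool :=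
  A.closedAt 0 && A.constFree && t.closedAt 0 &&
    ((ty (ev G fuel) false [] A).isSome && (chk (ev G fuel) false [] t A).isSome)

theorem realizable_nil : Realizable [] :=
  fun _ => ⟨fun _ => .zero, fun _ _ => rfl, fun c A h => by simp [constType] at h⟩

/-- Any substitution out of the empty context is vacuously well typed, and closed terms are
unchanged by it. -/
theorem typed_of_nil {Γ : Ctx} (hΓ : Derivable (ctx Γ)) {t A : Tm}
    (h : Derivable (typed [] t A)) (ht : ∀ σ, t.subst σ = t) (hA : ∀ σ, A.subst σ = A) :
    Derivable (typed Γ t A) := by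
  have := h.subst (σ := Tm.var) hΓ (fun k A hk => by simp at hk)
  rwa [ht, hA] at this

theorem accepts_sound {G : List Exp} {fuel : ℕ} {A t : Exp} (h : accepts G fuel A t = true)
    (hγ : ClosedConsts γ) (hG : ConstsTyped i γ G) :
    (∀ σ, (t.erase i γ).subst σ = t.erase i γ) ∧
      ∀ Γ : Ctx, Derivable (ctx Γ) → Derivable (typed Γ (t.erase i γ) (A.erase i γ)) := by
  simp only [accepts, Bool.and_eq_true, Option.isSome_iff_exists] at h
  obtain ⟨⟨⟨hA, -⟩, ht⟩, ⟨A', h₁⟩, t', h₂⟩ := h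
  have hr := ev_sound hγ hG fuel
  replace h₁ := (ty_sound (Γ := []) hr ctx_nil h₁).left
  replace h₂ := (chk_sound (Γ := []) hr ctx_nil h₂ ⟨_, h₁⟩).left
  replace ht := erase_closedAt (i := i) hγ ht
  replace hA := erase_closedAt (i := i) hγ hA
  exact ⟨ht, fun Γ hΓ => typed_of_nil hΓ h₂ ht hA⟩

/-- Constants are numbered from the oldest entry, so earlier numbers keep their meaning when the
library grows. -/
theorem constType_cons_lt {G : List Exp} {A : Exp} {c : ℕ} (hc : c < G.length) :
    constType (A :: G) c = constType G c := by
  simp only [constType, List.reverse_cons]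
  rw [List.getElem?_append_left (by simpa using hc)]

theorem constType_length {G : List Exp} {A : Exp} : constType (A :: G) G.length = some A := by
  simp only [constType, List.reverse_cons]
  rw [List.getElem?_append_right (by simp)]
  simp

theorem constType_lt {G : List Exp} {A : Exp} {c : ℕ} (h : constType G c = some A) :
    c < G.length := by
  simp only [constType, List.getElem?_eq_some_iff] at h
  simpa using h.choose

/-- The new constant is interpreted by the erasure of the accepted expression. Since library types
mention no constants, changing the interpretation at one number leaves all of them as they were. -/
theorem Realizable.cons {G : List Exp} {A t : Exp} (hG : Realizable G)
    (hc : G.all constFree = true) (fuel : ℕ) (h : accepts G fuel A t = true) :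
    Realizable (A :: G) := by
  intro i
  obtain ⟨γ, hγ, hG⟩ := hG i
  obtain ⟨ht, hA⟩ := accepts_sound h hγ hG
  refine ⟨Function.update γ G.length (t.erase i γ), ?_, ?_⟩
  · intro c σ
    by_cases e : c = G.length
    · subst e; rw [Function.update_self]; exact ht σ
    · rw [Function.update_of_ne e]; exact hγ c σ
  · intro c B hB Γ hΓ
    have hlt := constType_lt hB
    rw [List.length_cons] at hlt
    by_cases e : c = G.length
    · subst e
      rw [constType_length] at hB
      cases hB
      simp only [accepts, Bool.and_eq_true] at h
      rw [Function.update_self, erase_constFree h.1.1.2 γ]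
      exact hA Γ hΓ
    · rw [constType_cons_lt (by omega)] at hB
      have : B ∈ G := by
        have := List.mem_of_getElem? hB
        simpa using this
      rw [Function.update_of_ne e, erase_constFree (List.all_eq_true.1 hc B this) γ]
      exact hG c B hB Γ hΓ

end Exp
end HoTT

end

/-! ### An unverified elaborator and its input language. -/

noncomputable section

namespace HoTT

namespace Exp

/-! ### Elaboration

Nothing is proved about the elaborator: its output is verified by `accepts`. -/

/-- Apply `f` to the immediate subexpressions, and `g` to the immediate annotations, together with
the number of variables that are bound there. -/
def mapSub (f g : ℕ → Exp → Exp) : Exp → Exp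
  | var k => var k
  | const c => const c
  | univ n => univ n
  | pi A B => pi (f 0 A) (f 1 B)
  | lam A b => lam (f 0 A) (f 1 b)
  | app t a => app (f 0 t) (f 0 a)
  | sigma A B => sigma (f 0 A) (f 1 B)
  | pair A B a b => pair (g 0 A) (g 1 B) (f 0 a) (f 0 b)
  | sigmaInd A B C t p => sigmaInd (f 0 A) (f 1 B) (f 1 C) (f 2 t) (f 0 p)
  | sum A B => sum (f 0 A) (f 0 B)
  | sumRec A B D c d e => sumRec (f 0 A) (f 0 B) (f 0 D) (f 1 c) (f 1 d) (f 0 e)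
  | empty => empty
  | emptyInd C e => emptyInd (f 1 C) (f 0 e)
  | nat => nat
  | zero => zero
  | succ n => succ (f 0 n)
  | natInd C z s n => natInd (f 1 C) (f 0 z) (f 2 s) (f 0 n)
  | id A a b => id (f 0 A) (f 0 a) (f 0 b)
  | refl A a => refl (g 0 A) (f 0 a)
  | idInd A C c a b p => idInd (f 0 A) (f 3 C) (f 1 c) (f 0 a) (f 0 b) (f 0 p)
  | trunc k A => trunc (f 0 k) (f 0 A)
  | tr k A a => tr (f 0 k) (g 0 A) (f 0 a)
  | truncIsTrunc n k A => truncIsTrunc n (f 0 k) (f 0 A)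
  | truncInd k A C h t x => truncInd (f 0 k) (f 0 A) (f 1 C) (f 1 h) (f 1 t) (f 0 x)
  | isTrunc n k A => isTrunc n (f 0 k) (f 0 A)
  | eta A B t => eta (g 0 A) (g 1 B) (f 0 t)
  | cum n A => cum n (f 0 A)

/-- The immediate subexpressions without annotations, with the numbers of variables bound. -/
def subs : Exp → List (ℕ × Exp)
  | var _ | const _ | univ _ | empty | nat | zero => []
  | pi A B | lam A B | sigma A B => [(0, A), (1, B)]
  | app A B | sum A B | trunc A B | tr A _ B | pair _ _ A B | truncIsTrunc _ A B
  | isTrunc _ A B => [(0, A), (0, B)]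
  | sigmaInd A B C t p => [(0, A), (1, B), (1, C), (2, t), (0, p)]
  | sumRec A B D c d e => [(0, A), (0, B), (0, D), (1, c), (1, d), (0, e)]
  | emptyInd C e => [(1, C), (0, e)]
  | succ n | refl _ n | eta _ _ n | cum _ n => [(0, n)]
  | natInd C z s n => [(1, C), (0, z), (2, s), (0, n)]
  | id A a b => [(0, A), (0, a), (0, b)]
  | idInd A C c a b p => [(0, A), (3, C), (1, c), (0, a), (0, b), (0, p)]
  | truncInd k A C h t x => [(0, k), (0, A), (1, C), (1, h), (1, t), (0, x)]

/-- A number for the head constructor. -/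
def headTag : Exp → ℕ
  | var _ => 0
  | const _ => 1
  | univ _ => 2
  | pi _ _ => 3
  | lam _ _ => 4
  | app _ _ => 5
  | sigma _ _ => 6
  | pair _ _ _ _ => 7
  | sigmaInd _ _ _ _ _ => 8
  | sum _ _ => 9
  | sumRec _ _ _ _ _ _ => 10
  | empty => 11
  | emptyInd _ _ => 12
  | nat => 13
  | zero => 14
  | succ _ => 15
  | natInd _ _ _ _ => 16
  | id _ _ _ => 17
  | refl _ _ => 18
  | idInd _ _ _ _ _ _ => 19
  | trunc _ _ => 20
  | tr _ _ _ => 21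
  | truncIsTrunc _ _ _ => 22
  | truncInd _ _ _ _ _ _ => 23
  | isTrunc _ _ _ => 24
  | eta _ _ _ => 25
  | cum _ _ => 26

/-- The reductions of the checker without their side conditions; an unjustified step can only lead
to an expression that is rejected later. -/
def headStep (nf : Exp → Exp) : Exp → Exp
  | app f a => match f with
    | lam _ b => nf (b.inst a)
    | _ => app f a
  | sigmaInd A B C g p => match p with
    | pair _ _ a b => nf (g.subst [b, a] 0 0)
    | _ => sigmaInd A B C g p
  | idInd A C c a b p => match p with
    | refl _ x => nf (c.inst x)
    | _ => idInd A C c a b p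
  | truncInd k A C h g t => match t with
    | tr _ _ x => nf (g.inst x)
    | _ => truncInd k A C h g t
  | isTrunc n k A => match k with
    | zero => isContr A
    | succ k => nf (isTruncSucc n k A)
    | _ => isTrunc n k A
  | cum _ A => A
  | t => t

/-- Normalization without type checks. -/
def nf (fuel : ℕ) : Exp → Exp :=
  Nat.rec (fun t => t) (fun _ nf t => headStep nf (mapSub (fun _ => nf) (fun _ t => t) t)) fuel

/-- The constants from this number on are metavariables. -/
def metaBase : ℕ := 1000000

abbrev Assignment : Type := List (Option Exp)

/-- Solutions of metavariables live outside the binders that have been passed, and are weakened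
accordingly when they are inserted. -/
def instMeta (fuel : ℕ) : Assignment → ℕ → Exp → Exp :=
  Nat.rec (fun _ _ t => t) (fun _ go σ d t =>
    match t with
    | const c => match Nat.ble metaBase c with
      | true => match (σ[c - metaBase]?).bind fun x => x with
        | some u => u.wk d
        | none => const c
      | false => const c
    | _ => mapSub (fun b => go σ (d + b)) (fun b => go σ (d + b)) t) fuel

def hasMeta (fuel : ℕ) : Exp → Bool :=
  Nat.rec (fun _ => false) (fun _ go t =>
    match t with
    | const c => Nat.ble metaBase c
    | _ => (subs t).any fun x => go x.2) fuel

/-- First-order matching of a pattern with metavariables; failures are ignored. -/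
def unify (fuel : ℕ) : Assignment → ℕ → Exp → Exp → Assignment :=
  Nat.rec (fun σ _ _ _ => σ) (fun _ go σ d t u =>
    let zip (σ : Assignment) (t u : Exp) : Assignment :=
      ((subs t).zip (subs u)).foldl (fun σ x => go σ (d + x.1.1) x.1.2 x.2.2) σ
    let dflt : Assignment :=
      match Nat.beq t.headTag u.headTag with
      | true => zip σ t u
      | false =>
        let t' := nf fuel t
        let u' := nf fuel u
        match Nat.beq t'.headTag u'.headTag with
        | true => zip σ t' u'
        | false => σ
    match t.strip with
    | const c => match Nat.ble metaBase c with
      | true => match (σ[c - metaBase]?).bind fun x => x with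
        | some _ => σ
        -- To leave the scope of `d` binders, the bound variables are replaced by the dummy `zero`.
        -- If the solution really depends on them, the result is wrong and is left to the checker to
        -- reject.
        | none => σ.set (c - metaBase) (some (u.subst (List.replicate d zero) 0 0))
      | false => dflt
    | _ => dflt) fuel

/-- Replace occurrences of the `j`-th expression in the list by the variable `j`. -/
def abstr (fuel : ℕ) (pats : List Exp) : ℕ → Exp → Exp :=
  Nat.rec (fun _ t => t) (fun _ go d t =>
    let rec find : List Exp → ℕ → Option Exp
      | [], _ => none
      | p :: ps, j => match t.eqb (p.wk d) with
        | true => some (var (j + d))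
        | false => find ps (j + 1)
    match find pats 0 with
    | some v => v
    | none => match t with
      | var k => match Nat.ble d k with
        | true => var (k + pats.length)
        | false => var k
      | _ => mapSub (fun b => go (d + b)) (fun b => go (d + b)) t) fuel

end Exp

/-- Terms of the input language; variables are numbered from the outside. -/
inductive Raw : Type
  | var (l : ℕ)
  | hole
  | const (c : ℕ)
  | univ (n : ℕ)
  | pi (A B : Raw)
  | lam (b : Raw)
  | lamT (A b : Raw)
  | app (f a : Raw)
  | the (A a : Raw)
  | sigma (A B : Raw)
  | pair (a b : Raw)
  | fst (p : Raw)
  | snd (p : Raw)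
  | split (g p : Raw)
  | sum (A B : Raw)
  | sumRec (D c d e : Raw)
  | empty
  | absurd (e : Raw)
  | nat
  | zero
  | succ (n : Raw)
  | natInd (C z s n : Raw)
  | id (a b : Raw)
  | idT (A a b : Raw)
  | refl
  | reflT (a : Raw)
  | ind (C c p : Raw)
  | sym (p : Raw)
  | trans (p q : Raw)
  | ap (f p : Raw)
  | tp (P p x : Raw)
  | trunc (k A : Raw)
  | tr (k a : Raw)
  | truncIsTrunc (n : ℕ) (k A : Raw)
  | truncInd (C h g t : Raw)
  | isTrunc (n : ℕ) (k A : Raw)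
  | eta (f : Raw)

namespace Raw

open Exp (inst wk subst nf instMeta hasMeta unify abstr metaBase Assignment)

/-- The result of elaboration: an expression with its type, or an error. -/
inductive Res : Type
  | ok (e T : Exp)
  | err

def Res.bind (x : Res) (f : Exp → Exp → Res) : Res :=
  match x with
  | ok e T => f e T
  | err => err

/-- Deep enough for all expressions that occur. -/
def depth : ℕ := 1000

def whnf (T : Exp) : Exp :=
  match T with
  | .pi _ _ => T
  | .sigma _ _ => T
  | .id _ _ _ => T
  | .trunc _ _ => T
  | .univ _ => T
  | .sum _ _ => T
  | _ => nf depth T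

def asPi (T : Exp) (k : Exp → Exp → Res) : Res :=
  match whnf T with
  | .pi A B => k A B
  | _ => .err

def asSigma (T : Exp) (k : Exp → Exp → Res) : Res :=
  match whnf T with
  | .sigma A B => k A B
  | _ => .err

def asId (T : Exp) (k : Exp → Exp → Exp → Res) : Res :=
  match whnf T with
  | .id A a b => k A a b
  | _ => .err

def asSum (T : Exp) (k : Exp → Exp → Res) : Res :=
  match whnf T with
  | .sum A B => k A B
  | _ => .err

def asTrunc (T : Exp) (k : Exp → Exp → Res) : Res :=
  match whnf T with
  | .trunc n A => k n A
  | _ => .err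

/-- Return an expression of an inferred type when the type `exp` is expected. -/
def ret (exp : Option Exp) (e T : Exp) : Res :=
  match exp with
  | none => .ok e T
  | some X =>
    match X.strip with
    | .univ n => match T.strip with
      | .univ m => match Nat.beq n m with
        | true => .ok e X
        | false => .ok (.cum n e) X
      | _ => .ok e X
    | _ => .ok e X

/-- A function that elaborates with an optional expected type. -/
abbrev Elab : Type := List Exp → Raw → Option Exp → Res

def expected (exp : Option Exp) (k : Exp → Res) : Res :=
  match exp with
  | some T => k T
  | none => .err

/-- The state of the elaboration of an application: the function so far and its type, the
assignment of metavariables, and the postponed arguments. -/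
structure Spine : Type where
  e : Exp
  T : Exp
  σ : Assignment
  post : List (ℕ × Raw × Exp)

def finishSpine (go : Elab) (Γ : List Exp) (e T : Exp) : List (ℕ × Raw × Exp) → Assignment → Res
  | [], σ =>
    let e' := instMeta depth σ 0 e
    match hasMeta depth e' with
    | true => .err
    | false => .ok e' (instMeta depth σ 0 T)
  | (j, a, A) :: post, σ =>
    (go Γ a (some (instMeta depth σ 0 A))).bind fun a' _ =>
      finishSpine go Γ e T post (σ.set j (some a'.strip))

/-- An argument whose expected type still contains metavariables is elaborated without it, and the
inferred type helps to solve them. If that fails the argument becomes a metavariable itself and is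
postponed until the result type has been matched. -/
def spine (go : Elab) (Γ : List Exp) (exp : Option Exp) : List Raw → Spine → Res
  | [], s =>
    match s.σ with
    | [] => .ok s.e s.T
    | _ =>
      let σ := match exp with
        | some X => unify depth s.σ 0 s.T X
        | none => s.σ
      finishSpine go Γ s.e s.T s.post.reverse σ
  | a :: as, s =>
    let T := match s.T with
      | .pi A B => .pi A B
      | T => instMeta depth s.σ 0 T
    asPi T fun A B =>
    let A := match s.σ with
      | [] => A
      | σ => instMeta depth σ 0 A
    let m := s.σ.length
    let v := Exp.const (metaBase + m)
    let pend (post : List (ℕ × Raw × Exp)) : Spine :=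
      ⟨.app s.e v, B.inst v, s.σ ++ [none], post⟩
    match a with
    | hole => spine go Γ exp as (pend s.post)
    | _ =>
      match hasMeta depth A with
      | false => (go Γ a (some A)).bind fun a' _ =>
        let a' := a'.strip
        spine go Γ exp as ⟨.app s.e a', B.inst a', s.σ, s.post⟩
      | true =>
        match go Γ a none with
        | .ok a' T => spine go Γ exp as ⟨.app s.e a', B.inst a', unify depth s.σ 0 A T, s.post⟩
        | .err => spine go Γ exp as (pend ((m, a, A) :: s.post))

def unfoldApp : Raw → List Raw → Raw × List Raw
  | app f a, as => unfoldApp f (a :: as)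
  | f, as => (f, as)

def fstE (A B p : Exp) : Exp := .sigmaInd A B (A.wk 1) (.var 1) p

/-- The default level is harmless: a wrong level can at worst make the checker refuse the term. -/
def levelOf (T : Exp) : ℕ :=
  match whnf T with
  | .univ n => n
  | _ => 0

def levelIn (G Γ : List Exp) (A : Exp) : ℕ :=
  match Exp.ty (Exp.ev G depth) false Γ A with
  | some q => q.2
  | none => 0

def elabStep (G : List Exp) (go : Elab) (Γ : List Exp) (r : Raw) (exp : Option Exp) :
    Res :=
  let done (e T : Exp) : Res := ret exp e T
  let inf (r : Raw) (k : Exp → Exp → Res) : Res := (go Γ r none).bind k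
  let chk (r : Raw) (T : Exp) (k : Exp → Res) : Res := (go Γ r (some T)).bind fun e _ => k e
  match r with
  | var l =>
    let j := Γ.length - 1 - l
    match Γ[j]? with
    | some A => done (.var j) (A.wk (j + 1))
    | none => .err
  | hole => .err
  | const c => match Exp.constType G c with
    | some A => done (.const c) A
    | none => .err
  | univ n => done (.univ n) (.univ (n + 1))
  | pi A B => inf A fun A S => (go (A :: Γ) B none).bind fun B S' =>
      done (.pi A B) (.univ (max (levelOf S) (levelOf S')))
  | sigma A B => inf A fun A S => (go (A :: Γ) B none).bind fun B S' =>
      done (.sigma A B) (.univ (max (levelOf S) (levelOf S')))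
  | lam b => expected exp fun X => asPi X fun A B =>
      (go (A :: Γ) b (some B)).bind fun b _ => .ok (.lam A b) X
  | lamT A b => inf A fun A _ => (go (A :: Γ) b none).bind fun b B => done (.lam A b) (.pi A B)
  | app f a =>
    let q := unfoldApp f [a]
    inf q.1 fun f T => (spine go Γ exp q.2 ⟨f, T, [], []⟩).bind done
  | the A a => inf A fun A _ => chk a A fun a => done a A
  | pair a b => expected exp fun X => asSigma X fun A B => chk a A fun a => chk b (B.inst a) fun b =>
      .ok (.pair A B a b) X
  | fst p => inf p fun p T => asSigma T fun A B => done (fstE A B p) A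
  | snd p => inf p fun p T => asSigma T fun A B =>
      done (.sigmaInd A B (B.subst [fstE (A.wk 1) (B.lift 1 1) (.var 0)] 1 0) (.var 0) p)
        (B.inst (fstE A B p))
  | split g p => expected exp fun X => inf p fun p T => asSigma T fun A B =>
      -- The motive is guessed by abstracting the scrutinee from the expected type.
      let C := abstr depth [p] 0 X
      (go (B :: A :: Γ) g
        (some (C.subst [.pair (A.wk 2) (B.lift 2 1) (.var 1) (.var 0)] 2 0))).bind fun g _ =>
        .ok (.sigmaInd A B C g p) X
  | sum A B => inf A fun A S => inf B fun B S' =>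
      done (.sum A B) (.univ (max (levelOf S) (levelOf S')))
  | sumRec D c d e => inf D fun D _ => inf e fun e T => asSum T fun A B =>
      (go (A :: Γ) c (some (D.wk 1))).bind fun c _ => (go (B :: Γ) d (some (D.wk 1))).bind fun d _ =>
        done (.sumRec A B D c d e) D
  | empty => done .empty (.univ 0)
  | absurd e => expected exp fun X => chk e .empty fun e => .ok (.emptyInd (X.wk 1) e) X
  | nat => done .nat (.univ 0)
  | zero => done .zero .nat
  | succ n => chk n .nat fun n => done (.succ n) .nat
  | natInd C z s n => (go (.nat :: Γ) C none).bind fun C _ => chk z (C.inst .zero) fun z =>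
      (go (C :: .nat :: Γ) s (some (C.subst [.succ (.var 1)] 2 0))).bind fun s _ =>
        chk n .nat fun n => done (.natInd C z s n) (C.inst n)
  | id a b => inf a fun a A => chk b A fun b => done (.id A a b) (.univ (levelIn G Γ A))
  | idT A a b => inf A fun A S => chk a A fun a => chk b A fun b => done (.id A a b) S
  | refl => expected exp fun X => asId X fun A _ b => done (.refl A b) (.id A b b)
  | reflT a => inf a fun a A => done (.refl A a) (.id A a a)
  | ind C c p => inf p fun p T => asId T fun A a b =>
      let withMotive (C : Exp) : Res :=
        (go (A :: Γ) c (some (Exp.instRefl A C))).bind fun c _ =>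
          done (.idInd A C c a b p) (C.subst [p, b, a] 0 0)
      match C with
      | hole => expected exp fun X => withMotive (abstr depth [p, b, a] 0 X)
      | _ => (go (Exp.idCtx A Γ) C none).bind fun C _ => withMotive C
  | sym p => inf p fun p T => asId T fun A a b =>
      done (.idInd A (.id (A.wk 3) (.var 1) (.var 2)) (.refl (A.wk 1) (.var 0)) a b p) (.id A b a)
  | trans p q => inf p fun p T => inf q fun q T' => asId T fun A a b => asId T' fun _ _ c =>
      done (.app (.idInd A (.pi (.id (A.wk 3) (.var 1) (c.wk 3)) (.id (A.wk 4) (.var 3) (c.wk 4)))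
        (.lam (.id (A.wk 1) (.var 0) (c.wk 1)) (.var 0)) a b p) q) (.id A a c)
  | ap f p => inf p fun p T => asId T fun A a b => (go (A :: Γ) f none).bind fun f B =>
      -- The codomain is assumed not to depend on the variable, so any dummy may be inserted to
      -- remove it from scope.
      let B' := B.inst .zero
      done (.idInd A (.id (B'.wk 3) (f.subst [.var 2] 3 0) (f.subst [.var 1] 3 0)) (.refl B f) a b p)
        (.id B' (f.inst a) (f.inst b))
  | tp P p x => inf p fun p T => asId T fun A a b => (go (A :: Γ) P none).bind fun P _ =>
      chk x (P.inst a) fun x =>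
        done (.app (.idInd A (.pi (P.subst [.var 2] 3 0) (P.subst [.var 2] 4 0)) (.lam P (.var 0))
          a b p) x) (P.inst b)
  | trunc k A => chk k .nat fun k => inf A fun A S => done (.trunc k A) S
  | tr k a => chk k .nat fun k =>
      match exp with
      | some X => asTrunc X fun _ A => chk a A fun a => done (.tr k A a) (.trunc k A)
      | none => inf a fun a A => done (.tr k A a) (.trunc k A)
  | truncIsTrunc n k A => chk k .nat fun k => chk A (.univ n) fun A =>
      done (.truncIsTrunc n k A) (.isTrunc n k (.trunc k A))
  | truncInd C h g t => inf t fun t T => asTrunc T fun k A =>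
      (go (.trunc k A :: Γ) C none).bind fun C _ =>
        (go (.trunc k A :: Γ) h
          (some (.isTrunc (levelIn G (.trunc k A :: Γ) C) (k.wk 1) C))).bind fun h _ =>
          (go (A :: Γ) g (some (Exp.instTr k A C))).bind fun g _ =>
            done (.truncInd k A C h g t) (C.inst t)
  | isTrunc n k A => chk k .nat fun k => chk A (.univ n) fun A => done (.isTrunc n k A) (.univ n)
  | eta f => inf f fun f T => asPi T fun A B =>
      done (.eta A B f) (.id (.pi A B) (Exp.expand A f) f)

def elaborate (G : List Exp) (fuel : ℕ) : Elab :=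
  Nat.rec (fun _ _ _ => .err) (fun _ go => elabStep G go) fuel

end Raw

/-! ### The input language in higher-order abstract syntax -/

/-- A term of the input language, depending on the number of variables in scope. -/
structure Term : Type where
  raw : ℕ → Raw

namespace Term

instance : CoeFun Term fun _ => Term → Term := ⟨fun f a => ⟨fun d => .app (f.raw d) (a.raw d)⟩⟩

/-- The body of a binder. -/
def bind (f : Term → Term) (d : ℕ) : Raw := (f ⟨fun _ => .var d⟩).raw (d + 1)

def bind₂ (f : Term → Term → Term) (d : ℕ) : Raw := (f ⟨fun _ => .var d⟩ ⟨fun _ => .var (d + 1)⟩).raw (d + 2)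

def bind₃ (f : Term → Term → Term → Term) (d : ℕ) : Raw :=
  (f ⟨fun _ => .var d⟩ ⟨fun _ => .var (d + 1)⟩ ⟨fun _ => .var (d + 2)⟩).raw (d + 3)

def hole : Term := ⟨fun _ => .hole⟩
def con (c : ℕ) : Term := ⟨fun _ => .const c⟩
def univ (n : ℕ) : Term := ⟨fun _ => .univ n⟩
def pi (A : Term) (B : Term → Term) : Term := ⟨fun d => .pi (A.raw d) (bind B d)⟩
def sigma (A : Term) (B : Term → Term) : Term := ⟨fun d => .sigma (A.raw d) (bind B d)⟩
def lam (b : Term → Term) : Term := ⟨fun d => .lam (bind b d)⟩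
def lamT (A : Term) (b : Term → Term) : Term := ⟨fun d => .lamT (A.raw d) (bind b d)⟩
def the (A a : Term) : Term := ⟨fun d => .the (A.raw d) (a.raw d)⟩
def pair (a b : Term) : Term := ⟨fun d => .pair (a.raw d) (b.raw d)⟩
def fst (p : Term) : Term := ⟨fun d => .fst (p.raw d)⟩
def snd (p : Term) : Term := ⟨fun d => .snd (p.raw d)⟩
/-- Pattern matching on a pair, for the expected type. -/
def split (p : Term) (g : Term → Term → Term) : Term := ⟨fun d => .split (bind₂ g d) (p.raw d)⟩
def sum (A B : Term) : Term := ⟨fun d => .sum (A.raw d) (B.raw d)⟩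
def sumRec (D e : Term) (c c' : Term → Term) : Term :=
  ⟨fun d => .sumRec (D.raw d) (bind c d) (bind c' d) (e.raw d)⟩
def empty : Term := ⟨fun _ => .empty⟩
def absurd (e : Term) : Term := ⟨fun d => .absurd (e.raw d)⟩
def nat : Term := ⟨fun _ => .nat⟩
def zero : Term := ⟨fun _ => .zero⟩
def succ (n : Term) : Term := ⟨fun d => .succ (n.raw d)⟩
def natInd (C : Term → Term) (z : Term) (s : Term → Term → Term) (n : Term) : Term :=
  ⟨fun d => .natInd (bind C d) (z.raw d) (bind₂ s d) (n.raw d)⟩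
def id (a b : Term) : Term := ⟨fun d => .id (a.raw d) (b.raw d)⟩
def idT (A a b : Term) : Term := ⟨fun d => .idT (A.raw d) (a.raw d) (b.raw d)⟩
def refl : Term := ⟨fun _ => .refl⟩
def reflT (a : Term) : Term := ⟨fun d => .reflT (a.raw d)⟩
/-- Path induction with explicit motive. -/
def ind (C : Term → Term → Term → Term) (p : Term) (c : Term → Term) : Term :=
  ⟨fun d => .ind (bind₃ C d) (bind c d) (p.raw d)⟩
/-- Path induction for the expected type. -/
def path (p : Term) (c : Term → Term) : Term := ⟨fun d => .ind .hole (bind c d) (p.raw d)⟩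
def sym (p : Term) : Term := ⟨fun d => .sym (p.raw d)⟩
def trans (p q : Term) : Term := ⟨fun d => .trans (p.raw d) (q.raw d)⟩
def ap (f : Term → Term) (p : Term) : Term := ⟨fun d => .ap (bind f d) (p.raw d)⟩
/-- Transport in the family `P` along `p`. -/
def tp (P : Term → Term) (p x : Term) : Term := ⟨fun d => .tp (bind P d) (p.raw d) (x.raw d)⟩
def trunc (k A : Term) : Term := ⟨fun d => .trunc (k.raw d) (A.raw d)⟩
def tr (k a : Term) : Term := ⟨fun d => .tr (k.raw d) (a.raw d)⟩
def truncIsTrunc (n : ℕ) (k A : Term) : Term := ⟨fun d => .truncIsTrunc n (k.raw d) (A.raw d)⟩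
/-- Induction on a truncation, with explicit motive. -/
def truncInd (C : Term → Term) (t : Term) (h g : Term → Term) : Term :=
  ⟨fun d => .truncInd (bind C d) (bind h d) (bind g d) (t.raw d)⟩
def isTrunc (n : ℕ) (k A : Term) : Term := ⟨fun d => .isTrunc n (k.raw d) (A.raw d)⟩
def eta (f : Term) : Term := ⟨fun d => .eta (f.raw d)⟩

/-- `A → B`. -/
def arrow (A B : Term) : Term := pi A fun _ => B

/-- `A × B`. -/
def prod (A B : Term) : Term := sigma A fun _ => B

end Term

/-! ### Libraries of verified terms -/

/-- A type with a term of this type, both closed. -/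
structure Entry : Type where
  type : Term
  proof : Term

namespace Entry

/-- The elaborated type. -/
def typeExp (e : Entry) : Exp :=
  -- Types are elaborated over the empty library, so they cannot refer to constants.
  match Raw.elaborate [] Raw.depth [] (e.type.raw 0) none with
  | .ok A _ => A
  -- A failure yields an open expression, which `Exp.accepts` rejects.
  | .err => .var 0

abbrev types (L : List Entry) : List Exp := L.map typeExp

/-- Only the verdict of `Exp.accepts` carries logical weight; the elaborator merely proposes the
term. -/
def verify (L : List Entry) (e : Entry) : Bool :=
  match Raw.elaborate (types L) Raw.depth [] (e.proof.raw 0) (some e.typeExp) with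
  | .ok t _ => Exp.accepts (types L) Raw.depth e.typeExp t
  | .err => false

/-- All terms in the library are derivable; later entries, which come first in the list,
may refer to earlier ones. -/
def Verified (L : List Entry) : Prop :=
  Exp.Realizable (types L) ∧ (types L).all Exp.constFree = true

theorem verified_nil : Verified [] := ⟨Exp.realizable_nil, rfl⟩

theorem Verified.cons {L : List Entry} (hL : Verified L) {e : Entry} (h : verify L e = true) :
    Verified (e :: L) := by
  rw [verify] at h
  split at h
  · refine ⟨hL.1.cons hL.2 _ h, ?_⟩
    simp only [Exp.accepts, Bool.and_eq_true] at h
    rw [types, List.map_cons, List.all_cons, h.1.1.2, Bool.true_and]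
    exact hL.2
  · cases h

end Entry

end HoTT

end

/-! ### The statement, in the input language and as an explicit expression. -/

noncomputable section

namespace HoTT

namespace Term

/-! ### Notions of the theorem in the input language -/

def isContr (A : Term) : Term := sigma A fun x => pi A fun y => id x y
def isProp (A : Term) : Term := pi A fun x => pi A fun y => id x y

def isEquiv (A B e : Term) : Term :=
  prod (sigma (arrow B A) fun s => pi B fun y => id (e (s y)) y)
    (sigma (arrow B A) fun r => pi A fun x => id (r (e x)) x)

def equiv (A B : Term) : Term := sigma (arrow A B) fun e => isEquiv A B e

def idMap (A : Term) : Term := lamT A fun x => x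

def idEquiv (A : Term) : Term :=
  the (equiv A A) (pair (lam fun x => x) (pair (pair (lam fun x => x) (lam fun _ => refl))
    (pair (lam fun x => x) (lam fun _ => refl))))

/-- An equivalence from an inverse and two homotopies. -/
def equivOf (f g s r : Term) : Term := pair f (pair (pair g s) (pair g r))

def idToEquiv (A B : Term) : Term :=
  lamT (idT (univ 0) A B) fun p => ind (fun X Y _ => equiv X Y) p idEquiv

def univalence : Term :=
  pi (univ 0) fun A => pi (univ 0) fun B =>
    isEquiv (idT (univ 0) A B) (equiv A B) (idToEquiv A B)

def neg (A : Term) : Term := arrow A empty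

def excludedMiddle : Term := pi (univ 0) fun P => arrow (isProp P) (sum P (neg P))

def propTrunc (A : Term) : Term := trunc (succ zero) A

def isConnected (k A : Term) : Term := isContr (trunc k A)

def component (A : Term) : Term := sigma (univ 0) fun Z => propTrunc (idT (univ 0) Z A)

def isRigid (A : Term) : Term := isContr (component A)

def automorphismSending (A B : Term) : Term :=
  sigma (arrow (univ 0) (univ 0)) fun f =>
    prod (isEquiv (univ 0) (univ 0) f) (propTrunc (idT (univ 0) (f A) B))

/-- The statement of the theorem. -/
def mainType : Term :=
  arrow univalence <| arrow excludedMiddle <|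
  pi nat fun m => pi (univ 0) fun X => pi (univ 0) fun A => pi (univ 0) fun B =>
  arrow (isTrunc 0 (succ m) X) <|
  arrow (isConnected (succ m) A) <| arrow (isConnected (succ m) B) <|
  arrow (isRigid A) <| arrow (isRigid B) <|
  arrow (neg (equiv (prod X A) (prod X B))) <|
  prod (automorphismSending (prod X A) (prod X B))
    (prod (equiv (component (prod X A)) (component X))
      (equiv (component X) (component (prod X B))))

def mainExp : Exp :=
  match Raw.elaborate [] Raw.depth [] (mainType.raw 0) none with
  | .ok A _ => A
  | .err => .var 0

end Term

/-! ### The statement of the theorem as an expression -/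

namespace Exp

def arrow (A B : Exp) : Exp := pi A (B.wk 1)
def prod (A B : Exp) : Exp := sigma A (B.wk 1)
def neg (A : Exp) : Exp := arrow A empty
def isProp (A : Exp) : Exp := pi A (pi (A.wk 1) (id (A.wk 2) (var 1) (var 0)))

def isEquiv (A B e : Exp) : Exp :=
  prod
    (sigma (arrow B A)
      (pi (B.wk 1) (id (B.wk 2) (app (e.wk 2) (app (var 1) (var 0))) (var 0))))
    (sigma (arrow B A)
      (pi (A.wk 1) (id (A.wk 2) (app (var 1) (app (e.wk 2) (var 0))) (var 0))))

def equiv (A B : Exp) : Exp := sigma (arrow A B) (isEquiv (A.wk 1) (B.wk 1) (var 0))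

/-- The identity equivalence of the last variable. -/
def idEquivVar : Exp :=
  -- The annotations of pairs and reflexivity paths are dummies here; this is permissible since the
  -- expression is only compared by `eqb` and erased.
  pair empty empty (lam (var 0) (var 0))
    (pair empty empty (pair empty empty (lam (var 0) (var 0)) (lam (var 0) (refl empty (var 0))))
      (pair empty empty (lam (var 0) (var 0)) (lam (var 0) (refl empty (var 0)))))

def idToEquiv (A B : Exp) : Exp :=
  lam (id (univ 0) A B)
    (idInd (univ 0) (equiv (var 2) (var 1)) idEquivVar (A.wk 1) (B.wk 1) (var 0))

def univalence : Exp :=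
  pi (univ 0) (pi (univ 0)
    (isEquiv (id (univ 0) (var 1) (var 0)) (equiv (var 1) (var 0)) (idToEquiv (var 1) (var 0))))

def excludedMiddle : Exp :=
  pi (univ 0) (arrow (isProp (var 0)) (sum (var 0) (neg (var 0))))

def propTrunc (A : Exp) : Exp := trunc (succ zero) A
def isConnected (k A : Exp) : Exp := isContr (trunc k A)
def component (A : Exp) : Exp := sigma (univ 0) (propTrunc (id (univ 0) (var 0) (A.wk 1)))
def isRigid (A : Exp) : Exp := isContr (component A)

def automorphismSending (A B : Exp) : Exp :=
  sigma (arrow (univ 0) (univ 0))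
    (prod (isEquiv (univ 0) (univ 0) (var 0))
      (propTrunc (id (univ 0) (app (var 0) (A.wk 1)) (B.wk 1))))

def mainStatement : Exp :=
  arrow univalence <| arrow excludedMiddle <|
  pi nat <| pi (univ 0) <| pi (univ 0) <| pi (univ 0) <|
  arrow (isTrunc 0 (succ (var 3)) (var 2)) <|
  arrow (isConnected (succ (var 3)) (var 1)) <|
  arrow (isConnected (succ (var 3)) (var 0)) <|
  arrow (isRigid (var 1)) <|
  arrow (isRigid (var 0)) <|
  arrow (neg (equiv (prod (var 2) (var 1)) (prod (var 2) (var 0)))) <|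
  prod
    (automorphismSending (prod (var 2) (var 1)) (prod (var 2) (var 0)))
    (prod
      (equiv (component (prod (var 2) (var 1))) (component (var 2)))
      (equiv (component (var 2)) (component (prod (var 2) (var 0)))))

theorem erase_mainStatement {i : ℕ} {γ : ℕ → Tm} (hγ : ClosedConsts γ) :
    mainStatement.erase i γ =
      (HoTT.arrow (HoTT.univalence i) <|
        HoTT.arrow (HoTT.excludedMiddle i) <|
        .pi .nat <| .pi (.univ i) <| .pi (.univ i) <| .pi (.univ i) <|
        HoTT.arrow (HoTT.isTrunc i (.succ (.var 3)) (.var 2)) <|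
        HoTT.arrow (HoTT.isConnected (.succ (.var 3)) (.var 1)) <|
        HoTT.arrow (HoTT.isConnected (.succ (.var 3)) (.var 0)) <|
        HoTT.arrow (HoTT.isRigid i (.var 1)) <|
        HoTT.arrow (HoTT.isRigid i (.var 0)) <|
        HoTT.arrow (HoTT.neg (HoTT.equiv
          (HoTT.prod (.var 2) (.var 1)) (HoTT.prod (.var 2) (.var 0)))) <|
        HoTT.prod
          (HoTT.automorphismSending i
            (HoTT.prod (.var 2) (.var 1)) (HoTT.prod (.var 2) (.var 0)))
          (HoTT.prod
            (HoTT.equiv (HoTT.component i (HoTT.prod (.var 2) (.var 1)))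
              (HoTT.component i (.var 2)))
            (HoTT.equiv (HoTT.component i (.var 2))
              (HoTT.component i (HoTT.prod (.var 2) (.var 0)))))) := by
  simp only [mainStatement, arrow, HoTT.arrow, prod, HoTT.prod, neg, HoTT.neg, isProp, HoTT.isProp,
    isEquiv, HoTT.isEquiv, equiv, HoTT.equiv, idEquivVar, HoTT.idEquiv, idToEquiv, HoTT.idToEquiv,
    univalence, HoTT.univalence, excludedMiddle, HoTT.excludedMiddle, propTrunc, HoTT.propTrunc,
    isConnected, HoTT.isConnected, component, HoTT.component, isRigid, HoTT.isRigid,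
    automorphismSending, HoTT.automorphismSending, erase, erase_isContr hγ, erase_wk_one hγ,
    erase_wk_two hγ, add_zero]

/-- This ties the statement that the library proves to the one written with de Bruijn indices:
equality up to annotations suffices because erasure removes them. -/
theorem mainExp_eqb : Term.mainExp.eqb mainStatement = true := by decide +kernel

end Exp
end HoTT

end

/-! ### The internal proof in homotopy type theory. -/

noncomputable section

namespace HoTT

namespace Term

open Entry

/-! ### The library: paths, propositions and truncation levels -/

abbrev U : Term := univ 0
-- Entries stated for `U₁` apply by cumulativity to types in `U`, and also to components and to
-- identity types of `U`, which live one universe higher.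
abbrev U₁ : Term := univ 1

/-- Nondependent elimination of the propositional truncation into a type `D`, for a
proof `h` that `D` is a `(-1)`-type. -/
def mere (t D h : Term) (g : Term → Term) : Term := truncInd (fun _ => D) t (fun _ => h) g

def symTransEntry : Entry where
  type := pi U₁ fun A => pi A fun x => pi A fun y => pi (id x y) fun p =>
    id (trans (sym p) p) (reflT y)
  proof := lam fun _ => lam fun _ => lam fun _ => lam fun p => path p fun _ => refl

def lib₁ : List Entry := [symTransEntry]
theorem lib₁_verified : Verified lib₁ := verified_nil.cons (by decide +kernel)
def symTrans (p : Term) : Term := con 0 hole hole hole p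

def transCancelEntry : Entry where
  type := pi U₁ fun A => pi A fun x => pi A fun y => pi (id x y) fun p => pi A fun z =>
    pi (id x z) fun q => id (trans p (trans (sym p) q)) q
  proof := lam fun _ => lam fun _ => lam fun _ => lam fun p =>
    path p fun _ => lam fun _ => lam fun _ => refl

def lib₂ : List Entry := transCancelEntry :: lib₁
theorem lib₂_verified : Verified lib₂ := lib₁_verified.cons (by decide +kernel)
def transCancel (p q : Term) : Term := con 1 hole hole hole p hole q

/-- Normalizing `h x y` by `h x x` gives a center that is the trivial loop at reflexivity, so path
induction contracts onto it. The conclusion is what being a (-1)-type unfolds to. -/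
def propIdContrEntry : Entry where
  type := pi U₁ fun A => arrow (isProp A) <| pi A fun x => pi A fun y => isContr (id x y)
  proof := lam fun _ => lam fun h => lam fun x => lam fun y =>
    pair (trans (sym (h x x)) (h x y)) (lam fun p => path p fun x => symTrans (h x x))

def lib₃ : List Entry := propIdContrEntry :: lib₂
theorem lib₃_verified : Verified lib₃ := lib₂_verified.cons (by decide +kernel)
def propIdContr (h : Term) : Term := con 2 hole h

def contrPropEntry : Entry where
  type := pi U₁ fun A => arrow (isContr A) (isProp A)
  proof := lam fun _ => lam fun c => lam fun x => lam fun y => trans (sym (snd c x)) (snd c y)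

def lib₄ : List Entry := contrPropEntry :: lib₃
theorem lib₄_verified : Verified lib₄ := lib₃_verified.cons (by decide +kernel)
def contrProp (c : Term) : Term := con 3 hole c

/-- Maps `f : X → Y` and `g : Y → X` with `f (g y) = y` and `g (f x) = x`. -/
def piInverse (X Y : Term) (C : Term → Term → Term → Term → Term) : Term :=
  pi (arrow X Y) fun f => pi (arrow Y X) fun g => pi (pi Y fun y => id (f (g y)) y) fun s =>
    pi (pi X fun x => id (g (f x)) x) fun r => C f g s r

/-- Univalence writes the equivalence as the image of a path, and path induction reduces to identity
maps. Because the family depends only on the underlying map, the inverse and the homotopies need no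
coherence. -/
def equivIndEntry : Entry where
  type := arrow univalence <|
    pi (pi U fun X => pi U fun Y => arrow (arrow X Y) U₁) fun P =>
    arrow (pi U fun X => P X X (idMap X)) <|
    pi U fun X => pi U fun Y => piInverse X Y fun f _ _ _ => P X Y f
  proof := lam fun ua => lam fun P => lam fun h => lam fun X => lam fun Y =>
    lam fun f => lam fun g => lam fun s => lam fun r =>
    let v := fst (ua X Y)
    let e := the (equiv X Y) (equivOf f g s r)
    tp (fun e => P X Y (fst e)) (snd v e)
      (ind (fun X Y p => P X Y (fst (idToEquiv X Y p))) (fst v e) fun X => h X)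

def lib₅ : List Entry := equivIndEntry :: lib₄
theorem lib₅_verified : Verified lib₅ := lib₄_verified.cons (by decide +kernel)
/-- Induction on an equivalence between `X` and `Y`, for univalence `ua`. -/
def equivInd (ua : Term) (P : Term → Term → Term → Term) (h : Term) : Term :=
  con 4 ua (lam fun X => lam fun Y => lam fun f => P X Y f) h

/-- Contractible types have contractible identity types; the step applies the induction hypothesis
to identity types. It is what permits truncation induction into paths of a truncated type. -/
def truncSuccEntry : Entry where
  type := pi nat fun k => pi U fun A => arrow (isTrunc 0 k A) (isTrunc 0 (succ k) A)
  proof := lam fun k => natInd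
    (fun k => pi U fun A => arrow (isTrunc 0 k A) (isTrunc 0 (succ k) A))
    (lam fun _ => lam fun c => propIdContr (contrProp c))
    (fun _ ih => lam fun _ => lam fun h => lam fun x => lam fun y => ih (id x y) (h x y)) k

def lib₆ : List Entry := truncSuccEntry :: lib₅
theorem lib₆_verified : Verified lib₆ := lib₅_verified.cons (by decide +kernel)
def truncSucc (k A h : Term) : Term := con 5 k A h

def propTruncPropEntry : Entry where
  type := pi U₁ fun A => isProp (propTrunc A)
  proof := lam fun A => lam fun x => lam fun y => fst (truncIsTrunc 1 (succ zero) A x y)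

def lib₇ : List Entry := propTruncPropEntry :: lib₆
theorem lib₇_verified : Verified lib₇ := lib₆_verified.cons (by decide +kernel)
def propTruncProp (A : Term) : Term := con 6 A

def retractPropEntry : Entry where
  type := pi U₁ fun A => pi U₁ fun B => arrow (isProp B) <| pi (arrow A B) fun f =>
    pi (arrow B A) fun g => arrow (pi A fun x => id (g (f x)) x) (isProp A)
  proof := lam fun _ => lam fun _ => lam fun hB => lam fun f => lam fun g => lam fun h =>
    lam fun x => lam fun y => trans (sym (h x)) (trans (ap (fun z => g z) (hB (f x) (f y))) (h y))

def lib₈ : List Entry := retractPropEntry :: lib₇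
theorem lib₈_verified : Verified lib₈ := lib₇_verified.cons (by decide +kernel)
def retractProp (A B hB f g h : Term) : Term := con 7 A B hB f g h

def singletonEntry : Entry where
  type := pi U₁ fun A => pi A fun x => isContr (sigma A fun y => id y x)
  proof := lam fun _ => lam fun x => pair (pair x refl) (lam fun w => split w fun _ q =>
    path q fun _ => refl)

def lib₉ : List Entry := singletonEntry :: lib₈
theorem lib₉_verified : Verified lib₉ := lib₈_verified.cons (by decide +kernel)
def singleton (A x : Term) : Term := con 8 A x

def sigmaPathEntry : Entry where
  type := pi U₁ fun A => pi (arrow A U₁) fun B => arrow (pi A fun x => isProp (B x)) <|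
    pi (sigma A fun x => B x) fun u => pi (sigma A fun x => B x) fun v =>
    arrow (id (fst u) (fst v)) (id u v)
  proof := lam fun A => lam fun B => lam fun hB => lam fun u => split u fun _ b =>
    lam fun v => split v fun _ b' => lam fun p =>
      ind (fun x y _ => pi (B x) fun b => pi (B y) fun b' =>
          idT (sigma A fun x => B x) (pair x b) (pair y b')) p
        (fun x => lam fun b => lam fun b' =>
          ap (fun z => the (sigma A fun x => B x) (pair x z)) (hB x b b')) b b'

def lib₁₀ : List Entry := sigmaPathEntry :: lib₉
theorem lib₁₀_verified : Verified lib₁₀ := lib₉_verified.cons (by decide +kernel)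
/-- The equality of `u` and `v` from that of their first components, for a family `B` of
propositions. -/
def sigmaPath (A : Term) (B : Term → Term) (hB : Term → Term) (u v p : Term) : Term :=
  con 9 A (lam fun x => B x) (lam fun x => hB x) u v p

end Term
end HoTT

end

noncomputable section

namespace HoTT

namespace Term

open Entry

/-! ### The library: function extensionality for propositions -/

/-- The type of lifts of `h : T → Y` along `e : X → Y`. -/
def lifts (T X e h : Term) : Term :=
  sigma (arrow T X) fun g => id (lamT T fun t => e (g t)) h

/-- Induction on equivalences leaves lifts along the identity map, a retract of a singleton. The
composite with the identity is only the eta-expansion of the lift, hence the correction by `eta`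
paths, which cancel. -/
def liftsPropEntry : Entry where
  type := arrow univalence <| pi U fun T => pi U fun X => pi U fun Y => piInverse X Y fun f _ _ _ =>
    pi (arrow T Y) fun h => isProp (lifts T X f h)
  proof := lam fun ua => lam fun T =>
    equivInd ua (fun X Y f => pi (arrow T Y) fun h => isProp (lifts T X f h))
      (lam fun X => lam fun h =>
        retractProp (lifts T X (idMap X) h) (sigma (arrow T X) fun g => id g h)
          (contrProp (singleton (arrow T X) h))
          (lam fun w => pair (fst w) (trans (sym (eta (fst w))) (snd w)))
          (lam fun w => pair (fst w) (trans (eta (fst w)) (snd w)))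
          (lam fun w => split w fun g q =>
            ap (fun q => the (lifts T X (idMap X) h) (pair g q)) (transCancel (eta g) q)))

def lib₁₁ : List Entry := liftsPropEntry :: lib₁₀
theorem lib₁₁_verified : Verified lib₁₁ := lib₁₀_verified.cons (by decide +kernel)
def liftsProp (ua T X Y f g s r h : Term) : Term := con 10 ua T X Y f g s r h

/-- If the fibers are contractible, the projection from the total space is an equivalence. Sections
of the family are a retract of the lifts of the identity along this projection. -/
def piContrPropEntry : Entry where
  type := arrow univalence <| pi U fun A => pi (arrow A U) fun B =>
    arrow (pi A fun x => isContr (B x)) (isProp (pi A fun x => B x))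
  proof := lam fun ua => lam fun A => lam fun B => lam fun c =>
    let S := sigma A fun x => B x
    retractProp (pi A fun x => B x) (lifts A S (lamT S fun w => fst w) (idMap A))
      (liftsProp ua A S A (lamT S fun w => fst w) (lam fun x => pair x (fst (c x)))
        (lam fun _ => refl)
        (lam fun w => split w fun x b => ap (fun b => the S (pair x b)) (snd (c x) b)) (idMap A))
      (lam fun f => pair (lam fun x => pair x (f x)) refl)
      (lam fun w => lam fun x => tp (fun y => B y) (ap (fun u => u x) (snd w)) (snd (fst w x)))
      (lam fun f => eta f)

def lib₁₂ : List Entry := piContrPropEntry :: lib₁₁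
theorem lib₁₂_verified : Verified lib₁₂ := lib₁₁_verified.cons (by decide +kernel)
def piContrProp : Term := con 11

/-- A section `f` provides a point in each fiber, so the proposition-valued family becomes
contractible. -/
def piPropEntry : Entry where
  type := arrow univalence <| pi U fun A => pi (arrow A U) fun B =>
    arrow (pi A fun x => isProp (B x)) (isProp (pi A fun x => B x))
  proof := lam fun ua => lam fun A => lam fun B => lam fun h => lam fun f => lam fun g =>
    piContrProp ua A B (lam fun x => pair (f x) (lam fun y => h x (f x) y)) f g

def lib₁₃ : List Entry := piPropEntry :: lib₁₂
theorem lib₁₃_verified : Verified lib₁₃ := lib₁₂_verified.cons (by decide +kernel)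
def piProp (ua A : Term) (B h : Term → Term) : Term :=
  con 12 ua A (lam fun x => B x) (lam fun x => h x)

def isContrPropEntry : Entry where
  type := arrow univalence <| pi U fun A => isProp (isContr A)
  proof := lam fun ua => lam fun A => lam fun c => lam fun c' =>
    sigmaPath A (fun x => pi A fun y => id x y)
      (fun x => piProp ua A (fun y => id x y)
        fun y => contrProp (propIdContr (contrProp c) x y)) c c' (snd c (fst c'))

def lib₁₄ : List Entry := isContrPropEntry :: lib₁₃
theorem lib₁₄_verified : Verified lib₁₄ := lib₁₃_verified.cons (by decide +kernel)
def isContrProp : Term := con 13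

def isTruncPropEntry : Entry where
  type := arrow univalence <| pi nat fun k => pi U fun A => isProp (isTrunc 0 k A)
  proof := lam fun ua => lam fun k => natInd (fun k => pi U fun A => isProp (isTrunc 0 k A))
    (lam fun A => isContrProp ua A)
    (fun k ih => lam fun A => piProp ua A (fun x => pi A fun y => isTrunc 0 k (id x y))
      fun x => piProp ua A (fun y => isTrunc 0 k (id x y)) fun y => ih (id x y)) k

def lib₁₅ : List Entry := isTruncPropEntry :: lib₁₄
theorem lib₁₅_verified : Verified lib₁₅ := lib₁₄_verified.cons (by decide +kernel)
def isTruncProp (ua k A : Term) : Term := con 14 ua k A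

end Term
end HoTT

end

noncomputable section

namespace HoTT

namespace Term

open Entry

/-! ### The library: identifications of types -/

def uaPathEntry : Entry where
  type := arrow univalence <| pi U fun X => pi U fun Y => piInverse X Y fun _ _ _ _ => idT U X Y
  proof := lam fun ua => lam fun X => lam fun Y => lam fun f => lam fun g => lam fun s => lam fun r =>
    fst (fst (ua X Y)) (equivOf f g s r)

def lib₁₆ : List Entry := uaPathEntry :: lib₁₅
theorem lib₁₆_verified : Verified lib₁₆ := lib₁₅_verified.cons (by decide +kernel)
def uaPath (ua X Y f g s r : Term) : Term := con 15 ua X Y f g s r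

def fiber (W T p t : Term) : Term := sigma W fun w => idT T (p w) t

/-- Composing with an equivalence does not change fibers. By induction the equivalence is an
identity map, where both sides agree by computation. -/
def fiberCompEntry : Entry where
  type := arrow univalence <| pi U fun W => pi U fun T => pi U fun X => piInverse T X fun e _ _ _ =>
    pi (arrow W T) fun p => pi T fun t =>
      idT U (fiber W T p t) (sigma W fun w => idT X (e (p w)) (e t))
  proof := lam fun ua => lam fun W =>
    equivInd ua (fun T X e => pi (arrow W T) fun p => pi T fun t =>
      idT U (fiber W T p t) (sigma W fun w => idT X (e (p w)) (e t)))
      (lam fun _ => lam fun _ => lam fun _ => refl)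

def lib₁₇ : List Entry := fiberCompEntry :: lib₁₆
theorem lib₁₇_verified : Verified lib₁₇ := lib₁₆_verified.cons (by decide +kernel)
def fiberComp : Term := con 16

def fiberFst (X A x : Term) : Term := sigma (prod X A) fun w => idT X (fst w) x

def fiberFstEntry : Entry where
  type := arrow univalence <| pi U fun X => pi U fun A => pi X fun x => idT U (fiberFst X A x) A
  proof := lam fun ua => lam fun X => lam fun A => lam fun x =>
    uaPath ua (fiberFst X A x) A
      (lam fun v => snd (fst v)) (lam fun a => pair (pair x a) refl) (lam fun _ => refl)
      (lam fun v => split v fun w q =>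
        -- The type of `q` mentions `w`, so `q` is generalized before `w` is split; its endpoint `x`
        -- is then freed for path induction.
        the (pi (idT X (fst w) x) fun q =>
            idT (fiberFst X A x) (pair (pair x (snd w)) refl) (pair w q))
          (split w fun _ a => lam fun q =>
            ind (fun y z q => pi A fun a =>
              idT (fiberFst X A z) (pair (pair z a) refl) (pair (pair y a) q)) q
              (fun _ => lam fun _ => refl) a) q)

def lib₁₈ : List Entry := fiberFstEntry :: lib₁₇
theorem lib₁₈_verified : Verified lib₁₈ := lib₁₇_verified.cons (by decide +kernel)
def fiberFstPath : Term := con 17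

def proj (Z hZ t : Term) : Term := truncInd (fun _ => Z) t (fun _ => hZ) (fun w => fst w)

/-- Pairing with a point of the truncation of `C`. Connectedness gives such a point, whereas a point
of `C` itself need not be available. -/
def injAt (k Z C z u : Term) : Term :=
  truncInd (fun _ => trunc k (prod Z C)) u (fun _ => truncIsTrunc 0 k (prod Z C))
    (fun c => tr k (the (prod Z C) (pair z c)))

def projInjEntry : Entry where
  type := pi nat fun k => pi U fun Z => pi U fun C => pi (isTrunc 0 k Z) fun hZ =>
    pi (trunc k C) fun u => pi Z fun z => idT Z (proj Z hZ (injAt k Z C z u)) z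
  proof := lam fun k => lam fun Z => lam fun C => lam fun hZ => lam fun u => lam fun z =>
    truncInd (fun u => idT Z (proj Z hZ (injAt k Z C z u)) z) u
      (fun u => truncSucc k Z hZ (proj Z hZ (injAt k Z C z u)) z) (fun _ => refl)

def lib₁₉ : List Entry := projInjEntry :: lib₁₈
theorem lib₁₉_verified : Verified lib₁₉ := lib₁₈_verified.cons (by decide +kernel)
def projInj : Term := con 18

/-- On the class of a pair `(z, x)` the chosen center can be replaced by the class of `x`, as the
truncation of `C` is contractible. -/
def injProjEntry : Entry where
  type := pi nat fun k => pi U fun Z => pi U fun C => pi (isTrunc 0 k Z) fun hZ =>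
    pi (isConnected k C) fun c => pi (trunc k (prod Z C)) fun t =>
      id (injAt k Z C (proj Z hZ t) (fst c)) t
  proof := lam fun k => lam fun Z => lam fun C => lam fun hZ => lam fun c => lam fun t =>
    truncInd (fun t => id (injAt k Z C (proj Z hZ t) (fst c)) t) t
      (fun t => truncSucc k (trunc k (prod Z C)) (truncIsTrunc 0 k (prod Z C))
        (injAt k Z C (proj Z hZ t) (fst c)) t)
      (fun w => split w fun z x => ap (fun u => injAt k Z C z u) (snd c (tr k x)))

def lib₂₀ : List Entry := injProjEntry :: lib₁₉
theorem lib₂₀_verified : Verified lib₂₀ := lib₁₉_verified.cons (by decide +kernel)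
def injProj : Term := con 19

/-- Quantification over a truncation level `k`, a `k`-type `X` and a `k`-connected type `A`. -/
def piConnected (C : Term → Term → Term → Term → Term → Term → Term) : Term :=
  pi univalence fun ua => pi nat fun k => pi U fun X => pi U fun A => pi (isTrunc 0 k X) fun hX =>
    pi (isConnected k A) fun cA => C ua k X A hX cA

def lamConnected (b : Term → Term → Term → Term → Term → Term → Term) : Term :=
  lam fun ua => lam fun k => lam fun X => lam fun A => lam fun hX => lam fun cA => b ua k X A hX cA

def truncProdEntry : Entry where
  type := piConnected fun _ k X A _ _ => idT U (trunc k (prod X A)) X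
  proof := lamConnected fun ua k X A hX cA =>
    uaPath ua (trunc k (prod X A)) X (lam fun t => proj X hX t)
      (lam fun z => injAt k X A z (fst cA)) (lam fun z => projInj k X A hX (fst cA) z)
      (lam fun t => injProj k X A hX cA t)

def lib₂₁ : List Entry := truncProdEntry :: lib₂₀
theorem lib₂₁_verified : Verified lib₂₁ := lib₂₀_verified.cons (by decide +kernel)
/-- The `k`-truncation of the product of a `k`-type and a `k`-connected type. -/
def truncProd (ua k X A hX cA : Term) : Term := con 20 ua k X A hX cA

def trMap (k Y : Term) : Term := lamT Y fun y => tr k y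

/-- After composition with the equivalence from the truncation to `X`, the truncation map computes
to the first projection, whose fibers are `A`. -/
def fiberTrEntry : Entry where
  type := piConnected fun _ k X A _ _ => pi (trunc k (prod X A)) fun t =>
    idT U (fiber (prod X A) (trunc k (prod X A)) (trMap k (prod X A)) t) A
  proof := lamConnected fun ua k X A hX cA => lam fun t =>
    trans (fiberComp ua (prod X A) (trunc k (prod X A)) X (lam fun t => proj X hX t)
      (lam fun z => injAt k X A z (fst cA)) (lam fun z => projInj k X A hX (fst cA) z)
      (lam fun t => injProj k X A hX cA t) (trMap k (prod X A)) t)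
      (fiberFstPath ua X A (proj X hX t))

def lib₂₂ : List Entry := fiberTrEntry :: lib₂₁
theorem lib₂₂_verified : Verified lib₂₂ := lib₂₁_verified.cons (by decide +kernel)
def fiberTr (ua k X A hX cA : Term) : Term := con 21 ua k X A hX cA

end Term
end HoTT

end

noncomputable section

namespace HoTT

namespace Term

open Entry

/-! ### The library: types that are merely products -/

/-- Based path induction follows from the unbased form by including the family in the motive. -/
def basedIndEntry : Entry where
  type := pi U₁ fun A => pi A fun x => pi (pi A fun y => arrow (id x y) U₁) fun P =>
    arrow (P x (reflT x)) <| pi A fun y => pi (id x y) fun q => P y q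
  proof := lam fun A => lam fun _ => lam fun P => lam fun d => lam fun _ => lam fun q =>
    ind (fun x y q => pi (pi A fun y => arrow (id x y) U₁) fun P => arrow (P x (reflT x)) (P y q)) q
      (fun _ => lam fun _ => lam fun d => d) P d

def lib₂₃ : List Entry := basedIndEntry :: lib₂₂
theorem lib₂₃_verified : Verified lib₂₃ := lib₂₂_verified.cons (by decide +kernel)
def basedInd (A x : Term) (P : Term → Term → Term) (d y q : Term) : Term :=
  con 22 A x (lam fun y => lam fun q => P y q) d y q

def totalFiber (Y T p : Term) : Term := sigma T fun t => fiber Y T p t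

def totalFiberEntry : Entry where
  type := arrow univalence <| pi U fun Y => pi U fun T => pi (arrow Y T) fun p =>
    idT U Y (totalFiber Y T p)
  proof := lam fun ua => lam fun Y => lam fun T => lam fun p => uaPath ua Y (totalFiber Y T p)
    (lam fun y => pair (p y) (pair y refl)) (lam fun v => fst (snd v))
    (lam fun v => split v fun t x => split x fun y q =>
      basedInd T (p y) (fun t q => idT (totalFiber Y T p) (pair (p y) (pair y refl)) (pair t (pair y q)))
        refl t q)
    (lam fun _ => refl)

def lib₂₄ : List Entry := totalFiberEntry :: lib₂₃
theorem lib₂₄_verified : Verified lib₂₄ := lib₂₃_verified.cons (by decide +kernel)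
def totalFiberPath : Term := con 23

/-- Transport along a path `p` between types. -/
def cast (p x : Term) : Term := tp (fun Z => Z) p x

def castSymEntry : Entry where
  type := pi U fun X => pi U fun Y => pi (idT U X Y) fun p => pi Y fun y =>
    id (cast p (cast (sym p) y)) y
  proof := lam fun _ => lam fun _ => lam fun p =>
    ind (fun _ Y p => pi Y fun y => id (cast p (cast (sym p) y)) y) p fun _ => lam fun _ => refl

def lib₂₅ : List Entry := castSymEntry :: lib₂₄
theorem lib₂₅_verified : Verified lib₂₅ := lib₂₄_verified.cons (by decide +kernel)
def castSym : Term := con 24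

def symCastEntry : Entry where
  type := pi U fun X => pi U fun Y => pi (idT U X Y) fun p => pi X fun x =>
    id (cast (sym p) (cast p x)) x
  proof := lam fun _ => lam fun _ => lam fun p =>
    ind (fun X _ p => pi X fun x => id (cast (sym p) (cast p x)) x) p fun _ => lam fun _ => refl

def lib₂₆ : List Entry := symCastEntry :: lib₂₅
theorem lib₂₆_verified : Verified lib₂₆ := lib₂₅_verified.cons (by decide +kernel)
def symCast : Term := con 25

/-- Transporting fiberwise avoids identifying the family with a constant one, which would take
function extensionality. -/
def totalEntry : Entry where
  type := arrow univalence <| pi U fun T => pi (arrow T U) fun F => pi U fun A =>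
    arrow (pi T fun t => idT U (F t) A) (idT U (sigma T fun t => F t) (prod T A))
  proof := lam fun ua => lam fun T => lam fun F => lam fun A => lam fun h =>
    uaPath ua (sigma T fun t => F t) (prod T A)
      (lam fun v => pair (fst v) (cast (h (fst v)) (snd v)))
      (lam fun w => pair (fst w) (cast (sym (h (fst w))) (snd w)))
      (lam fun w => split w fun t a =>
        ap (fun a => the (prod T A) (pair t a)) (castSym (F t) A (h t) a))
      (lam fun v => split v fun t x =>
        ap (fun x => the (sigma T fun t => F t) (pair t x)) (symCast (F t) A (h t) x))

def lib₂₇ : List Entry := totalEntry :: lib₂₆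
theorem lib₂₇_verified : Verified lib₂₇ := lib₂₆_verified.cons (by decide +kernel)
def totalPath : Term := con 26

def prodOfFibersEntry : Entry where
  type := arrow univalence <| pi U fun Y => pi U fun T => pi (arrow Y T) fun p => pi U fun A =>
    arrow (pi T fun t => idT U (fiber Y T p t) A) (idT U Y (prod T A))
  proof := lam fun ua => lam fun Y => lam fun T => lam fun p => lam fun A => lam fun h =>
    trans (totalFiberPath ua Y T p) (totalPath ua T (lam fun t => fiber Y T p t) A h)

def lib₂₈ : List Entry := prodOfFibersEntry :: lib₂₇
theorem lib₂₈_verified : Verified lib₂₈ := lib₂₇_verified.cons (by decide +kernel)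
def prodOfFibers : Term := con 27

def merelyEqual (X Y : Term) : Term := propTrunc (idT U X Y)

/-- Functoriality of the propositional truncation of a type in `U₁`. -/
def mereMap (t D : Term) (g : Term → Term) : Term :=
  mere t (propTrunc D) (truncIsTrunc 1 (succ zero) D) fun q => tr (succ zero) (g q)

/-- Both `F` and `A` are points of the contractible component of `A`; project the path between them.
-/
def rigidPathEntry : Entry where
  type := pi U fun A => arrow (isRigid A) <| pi U fun F => arrow (merelyEqual F A) (idT U F A)
  proof := lam fun A => lam fun r => lam fun F => lam fun m =>
    ap (fun w => fst w) (contrProp r (pair F m) (pair A (tr (succ zero) refl)))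

def lib₂₉ : List Entry := rigidPathEntry :: lib₂₈
theorem lib₂₉_verified : Verified lib₂₉ := lib₂₈_verified.cons (by decide +kernel)
def rigidPath (A r F m : Term) : Term := con 28 A r F m

/-- All fibers of the map from `Y` to its truncation are equal to `A`. -/
def trFibers (k Y A : Term) : Term :=
  pi (trunc k Y) fun t => idT U (fiber Y (trunc k Y) (trMap k Y) t) A

def fibersAlongEntry : Entry where
  type := pi nat fun k => pi U fun A => pi U fun Y => pi U fun W => arrow (idT U Y W) <|
    arrow (trFibers k W A) (trFibers k Y A)
  proof := lam fun k => lam fun A => lam fun _ => lam fun _ => lam fun q =>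
    ind (fun Y W _ => arrow (trFibers k W A) (trFibers k Y A)) q fun _ => lam fun h => h

def lib₃₀ : List Entry := fibersAlongEntry :: lib₂₉
theorem lib₃₀_verified : Verified lib₃₀ := lib₂₉_verified.cons (by decide +kernel)
def fibersAlong : Term := con 29

/-- The mere identification with the product can be used because, for each fiber, only a mere
identification with `A` is sought. Rigidity then upgrades it for every fiber, and reassembling the
total space gives the product. -/
def decomposeEntry : Entry where
  type := piConnected fun _ k X A _ _ => arrow (isRigid A) <| pi U fun Y =>
    arrow (merelyEqual Y (prod X A)) (idT U Y (prod (trunc k Y) A))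
  proof := lamConnected fun ua k X A hX cA => lam fun rA => lam fun Y => lam fun m =>
    prodOfFibers ua Y (trunc k Y) (trMap k Y) A (lam fun t =>
      rigidPath A rA (fiber Y (trunc k Y) (trMap k Y) t)
        (mereMap m (idT U (fiber Y (trunc k Y) (trMap k Y) t) A) fun q =>
          fibersAlong k A Y (prod X A) q (fiberTr ua k X A hX cA) t))

def lib₃₁ : List Entry := decomposeEntry :: lib₃₀
theorem lib₃₁_verified : Verified lib₃₁ := lib₃₀_verified.cons (by decide +kernel)
/-- A type that is merely a product `X × A` is the product of its truncation with `A`. -/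
def decompose (ua k X A hX cA rA Y m : Term) : Term := con 30 ua k X A hX cA rA Y m

end Term
end HoTT

end

noncomputable section

namespace HoTT

namespace Term

open Entry

/-! ### The library: the automorphism -/

/-- Excluded middle is available for `U` only, and identity types of `U` lie in `U₁`. Components are
therefore decided through mere equivalence, and this entry translates back to mere equality. -/
def mereUaEntry : Entry where
  type := arrow univalence <| pi U fun X => pi U fun Y =>
    arrow (propTrunc (equiv X Y)) (merelyEqual X Y)
  proof := lam fun ua => lam fun X => lam fun Y => lam fun m =>
    mereMap m (idT U X Y) fun e => fst (fst (ua X Y)) e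

def lib₃₂ : List Entry := mereUaEntry :: lib₃₁
theorem lib₃₂_verified : Verified lib₃₂ := lib₃₁_verified.cons (by decide +kernel)
def mereUa (ua X Y m : Term) : Term := con 31 ua X Y m

def mereEquivEntry : Entry where
  type := pi U fun X => pi U fun Y => arrow (merelyEqual X Y) (propTrunc (equiv X Y))
  proof := lam fun X => lam fun Y => lam fun m =>
    mere m (propTrunc (equiv X Y)) (truncIsTrunc 0 (succ zero) (equiv X Y)) fun q =>
      tr (succ zero) (idToEquiv X Y q)

def lib₃₃ : List Entry := mereEquivEntry :: lib₃₂
theorem lib₃₃_verified : Verified lib₃₃ := lib₃₂_verified.cons (by decide +kernel)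
def mereEquiv (X Y m : Term) : Term := con 32 X Y m

def mereTruncEntry : Entry where
  type := piConnected fun _ k X A _ _ => pi U fun Z =>
    arrow (merelyEqual Z (prod X A)) (merelyEqual (trunc k Z) X)
  proof := lamConnected fun ua k X A hX cA => lam fun Z => lam fun m =>
    mereMap m (idT U (trunc k Z) X) fun q =>
      trans (ap (fun Z => trunc k Z) q) (truncProd ua k X A hX cA)

def lib₃₄ : List Entry := mereTruncEntry :: lib₃₃
theorem lib₃₄_verified : Verified lib₃₄ := lib₃₃_verified.cons (by decide +kernel)
def mereTrunc (ua k X A hX cA : Term) : Term := con 33 ua k X A hX cA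

def mereProdEntry : Entry where
  type := pi U fun X => pi U fun B => pi U fun Z =>
    arrow (merelyEqual Z X) (merelyEqual (prod Z B) (prod X B))
  proof := lam fun X => lam fun B => lam fun Z => lam fun m =>
    mereMap m (idT U (prod Z B) (prod X B)) fun q => ap (fun Z => prod Z B) q

def lib₃₅ : List Entry := mereProdEntry :: lib₃₄
theorem lib₃₅_verified : Verified lib₃₅ := lib₃₄_verified.cons (by decide +kernel)
def mereProd (X B : Term) : Term := con 34 X B

/-- Case distinction in the checker is nondependent and does not reduce, so the chosen type is
packaged with identifications that record its value in each case. -/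
def caseEntry : Entry where
  type := pi U fun P => arrow (sum P (neg P)) <| pi U fun X => pi U fun Y =>
    sigma U fun W => prod (arrow P (idT U W X)) (arrow (neg P) (idT U W Y))
  proof := lam fun P => lam fun d => lam fun X => lam fun Y =>
    sumRec (sigma U fun W => prod (arrow P (idT U W X)) (arrow (neg P) (idT U W Y))) d
      (fun p => pair X (pair (lam fun _ => refl) (lam fun n => absurd (n p))))
      (fun n => pair Y (pair (lam fun p => absurd (n p)) (lam fun _ => refl)))

def lib₃₆ : List Entry := caseEntry :: lib₃₅
theorem lib₃₆_verified : Verified lib₃₆ := lib₃₅_verified.cons (by decide +kernel)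
def caseType : Term := con 35

def decision (P : Term) : Term := pi U fun Z => sum (P Z) (neg (P Z))

/-- The property of the map that agrees with `g` on `P`, with `h` on `Q`, and with the identity
elsewhere. -/
def swapSpec (P Q g h f : Term) : Term := pi U fun Z =>
  prod (arrow (P Z) (idT U (f Z) (g Z))) <| prod (arrow (Q Z) (idT U (f Z) (h Z))) <|
    arrow (neg (P Z)) (arrow (neg (Q Z)) (idT U (f Z) Z))

/-- Two nested case distinctions, on `P` and then on `Q`. Disjointness lets a point of `Q` pass the
outer one. -/
def swapEntry : Entry where
  type := pi (arrow U U) fun P => pi (arrow U U) fun Q => arrow (decision P) <|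
    arrow (decision Q) <| arrow (pi U fun Z => arrow (P Z) (neg (Q Z))) <|
    pi (arrow U U) fun g => pi (arrow U U) fun h => sigma (arrow U U) fun f => swapSpec P Q g h f
  proof := lam fun P => lam fun Q => lam fun dP => lam fun dQ => lam fun disj =>
    lam fun g => lam fun h =>
    let v (Z : Term) := caseType (Q Z) (dQ Z) (h Z) Z
    let w (Z : Term) := caseType (P Z) (dP Z) (g Z) (fst (v Z))
    pair (lam fun Z => fst (w Z)) (lam fun Z => pair (fst (snd (w Z)))
      (pair (lam fun q => trans (snd (snd (w Z)) (lam fun p => disj Z p q)) (fst (snd (v Z)) q))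
        (lam fun n => lam fun n' => trans (snd (snd (w Z)) n) (snd (snd (v Z)) n'))))

def lib₃₇ : List Entry := swapEntry :: lib₃₆
theorem lib₃₇_verified : Verified lib₃₇ := lib₃₆_verified.cons (by decide +kernel)
def swap : Term := con 36

/-- If `P` holds at `Z`, then `Q` holds at `g Z`. -/
def mapsTo (P Q g : Term) : Term := pi U fun Z => arrow (P Z) (Q (g Z))

/-- `h` is a left inverse of `g` on `P`. -/
def inverseOn (P g h : Term) : Term := pi U fun Z => arrow (P Z) (idT U (h (g Z)) Z)

/-- The map exchanges `P` and `Q`, so a second application falls in the other case and undoes the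
first; elsewhere the map is the identity twice. -/
def involutionEntry : Entry where
  type := pi (arrow U U) fun P => pi (arrow U U) fun Q => arrow (decision P) <|
    arrow (decision Q) <| pi (arrow U U) fun g => pi (arrow U U) fun h => pi (arrow U U) fun f =>
    arrow (swapSpec P Q g h f) <| arrow (mapsTo P Q g) <| arrow (mapsTo Q P h) <|
    arrow (inverseOn P g h) <| arrow (inverseOn Q h g) <| pi U fun Z => idT U (f (f Z)) Z
  proof := lam fun _ => lam fun _ => lam fun dP => lam fun dQ => lam fun g => lam fun h =>
    lam fun f => lam fun s => lam fun gPQ => lam fun hQP => lam fun hg => lam fun gh => lam fun Z =>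
    sumRec (idT U (f (f Z)) Z) (dP Z)
      (fun p => trans (ap (fun W => f W) (fst (s Z) p))
        (trans (fst (snd (s (g Z))) (gPQ Z p)) (hg Z p)))
      (fun n => sumRec (idT U (f (f Z)) Z) (dQ Z)
        (fun q => trans (ap (fun W => f W) (fst (snd (s Z)) q))
          (trans (fst (s (h Z)) (hQP Z q)) (gh Z q)))
        (fun n' => trans (ap (fun W => f W) (snd (snd (s Z)) n n')) (snd (snd (s Z)) n n')))

def lib₃₈ : List Entry := involutionEntry :: lib₃₇
theorem lib₃₈_verified : Verified lib₃₈ := lib₃₇_verified.cons (by decide +kernel)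
def involution : Term := con 37

def swapInvolutionEntry : Entry where
  type := pi (arrow U U) fun P => pi (arrow U U) fun Q => arrow (decision P) <|
    arrow (decision Q) <| arrow (pi U fun Z => arrow (P Z) (neg (Q Z))) <|
    pi (arrow U U) fun g => pi (arrow U U) fun h =>
    arrow (mapsTo P Q g) <| arrow (mapsTo Q P h) <|
    arrow (inverseOn P g h) <| arrow (inverseOn Q h g) <| sigma (arrow U U) fun f =>
      prod (pi U fun Z => idT U (f (f Z)) Z) (pi U fun Z => arrow (P Z) (idT U (f Z) (g Z)))
  proof := lam fun P => lam fun Q => lam fun dP => lam fun dQ => lam fun disj =>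
    lam fun g => lam fun h => lam fun gPQ => lam fun hQP => lam fun hg => lam fun gh =>
    split (swap P Q dP dQ disj g h) fun f s =>
      pair f (pair (involution P Q dP dQ g h f s gPQ hQP hg gh) (lam fun Z => fst (s Z)))

def lib₃₉ : List Entry := swapInvolutionEntry :: lib₃₈
theorem lib₃₉_verified : Verified lib₃₉ := lib₃₈_verified.cons (by decide +kernel)
def swapInvolution : Term := con 38

def disjointEntry : Entry where
  type := arrow univalence <| pi U fun V => pi U fun W => arrow (neg (equiv V W)) <| pi U fun Z =>
    arrow (propTrunc (equiv Z V)) (neg (propTrunc (equiv Z W)))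
  proof := lam fun ua => lam fun V => lam fun W => lam fun n => lam fun Z => lam fun m => lam fun m' =>
    mere (mereUa ua Z V m) empty (lam fun x => absurd x) fun q =>
      mere (mereUa ua Z W m') empty (lam fun x => absurd x) fun q' =>
        n (idToEquiv V W (trans (sym q) q'))

def lib₄₀ : List Entry := disjointEntry :: lib₃₉
theorem lib₄₀_verified : Verified lib₄₀ := lib₃₉_verified.cons (by decide +kernel)
def disjoint : Term := con 39

def exchangeEntry : Entry where
  type := piConnected fun _ k X A _ _ => pi U fun B => pi U fun Z =>
    arrow (propTrunc (equiv Z (prod X A))) (propTrunc (equiv (prod (trunc k Z) B) (prod X B)))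
  proof := lamConnected fun ua k X A hX cA => lam fun B => lam fun Z => lam fun m =>
    mereEquiv (prod (trunc k Z) B) (prod X B)
      (mereProd X B (trunc k Z) (mereTrunc ua k X A hX cA Z (mereUa ua Z (prod X A) m)))

def lib₄₁ : List Entry := exchangeEntry :: lib₄₀
theorem lib₄₁_verified : Verified lib₄₁ := lib₄₀_verified.cons (by decide +kernel)
def exchange : Term := con 40

/-- Truncating the exchanged type recovers the truncation of `Z`, because `B` is connected;
multiplying by `A` restores `Z` by the decomposition, for which `A` must be rigid. -/
def exchangeBackEntry : Entry where
  type := piConnected fun _ k X A _ _ => arrow (isRigid A) <| pi U fun B =>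
    arrow (isConnected k B) <| pi U fun Z => arrow (propTrunc (equiv Z (prod X A)))
      (idT U (prod (trunc k (prod (trunc k Z) B)) A) Z)
  proof := lamConnected fun ua k X A hX cA => lam fun rA => lam fun B => lam fun cB =>
    lam fun Z => lam fun m =>
    trans (ap (fun T => prod T A) (truncProd ua k (trunc k Z) B (truncIsTrunc 0 k Z) cB))
      (sym (decompose ua k X A hX cA rA Z (mereUa ua Z (prod X A) m)))

def lib₄₂ : List Entry := exchangeBackEntry :: lib₄₁
theorem lib₄₂_verified : Verified lib₄₂ := lib₄₁_verified.cons (by decide +kernel)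
def exchangeBack : Term := con 41

def automorphismEntry : Entry where
  type := piConnected fun _ k X A _ _ => arrow excludedMiddle <| arrow (isRigid A) <|
    pi U fun B => arrow (isConnected k B) <| arrow (isRigid B) <|
    arrow (neg (equiv (prod X A) (prod X B))) (automorphismSending (prod X A) (prod X B))
  proof := lamConnected fun ua k X A hX cA => lam fun em => lam fun rA => lam fun B =>
    lam fun cB => lam fun rB => lam fun n =>
    let P (A : Term) := lamT U fun Z => propTrunc (equiv Z (prod X A))
    let d (A : Term) := lam fun Z =>
      em (propTrunc (equiv Z (prod X A))) (propTruncProp (equiv Z (prod X A)))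
    let g (B : Term) := lamT U fun Z => prod (trunc k Z) B
    split (swapInvolution (P A) (P B) (d A) (d B) (disjoint ua (prod X A) (prod X B) n) (g B) (g A)
        (exchange ua k X A hX cA B) (exchange ua k X B hX cB A)
        (exchangeBack ua k X A hX cA rA B cB) (exchangeBack ua k X B hX cB rB A cA)) fun f s =>
      -- An involution serves as its own right and left inverse.
      pair f (pair (pair (pair f (fst s)) (pair f (fst s)))
        (tr (succ zero) (trans (snd s (prod X A) (tr (succ zero) (idEquiv (prod X A))))
          (ap (fun T => prod T B) (truncProd ua k X A hX cA)))))

def lib₄₃ : List Entry := automorphismEntry :: lib₄₂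
theorem lib₄₃_verified : Verified lib₄₃ := lib₄₂_verified.cons (by decide +kernel)
def automorphism : Term := con 42

end Term
end HoTT

end

noncomputable section

namespace HoTT

namespace Term

open Entry

/-! ### The library: the components of the universe -/

/-- A mere path may be eliminated here because truncatedness is a proposition. It is for this that
function extensionality for propositions was developed. -/
def isTruncOfMereEntry : Entry where
  type := arrow univalence <| pi nat fun k => pi U fun X => arrow (isTrunc 0 k X) <| pi U fun Z =>
    arrow (merelyEqual Z X) (isTrunc 0 k Z)
  proof := lam fun ua => lam fun k => lam fun _ => lam fun hX => lam fun Z => lam fun m =>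
    mere m (isTrunc 0 k Z) (propIdContr (isTruncProp ua k Z)) fun q =>
      tp (fun Z => isTrunc 0 k Z) (sym q) hX

def lib₄₄ : List Entry := isTruncOfMereEntry :: lib₄₃
theorem lib₄₄_verified : Verified lib₄₄ := lib₄₃_verified.cons (by decide +kernel)
def isTruncOfMere : Term := con 43

/-- The action on mere identifications is a parameter: points of a component are identified by their
first coordinates alone, so its construction never matters. -/
def truncComponent (k X A d : Term) : Term := lamT (component (prod X A)) fun w =>
  the (component X) (pair (trunc k (fst w)) (d (fst w) (snd w)))

def prodComponent (X A u : Term) : Term := lamT (component X) fun v =>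
  the (component (prod X A)) (pair (prod (fst v) A) (u (fst v) (snd v)))

/-- Quantification over the maps between mere identifications that are used on components. -/
def piMere (k X A : Term) (C : Term → Term → Term) : Term :=
  pi (pi U fun Z => arrow (merelyEqual Z (prod X A)) (merelyEqual (trunc k Z) X)) fun d =>
    pi (pi U fun Z => arrow (merelyEqual Z X) (merelyEqual (prod Z A) (prod X A))) fun u => C d u

/-- The first coordinate of `v` is again truncated, being merely equal to `X`, so truncating its
product with `A` gives it back. -/
def truncProdComponentEntry : Entry where
  type := piConnected fun _ k X A _ _ => piMere k X A fun d u => pi (component X) fun v =>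
    id (truncComponent k X A d (prodComponent X A u v)) v
  proof := lamConnected fun ua k X A hX cA => lam fun d => lam fun u => lam fun v =>
    sigmaPath U (fun Z => merelyEqual Z X) (fun Z => propTruncProp (idT U Z X))
      (truncComponent k X A d (prodComponent X A u v)) v
      (truncProd ua k (fst v) A (isTruncOfMere ua k X hX (fst v) (snd v)) cA)

def lib₄₅ : List Entry := truncProdComponentEntry :: lib₄₄
theorem lib₄₅_verified : Verified lib₄₅ := lib₄₄_verified.cons (by decide +kernel)
def truncProdComponent : Term := con 44

def prodTruncComponentEntry : Entry where
  type := piConnected fun _ k X A _ _ => arrow (isRigid A) <| piMere k X A fun d u =>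
    pi (component (prod X A)) fun w => id (prodComponent X A u (truncComponent k X A d w)) w
  proof := lamConnected fun ua k X A hX cA => lam fun rA => lam fun d => lam fun u => lam fun w =>
    sigmaPath U (fun Z => merelyEqual Z (prod X A)) (fun Z => propTruncProp (idT U Z (prod X A)))
      (prodComponent X A u (truncComponent k X A d w)) w
      (sym (decompose ua k X A hX cA rA (fst w) (snd w)))

def lib₄₆ : List Entry := prodTruncComponentEntry :: lib₄₅
theorem lib₄₆_verified : Verified lib₄₆ := lib₄₅_verified.cons (by decide +kernel)
def prodTruncComponent : Term := con 45

def mainEntry : Entry where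
  type := mainType
  proof := lam fun ua => lam fun em => lam fun m => lam fun X => lam fun A => lam fun B =>
    lam fun hX => lam fun cA => lam fun cB => lam fun rA => lam fun rB => lam fun n =>
    -- The truncation level is `k - 2 = m - 1`; the library entries hold for arbitrary `k`.
    let k := succ m
    let d (A cA : Term) := mereTrunc ua k X A hX cA
    let u (A : Term) := mereProd X A
    pair (automorphism ua k X A hX cA em rA B cB rB n)
      (pair
        (equivOf (truncComponent k X A (d A cA)) (prodComponent X A (u A))
          (truncProdComponent ua k X A hX cA (d A cA) (u A))
          (prodTruncComponent ua k X A hX cA rA (d A cA) (u A)))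
        (equivOf (prodComponent X B (u B)) (truncComponent k X B (d B cB))
          (prodTruncComponent ua k X B hX cB rB (d B cB) (u B))
          (truncProdComponent ua k X B hX cB (d B cB) (u B))))

theorem main_verified : Verified (mainEntry :: lib₄₆) := lib₄₆_verified.cons (by decide +kernel)

end Term
end HoTT

end

/-! ### Extraction of the derivation from the verified library. -/

theorem mainTheorem10 (i : ℕ) :
    -- Under the four products, `.var 3` is `m : nat`, which stands for the truncation level
    -- `n = m - 1` (so that `n ≥ -1`), and `.var 2`, `.var 1`, `.var 0` are the types `X A B : U`,
    -- where `U` is the `i`-th universe.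
    ∃ t : HoTT.Tm, HoTT.Derivable (.typed [] t
      (HoTT.arrow (HoTT.univalence i) <|
        HoTT.arrow (HoTT.excludedMiddle i) <|
        .pi .nat <| .pi (.univ i) <| .pi (.univ i) <| .pi (.univ i) <|
        HoTT.arrow (HoTT.isTrunc i (.succ (.var 3)) (.var 2)) <|
        HoTT.arrow (HoTT.isConnected (.succ (.var 3)) (.var 1)) <|
        HoTT.arrow (HoTT.isConnected (.succ (.var 3)) (.var 0)) <|
        HoTT.arrow (HoTT.isRigid i (.var 1)) <|
        HoTT.arrow (HoTT.isRigid i (.var 0)) <|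
        HoTT.arrow (HoTT.neg (HoTT.equiv
          (HoTT.prod (.var 2) (.var 1)) (HoTT.prod (.var 2) (.var 0)))) <|
        HoTT.prod
          (HoTT.automorphismSending i
            (HoTT.prod (.var 2) (.var 1)) (HoTT.prod (.var 2) (.var 0)))
          (HoTT.prod
            (HoTT.equiv (HoTT.component i (HoTT.prod (.var 2) (.var 1)))
              (HoTT.component i (.var 2)))
            (HoTT.equiv (HoTT.component i (.var 2))
              (HoTT.component i (HoTT.prod (.var 2) (.var 0))))))) := by
  obtain ⟨γ, hγ, h⟩ := HoTT.Term.main_verified.1 i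
  -- The last constant of the library, in the empty context, is the required term.
  have h := h _ _ HoTT.Exp.constType_length [] HoTT.Derivable.ctx_nil
  have e : HoTT.Entry.typeExp HoTT.Term.mainEntry = HoTT.Term.mainExp := rfl
  rw [e, HoTT.Exp.erase_eq_of_eqb HoTT.Exp.mainExp_eqb, HoTT.Exp.erase_mainStatement hγ] at h
  exact ⟨_, h⟩
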